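/- **Setting.** A structured matrix has entries in $\{0,*,\times\}$. A complex matrix $N$ is a realization of a structured matrix $M$ if $N_{kl}=0$ whenever $M_{kl}=0$ and $N_{kl}\ne 0$ whenever $M_{kl}=\times$ (entries at $*$ positions are arbitrary). Let $\bar A\in\{0,*,\times\}^{n\times n}$ and $\bar B\in\{0,*,\times\}^{n\times m}$. A pair $(A,B)$ of complex matrices is controllable if $[B,AB,\dots,A^{n-1}B]$ has full row rank $n$. The pair $(\bar A,\bar B)$ is *structurally controllable* if some realization of the structured matrix obtained from $[\bar A,\bar B]$ by replacing every $\times$ with $*$ is controllable. It is *PSSC* (partially strongly structurally controllable) if, for Lebesgue-almost all complex values of the $*$ entries, the resulting pair is controllable for all nonzero complex values of the $\times$ entries. For a bipartite graph $G=(V^+,V^-,E)$, $\mathrm{mt}(G)$ is the maximum size of a matching; an edge is admissible if it lies in a maximum matching; a matching $\mathcal M$ covers a subgraph $H$ if $\mathcal M\cap E(H)$ is a maximum matching of $H$. A DM-decomposition (Dulmage–Mendelsohn decomposition) of $G$ is a partition of $V^+$ and $V^-$ into $V_k^{+}$, $V_k^-$ ($k=0,1,\dots,d,\infty$; the parts with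 index $0$ or $\infty$ may be empty), with components $G_k=(V_k^+,V_k^-,E_k)$, $E_k=E\cap(V_k^+\times V_k^-)$, such that: (1) $\mathrm{mt}(G_k)=|V_k^+|=|V_k^-|\geq 1$ for $1\le k\le d$; $\mathrm{mt}(G_0)=|V_0^+|<|V_0^-|$ if $V_0^+\neq\emptyset$; $\mathrm{mt}(G_\infty)=|V_\infty^-|<|V_\infty^+|$ if $V_\infty^-\ne\emptyset$; and each edge of each $G_k$ is admissible in $G_k$; (2) $G$ has an edge between $V_k^+$ and $V_l^-$ only if $k\le l$; (3) $\mathcal M\subseteq E$ is a maximum matching of $G$ if and only if $\mathcal M\subseteq\bigcup_kE_k$ and $\mathcal M\cap E_k$ is a maximum matching of $G_k$ for every $k$; (4) no decomposition with properties (1)–(3) has more nonempty components. The component $G_0$ is called the horizontal tail and $G_\infty$ the vertical tail. Let $\mathcal B=\mathcal B([\bar A,\bar B])$ be the bipartite graph with $V^+=\{v_1^+,\dots,v_n^+\}$, $V^-=\{v_1^-,\dots,v_{n+m}^-\}$ and edges $(v_k^+,v_l^-)$ for $[\bar A,\bar B]_{kl}\neq0$. Let $\mathcal B(H_\lambda)$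 be the graph obtained from $\mathcal B$ by adding the $\lambda$-edges $(v_k^+,v_k^-)$, $k=1,\dots,n$ (those not already present); a $\lambda$-edge that is also an edge of $\mathcal B$ is a self-loop. For a column index $j$ let $\mathcal B(H_\lambda^{j_c})=\mathcal B(H_\lambda)-\{v_j^-\}$, with a DM-decomposition into $G_k$, $k=0,1,\dots,d,\infty$. Let $\Omega_j$ be the set of $k\in\{1,\dots,d\}$ (so the tails are excluded) such that either two maximum matchings of $G_k$ contain different numbers of $\lambda$-edges or $G_k$ contains a self-loop. For $l\in\{1,\dots,n\}$ let $\Omega_j^l$ be the set of $k\in\Omega_j$ such that at least one maximum matching of $\mathcal B(H_\lambda^{j_c})-\{v_l^+\}$ does not cover $G_k$. **Theorem 3.** Suppose that $[\bar A,\bar B]$ has exactly one $\times$ entry, at position $(i,j)$, $1\le i\le n$, $1\le j\le n+m$. Then, for every DM-decomposition of $\mathcal B(H_\lambda^{j_c})$ (one always exists), $(\bar A,\bar B)$ is PSSC if and only if the following three statements hold. (i) $(\bar A,\bar B)$ is structurally controllable. (ii) At least one of the following holds: - d1) $\mathcal B$ has a maximum matching that does not match $v_j^-$; - d2) $\mathrm{mt}(\mathcal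 B-\{v_k^+,v_j^-\})=n-2$ for every neighbour $v_k^+\ne v_i^+$ of $v_j^-$ in $\mathcal B$ (if any); - d3) $\mathrm{mt}(\mathcal B-\{v_i^+,v_j^-\})=n-2$. (iii) At least one of the following holds: - e1) $\Omega_j^i=\emptyset$; - e2) $\Omega_j^i\neq\emptyset$, $i\neq j$, and for every neighbour $v_l^+\neq v_i^+$ of $v_j^-$ in $\mathcal B(H_\lambda)$, every maximum matching of $\mathcal B(H_\lambda^{j_c})-\{v_l^+\}$ covers $\bigcup_{k\in\Omega_j^i}G_k$. -/

import Mathlib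

open MeasureTheory

/-! ### Structured matrices, realizations, controllability -/

/-- The three kinds of entries of a structured matrix: a fixed zero, a generic entry `*` (any
complex value), and an unspecified entry `×` (any nonzero complex value). -/
inductive Entry where
  | zero
  | star
  | cross
  deriving DecidableEq

/-- The set `S_M` of realizations of a structured matrix `M`. -/
def realizations {ι κ : Type*} (M : Matrix ι κ Entry) : Set (Matrix ι κ ℂ) :=
  {N | ∀ i j, (M i j = Entry.cross → N i j ≠ 0) ∧ (M i j = Entry.zero → N i j = 0)}

/-- `M^*`: every indeterminate entry is replaced with `*`. -/
def allStar {ι κ : Type*} (M : Matrix ι κ Entry) : Matrix ι κ Entry :=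
  fun i j => if M i j = Entry.zero then Entry.zero else Entry.star

/-- The `{0,*}` summand in the splitting of `M` into its `*` entries and its `×` entries. -/
def starPart {ι κ : Type*} (M : Matrix ι κ Entry) : Matrix ι κ Entry :=
  fun i j => if M i j = Entry.star then Entry.star else Entry.zero

/-- The `{0,×}` summand in the splitting of `M` into its `*` entries and its `×` entries. -/
def crossPart {ι κ : Type*} (M : Matrix ι κ Entry) : Matrix ι κ Entry :=
  fun i j => if M i j = Entry.cross then Entry.cross else Entry.zero

/-- The positions of the `*` entries of `M`. -/
abbrev StarPos {ι κ : Type*} (M : Matrix ι κ Entry) : Type _ :=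
  {e : ι × κ // M e.1 e.2 = Entry.star}

/-- The matrix whose entry at a `*` position of `M` is the corresponding parameter, and whose other
entries are zero. For a `{0,*}` matrix `M` this parametrizes `realizations M` bijectively. -/
def ofParams {ι κ : Type*} (M : Matrix ι κ Entry) (p : StarPos M → ℂ) : Matrix ι κ ℂ :=
  fun i j => if h : M i j = Entry.star then p ⟨(i, j), h⟩ else 0

/-- The controllability matrix `[B, AB, …, A^{n-1}B]`. -/
def ctrbMatrix {n m : ℕ} (A : Matrix (Fin n) (Fin n) ℂ) (B : Matrix (Fin n) (Fin m) ℂ) :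
    Matrix (Fin n) (Fin n × Fin m) ℂ :=
  fun i kj => (A ^ (kj.1 : ℕ) * B) i kj.2

/-- `(A, B)` is controllable: its controllability matrix has full row rank. -/
def IsControllable {n m : ℕ} (A : Matrix (Fin n) (Fin n) ℂ) (B : Matrix (Fin n) (Fin m) ℂ) :
    Prop :=
  (ctrbMatrix A B).rank = n

/-- Structural controllability of the structured pair `(A, B)`. -/
def IsStructurallyControllable {n m : ℕ} (A : Matrix (Fin n) (Fin n) Entry)
    (B : Matrix (Fin n) (Fin m) Entry) : Prop :=
  ∃ (A' : Matrix (Fin n) (Fin n) ℂ) (B' : Matrix (Fin n) (Fin m) ℂ),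
    Matrix.fromCols A' B' ∈ realizations (allStar (Matrix.fromCols A B)) ∧ IsControllable A' B'

/-- Partial strong structural controllability: for Lebesgue-almost all values of the `*` entries,
the realization is controllable for all nonzero values of the `×` entries. -/
def IsPSSC {n m : ℕ} (A : Matrix (Fin n) (Fin n) Entry) (B : Matrix (Fin n) (Fin m) Entry) :
    Prop :=
  ∀ᵐ p : StarPos (starPart (Matrix.fromCols A B)) → ℂ ∂volume,
    ∀ X ∈ realizations (crossPart (Matrix.fromCols A B)),
      IsControllable (ofParams (starPart (Matrix.fromCols A B)) p + X).toCols₁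
        (ofParams (starPart (Matrix.fromCols A B)) p + X).toCols₂

/-! ### Bipartite graphs and matchings -/

/-- A finite bipartite graph `(V⁺, V⁻, E)` with `V⁺ ⊆ R` and `V⁻ ⊆ C`. -/
structure BipGraph (R C : Type*) where
  rows : Finset R
  cols : Finset C
  edges : Finset (R × C)
  edges_mem : ∀ e ∈ edges, e.1 ∈ rows ∧ e.2 ∈ cols

namespace BipGraph

variable {R C : Type*}

/-- `M` is a matching of `G`. -/
def IsMatching (G : BipGraph R C) (M : Finset (R × C)) : Prop :=
  M ⊆ G.edges ∧ ∀ e ∈ M, ∀ f ∈ M, (e.1 = f.1 ∨ e.2 = f.2) → e = f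

/-- `M` is a maximum matching of `G`, i.e. one of largest size. -/
def IsMaxMatching (G : BipGraph R C) (M : Finset (R × C)) : Prop :=
  G.IsMatching M ∧ ∀ N, G.IsMatching N → N.card ≤ M.card

/-- The size of a maximum matching of `G`. -/
noncomputable def mt (G : BipGraph R C) : ℕ :=
  sSup {k | ∃ M, G.IsMatching M ∧ M.card = k}

/-- Deletion of a vertex of `V⁺` with its incident edges. -/
def delRow [DecidableEq R] (G : BipGraph R C) (r : R) : BipGraph R C where
  rows := G.rows.erase r
  cols := G.cols
  edges := G.edges.filter (fun e => e.1 ≠ r)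
  edges_mem := fun e he => by
    rw [Finset.mem_filter] at he
    exact ⟨Finset.mem_erase.2 ⟨he.2, (G.edges_mem e he.1).1⟩, (G.edges_mem e he.1).2⟩

/-- Deletion of a vertex of `V⁻` with its incident edges. -/
def delCol [DecidableEq C] (G : BipGraph R C) (c : C) : BipGraph R C where
  rows := G.rows
  cols := G.cols.erase c
  edges := G.edges.filter (fun e => e.2 ≠ c)
  edges_mem := fun e he => by
    rw [Finset.mem_filter] at he
    exact ⟨(G.edges_mem e he.1).1, Finset.mem_erase.2 ⟨he.2, (G.edges_mem e he.1).2⟩⟩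

/-- The matching `M` covers the graph `H`: `M ∩ E(H)` is a maximum matching of `H`. -/
def Covers [DecidableEq R] [DecidableEq C] (M : Finset (R × C)) (H : BipGraph R C) : Prop :=
  H.IsMaxMatching (M ∩ H.edges)

/-- The minimum number of edges from `L` in a maximum matching of `G`. -/
noncomputable def gammaMin [DecidableEq R] [DecidableEq C] (G : BipGraph R C)
    (L : Finset (R × C)) : ℕ :=
  sInf {k | ∃ M, G.IsMaxMatching M ∧ (M ∩ L).card = k}

/-- The maximum number of edges from `L` in a maximum matching of `G`. -/
noncomputable def gammaMax [DecidableEq R] [DecidableEq C] (G : BipGraph R C)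
    (L : Finset (R × C)) : ℕ :=
  sSup {k | ∃ M, G.IsMaxMatching M ∧ (M ∩ L).card = k}

end BipGraph

/-! ### The Dulmage–Mendelsohn decomposition -/

/-- A labelling of the vertices by `0, 1, …, d, ∞`, written as the elements of `Fin (d + 2)`: the
label `0` stands for the horizontal tail, the last label for the vertical tail, and the labels in
between for the square components `1, …, d`. -/
structure BlockLabels (R C : Type*) where
  d : ℕ
  row : R → Fin (d + 2)
  col : C → Fin (d + 2)

namespace BlockLabels

variable {R C : Type*}

/-- The union of the components of `G` with labels in `K`. -/
noncomputable def unionComp (D : BlockLabels R C) (G : BipGraph R C) (K : Set (Fin (D.d + 2))) :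
    BipGraph R C := by
  classical
  exact
  { rows := G.rows.filter (fun r => D.row r ∈ K)
    cols := G.cols.filter (fun c => D.col c ∈ K)
    edges := G.edges.filter (fun e => D.row e.1 = D.col e.2 ∧ D.row e.1 ∈ K)
    edges_mem := fun e he => by
      rw [Finset.mem_filter] at he
      exact ⟨Finset.mem_filter.2 ⟨(G.edges_mem e he.1).1, he.2.2⟩,
        Finset.mem_filter.2 ⟨(G.edges_mem e he.1).2, he.2.1 ▸ he.2.2⟩⟩ }

/-- The component `G_k = (V⁺_k, V⁻_k, E_k)`: `E_k` consists of the edges of `G` between `V⁺_k` and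
`V⁻_k`. -/
def comp (D : BlockLabels R C) (G : BipGraph R C) (k : Fin (D.d + 2)) : BipGraph R C where
  rows := G.rows.filter (fun r => D.row r = k)
  cols := G.cols.filter (fun c => D.col c = k)
  edges := G.edges.filter (fun e => D.row e.1 = k ∧ D.col e.2 = k)
  edges_mem := fun e he => by
    rw [Finset.mem_filter] at he
    exact ⟨Finset.mem_filter.2 ⟨(G.edges_mem e he.1).1, he.2.1⟩,
      Finset.mem_filter.2 ⟨(G.edges_mem e he.1).2, he.2.2⟩⟩

/-- The label `k` is one of `1, …, d`. -/
def IsSquare (D : BlockLabels R C) (k : Fin (D.d + 2)) : Prop :=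
  k ≠ 0 ∧ k ≠ Fin.last (D.d + 1)

/-- The number of (nonempty) components. -/
def numComps (D : BlockLabels R C) (G : BipGraph R C) : ℕ :=
  (Finset.univ.filter
    (fun k => (D.comp G k).rows.Nonempty ∨ (D.comp G k).cols.Nonempty)).card

/-- All requirements on a DM-decomposition except that it cannot be refined. That the vertex sets
of the components partition the vertices of `G` is built into the labelling. -/
structure IsBlockDecomposition [DecidableEq R] [DecidableEq C] (D : BlockLabels R C)
    (G : BipGraph R C) : Prop where
  square : ∀ k, D.IsSquare k → (D.comp G k).rows.Nonempty ∧
    (D.comp G k).mt = (D.comp G k).rows.card ∧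
    (D.comp G k).rows.card = (D.comp G k).cols.card
  horizontal : (D.comp G 0).rows.Nonempty →
    (D.comp G 0).mt = (D.comp G 0).rows.card ∧
    (D.comp G 0).rows.card < (D.comp G 0).cols.card
  vertical : (D.comp G (Fin.last (D.d + 1))).cols.Nonempty →
    (D.comp G (Fin.last (D.d + 1))).mt = (D.comp G (Fin.last (D.d + 1))).cols.card ∧
    (D.comp G (Fin.last (D.d + 1))).cols.card < (D.comp G (Fin.last (D.d + 1))).rows.card
  admissible : ∀ k, ∀ e ∈ (D.comp G k).edges, ∃ M, (D.comp G k).IsMaxMatching M ∧ e ∈ M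
  triangular : ∀ e ∈ G.edges, D.row e.1 ≤ D.col e.2
  maxMatching_iff : ∀ M : Finset (R × C), G.IsMaxMatching M ↔
    (∀ e ∈ M, ∃ k, e ∈ (D.comp G k).edges) ∧
    ∀ k, (D.comp G k).IsMaxMatching (M ∩ (D.comp G k).edges)

/-- `D` is a Dulmage–Mendelsohn decomposition of `G`: it cannot be replaced by a decomposition of
`G` into more components with the same properties. -/
structure IsDMDecomposition [DecidableEq R] [DecidableEq C] (D : BlockLabels R C)
    (G : BipGraph R C) : Prop extends D.IsBlockDecomposition G where
  maximal : ∀ D' : BlockLabels R C, D'.IsBlockDecomposition G → D'.numComps G ≤ D.numComps G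

end BlockLabels

/-! ### Existence of the decomposition

The following lemmas serve only to prove that every finite bipartite graph has a
Dulmage–Mendelsohn decomposition in the sense above. -/

section Existence

variable {R C : Type*}

theorem BipGraph.IsMatching.card_le_rows {G : BipGraph R C} {M : Finset (R × C)}
    (h : G.IsMatching M) : M.card ≤ G.rows.card :=
  Finset.card_le_card_of_injOn Prod.fst (fun e he => (G.edges_mem e (h.1 he)).1)
    (fun e he f hf hef => h.2 e he f hf (Or.inl hef))

theorem BipGraph.IsMatching.card_le_cols {G : BipGraph R C} {M : Finset (R × C)}
    (h : G.IsMatching M) : M.card ≤ G.cols.card :=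
  Finset.card_le_card_of_injOn Prod.snd (fun e he => (G.edges_mem e (h.1 he)).2)
    (fun e he f hf hef => h.2 e he f hf (Or.inr hef))

theorem BipGraph.exists_isMaxMatching (G : BipGraph R C) : ∃ M, G.IsMaxMatching M := by
  classical
  have hne : (G.edges.powerset.filter G.IsMatching).Nonempty :=
    ⟨∅, by simp [BipGraph.IsMatching]⟩
  obtain ⟨M, hM, hmax⟩ := Finset.exists_max_image _ Finset.card hne
  rw [Finset.mem_filter] at hM
  exact ⟨M, hM.2, fun N hN => hmax N (by
    rw [Finset.mem_filter, Finset.mem_powerset]; exact ⟨hN.1, hN⟩)⟩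

theorem BipGraph.IsMaxMatching.mt_eq {G : BipGraph R C} {M : Finset (R × C)}
    (h : G.IsMaxMatching M) : G.mt = M.card := by
  apply IsGreatest.csSup_eq
  refine ⟨⟨M, h.1, rfl⟩, ?_⟩
  rintro k ⟨N, hN, rfl⟩
  exact h.2 N hN

/-- Hall's theorem in the form used below: a matching as a set of pairs. -/
theorem hall_matching [DecidableEq R] [DecidableEq C] (E : Finset (R × C)) (S : Finset R)
    (T : Finset C)
    (h : ∀ X ⊆ S, X.card ≤ (T.filter (fun c => ∃ x ∈ X, (x, c) ∈ E)).card) :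
    ∃ N ⊆ E, N.card = S.card ∧ (∀ e ∈ N, e.1 ∈ S ∧ e.2 ∈ T) ∧
      ∀ e ∈ N, ∀ f ∈ N, (e.1 = f.1 ∨ e.2 = f.2) → e = f := by
  classical
  have key := (Finset.all_card_le_biUnion_card_iff_exists_injective
    (fun x : S => T.filter (fun c => (x.1, c) ∈ E))).1 (by
      intro s
      have h1 := h (s.map (Function.Embedding.subtype _)) (by
        intro x hx
        simp only [Finset.mem_map, Function.Embedding.subtype_apply] at hx
        obtain ⟨a, _, rfl⟩ := hx
        exact a.2)
      rw [Finset.card_map] at h1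
      refine h1.trans (Finset.card_le_card ?_)
      intro c hc
      simp only [Finset.mem_filter, Finset.mem_map, Function.Embedding.subtype_apply] at hc
      obtain ⟨hcT, x, ⟨a, ha, rfl⟩, hxc⟩ := hc
      simp only [Finset.mem_biUnion, Finset.mem_filter]
      exact ⟨a, ha, hcT, hxc⟩)
  obtain ⟨f, hf, hfm⟩ := key
  simp only [Finset.mem_filter] at hfm
  refine ⟨Finset.univ.image (fun x : S => (x.1, f x)), ?_, ?_, ?_, ?_⟩
  · intro e he
    simp only [Finset.mem_image, Finset.mem_univ, true_and] at he
    obtain ⟨x, rfl⟩ := he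
    exact (hfm x).2
  · rw [Finset.card_image_of_injective, Finset.card_univ, Fintype.card_coe]
    intro x y hxy
    exact Subtype.ext (congrArg Prod.fst hxy)
  · intro e he
    simp only [Finset.mem_image, Finset.mem_univ, true_and] at he
    obtain ⟨x, rfl⟩ := he
    exact ⟨x.2, (hfm x).1⟩
  · intro e he e' he'
    simp only [Finset.mem_image, Finset.mem_univ, true_and] at he he'
    obtain ⟨x, rfl⟩ := he
    obtain ⟨y, rfl⟩ := he'
    rintro (hxy | hxy)
    · have : x = y := Subtype.ext hxy
      rw [this]
    · have : x = y := hf hxy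
      rw [this]

/-- A preorder on a finite type has a monotone labelling by an initial segment of `ℕ` whose fibres
are the classes of the preorder. -/
theorem exists_preorder_labels (α : Type*) [Finite α] (r : α → α → Prop)
    (hrefl : ∀ a, r a a) (htrans : ∀ a b c, r a b → r b c → r a c) :
    ∃ (d : ℕ) (f : α → Fin d), Function.Surjective f ∧ (∀ a b, r a b → f a ≤ f b) ∧
      ∀ a b, f a = f b → r a b := by
  classical
  let _ : Preorder α := { le := r, le_refl := hrefl, le_trans := htrans }
  have : Finite (Antisymmetrization α (· ≤ ·)) := Quotient.finite _
  let _ : Fintype (LinearExtension (Antisymmetrization α (· ≤ ·))) :=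
    Fintype.ofFinite (Antisymmetrization α (· ≤ ·))
  let g : α → LinearExtension (Antisymmetrization α (· ≤ ·)) :=
    fun a => toLinearExtension (toAntisymmetrization (· ≤ ·) a)
  let e := Fintype.orderIsoFinOfCardEq (LinearExtension (Antisymmetrization α (· ≤ ·))) rfl
  refine ⟨_, fun a => e.symm (g a), ?_, ?_, ?_⟩
  · refine e.symm.surjective.comp ?_
    intro q
    induction q using Quotient.inductionOn with
    | h a => exact ⟨a, rfl⟩
  · intro a b hab
    refine e.symm.monotone ?_
    exact toLinearExtension.monotone (toAntisymmetrization_le_toAntisymmetrization_iff.2 hab)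
  · intro a b hab
    have h1 : g a = g b := e.symm.injective hab
    have h2 : toAntisymmetrization (α := α) (· ≤ ·) a = toAntisymmetrization (· ≤ ·) b := h1
    exact toAntisymmetrization_le_toAntisymmetrization_iff.1 h2.le


/-- One step along an alternating path, from a row to a row. -/
def AltStep (G : BipGraph R C) (M : Finset (R × C)) (r r' : R) : Prop :=
  ∃ c, (r, c) ∈ G.edges ∧ (r', c) ∈ M

/-- In a counting argument: the partners of a set of matched rows. -/
theorem exists_partners [DecidableEq R] [DecidableEq C] {M : Finset (R × C)}
    (hM : ∀ e ∈ M, ∀ f ∈ M, (e.1 = f.1 ∨ e.2 = f.2) → e = f) (X : Finset R)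
    (hX : ∀ x ∈ X, ∃ c, (x, c) ∈ M) :
    ∃ Y : Finset C, Y.card = X.card ∧ ∀ c, c ∈ Y ↔ ∃ x ∈ X, (x, c) ∈ M := by
  rcases X.eq_empty_or_nonempty with rfl | ⟨x₀, hx₀⟩
  · exact ⟨∅, rfl, fun c => by simp⟩
  obtain ⟨c₀, -⟩ := hX x₀ hx₀
  have : Nonempty C := ⟨c₀⟩
  choose! μ hμ using hX
  refine ⟨X.image μ, Finset.card_image_of_injOn ?_, ?_⟩
  · intro x hx y hy hxy
    have := hM _ (hμ x hx) _ (hμ y hy) (Or.inr hxy)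
    exact congrArg Prod.fst this
  · intro c
    rw [Finset.mem_image]
    constructor
    · rintro ⟨x, hx, rfl⟩
      exact ⟨x, hx, hμ x hx⟩
    · rintro ⟨x, hx, hxc⟩
      refine ⟨x, hx, ?_⟩
      exact congrArg Prod.snd (hM _ (hμ x hx) _ hxc (Or.inl rfl))

/-- A maximum matching has no augmenting path. -/
theorem no_augmenting [DecidableEq R] [DecidableEq C] {G : BipGraph R C} {M : Finset (R × C)}
    (hM : G.IsMaxMatching M) {r₀ r : R} {c : C} (hr₀M : ∀ c, (r₀, c) ∉ M)
    (hreach : Relation.ReflTransGen (AltStep G M) r₀ r) (hrc : (r, c) ∈ G.edges)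
    (hcM : ∀ r, (r, c) ∉ M) : False := by
  classical
  let S : Finset R := insert r₀ (M.image Prod.fst)
  have hmat : ∀ x ∈ M.image Prod.fst, ∃ c, (x, c) ∈ M := by
    intro x hx
    rw [Finset.mem_image] at hx
    obtain ⟨e, he, rfl⟩ := hx
    exact ⟨e.2, he⟩
  have hr₀S : r₀ ∉ M.image Prod.fst := fun h => by
    obtain ⟨c, hc⟩ := hmat r₀ h
    exact hr₀M c hc
  have hScard : S.card = M.card + 1 := by
    rw [Finset.card_insert_of_notMem hr₀S, Finset.card_image_of_injOn]
    intro e he f hf hef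
    exact hM.1.2 e he f hf (Or.inl hef)
  obtain ⟨N, hNE, hNc, -, hN⟩ := hall_matching G.edges S G.cols (by
    intro X hX
    by_contra hlt
    push Not at hlt
    obtain ⟨Y, hYc, hY⟩ := exists_partners hM.1.2 (X.erase r₀) (by
      intro x hx
      rw [Finset.mem_erase] at hx
      have := hX hx.2
      rw [Finset.mem_insert] at this
      exact hmat x (this.resolve_left hx.1))
    have hsub : Y ⊆ G.cols.filter (fun c => ∃ x ∈ X, (x, c) ∈ G.edges) := by
      intro c' hc'
      obtain ⟨x, hx, hxc⟩ := (hY c').1 hc'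
      have := hM.1.1 hxc
      exact Finset.mem_filter.2 ⟨(G.edges_mem _ this).2, x, (Finset.mem_erase.1 hx).2, this⟩
    have hle := Finset.card_le_card hsub
    have hr₀X : r₀ ∈ X := by
      by_contra h
      rw [Finset.erase_eq_of_notMem h] at hYc
      omega
    have h1 := Finset.card_erase_add_one hr₀X
    have heq := Finset.eq_of_subset_of_card_le hsub (by omega)
    have hclosed : ∀ y, Relation.ReflTransGen (AltStep G M) r₀ y → y ∈ X := by
      intro y hy
      induction hy with
      | refl => exact hr₀X
      | tail _ hstep ih =>
        obtain ⟨c', hc', hc''⟩ := hstep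
        have : c' ∈ Y := by
          rw [heq]
          exact Finset.mem_filter.2 ⟨(G.edges_mem _ hc').2, _, ih, hc'⟩
        obtain ⟨x, hx, hxc⟩ := (hY c').1 this
        have := congrArg Prod.fst (hM.1.2 _ hxc _ hc'' (Or.inr rfl))
        simp only at this
        rw [← this]
        exact (Finset.mem_erase.1 hx).2
    have : c ∈ Y := by
      rw [heq]
      exact Finset.mem_filter.2 ⟨(G.edges_mem _ hrc).2, r, hclosed r hreach, hrc⟩
    obtain ⟨x, -, hxc⟩ := (hY c).1 this
    exact hcM x hxc)
  have := hM.2 N ⟨hNE, hN⟩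
  omega

/-- The properties of a labelling, relative to a maximum matching, from which the properties of a
decomposition are derived. -/
structure GoodLabels (G : BipGraph R C) (M : Finset (R × C)) (D : BlockLabels R C) : Prop where
  matched : ∀ r c, (r, c) ∈ M → D.row r = D.col c
  tri : ∀ r c, (r, c) ∈ G.edges → D.row r ≤ D.col c
  row_matched : ∀ r ∈ G.rows, D.row r ≠ Fin.last (D.d + 1) → ∃ c, (r, c) ∈ M
  col_matched : ∀ c ∈ G.cols, D.col c ≠ 0 → ∃ r, (r, c) ∈ M
  zero : ∀ r ∈ G.rows, D.row r = 0 →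
    ∃ r' c, Relation.ReflTransGen (AltStep G M) r r' ∧ (r', c) ∈ G.edges ∧ ∀ x, (x, c) ∉ M
  last : ∀ r ∈ G.rows, D.row r = Fin.last (D.d + 1) →
    ∃ r₀ ∈ G.rows, (∀ c, (r₀, c) ∉ M) ∧ Relation.ReflTransGen (AltStep G M) r₀ r
  surj : ∀ k, D.IsSquare k → ∃ r ∈ G.rows, D.row r = k
  conn : ∀ r ∈ G.rows, ∀ r' ∈ G.rows, D.IsSquare (D.row r) → D.row r = D.row r' →
    Relation.ReflTransGen (AltStep G M) r r'

theorem exists_goodLabels [DecidableEq R] [DecidableEq C] {G : BipGraph R C}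
    {M : Finset (R × C)} (hM : G.IsMaxMatching M) : ∃ D, GoodLabels G M D := by
  classical
  let H : R → Prop := fun r => ∃ r' c, Relation.ReflTransGen (AltStep G M) r r' ∧
    (r', c) ∈ G.edges ∧ ∀ x, (x, c) ∉ M
  let V : R → Prop := fun r => ∃ r₀ ∈ G.rows, (∀ c, (r₀, c) ∉ M) ∧
    Relation.ReflTransGen (AltStep G M) r₀ r
  have hHV : ∀ r, H r → V r → False := by
    rintro r ⟨r', c, h1, h2, h3⟩ ⟨r₀, -, h5, h6⟩
    exact no_augmenting hM h5 (h6.trans h1) h2 h3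
  let Sq : R → Prop := fun r => r ∈ G.rows ∧ ¬ H r ∧ ¬ V r
  have : Finite {r // Sq r} :=
    Finite.of_injective (fun r : {r // Sq r} => (⟨r.1, r.2.1⟩ : G.rows)) (by
      intro a b hab
      have h : a.1 = b.1 := congrArg (fun z : G.rows => z.1) hab
      exact Subtype.ext h)
  obtain ⟨d, f, hfs, hfm, hfi⟩ := exists_preorder_labels {r // Sq r}
    (fun a b => Relation.ReflTransGen (AltStep G M) a.1 b.1)
    (fun a => Relation.ReflTransGen.refl) (fun a b c => Relation.ReflTransGen.trans)
  let row : R → Fin (d + 2) := fun r =>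
    if H r then 0 else if h : Sq r then (f ⟨r, h⟩).castSucc.succ else Fin.last (d + 1)
  let col : C → Fin (d + 2) := fun c => if h : ∃ r, (r, c) ∈ M then row h.choose else 0
  have hcol : ∀ r c, (r, c) ∈ M → row r = col c := by
    intro r c hrc
    have h : ∃ r, (r, c) ∈ M := ⟨r, hrc⟩
    have h2 : r = h.choose :=
      congrArg Prod.fst (hM.1.2 _ hrc _ h.choose_spec (Or.inr rfl))
    simp only [col, dif_pos h]
    rw [← h2]
  have hrow0 : ∀ r, row r = 0 → H r := by
    intro r hr
    by_contra hH
    simp only [row, if_neg hH] at hr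
    split_ifs at hr with h
    · exact Fin.succ_ne_zero _ hr
    · exact absurd hr (Fin.last_pos).ne'
  have hrowH : ∀ r, H r → row r = 0 := fun r hr => by simp only [row, if_pos hr]
  have hrowV : ∀ r, V r → row r = Fin.last (d + 1) := fun r hr => by
    have h1 : ¬ H r := fun h => hHV r h hr
    have h2 : ¬ Sq r := fun h => h.2.2 hr
    simp only [row, if_neg h1, dif_neg h2]
  have hrowS : ∀ r (h : Sq r), row r = (f ⟨r, h⟩).castSucc.succ := fun r h => by
    simp only [row, if_neg h.2.1, dif_pos h]
  have hne : ∀ x : Fin d, x.castSucc.succ ≠ Fin.last (d + 1) := by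
    intro x hx
    have := congrArg Fin.val hx
    have := x.2
    simp at *
    try omega
  have hrowL : ∀ r ∈ G.rows, row r = Fin.last (d + 1) → V r := by
    intro r hrG hr
    by_contra hV
    by_cases hH : H r
    · rw [hrowH r hH] at hr
      exact absurd hr (Fin.last_pos).ne
    · rw [hrowS r ⟨hrG, hH, hV⟩] at hr
      exact hne _ hr
  refine ⟨⟨d, row, col⟩, hcol, ?_, ?_, ?_, ?_, ?_, ?_, ?_⟩
  · intro r c hrc
    change row r ≤ col c
    by_cases hH : H r
    · rw [hrowH r hH]; exact Fin.zero_le _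
    by_cases hc : ∃ r', (r', c) ∈ M
    · obtain ⟨r', hr'⟩ := hc
      rw [← hcol r' c hr']
      have hstep : AltStep G M r r' := ⟨c, hrc, hr'⟩
      have hH' : ¬ H r' := by
        rintro ⟨r₁, c₁, h1, h2⟩
        exact hH ⟨r₁, c₁, Relation.ReflTransGen.head hstep h1, h2⟩
      by_cases hV' : V r'
      · rw [hrowV r' hV']; exact Fin.le_last _
      have hV : ¬ V r := by
        rintro ⟨r₀, h0, h1, h2⟩
        exact hV' ⟨r₀, h0, h1, h2.tail hstep⟩
      have hs : Sq r := ⟨(G.edges_mem _ hrc).1, hH, hV⟩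
      have hs' : Sq r' := ⟨(G.edges_mem _ (hM.1.1 hr')).1, hH', hV'⟩
      rw [hrowS r hs, hrowS r' hs']
      have := hfm ⟨r, hs⟩ ⟨r', hs'⟩ (Relation.ReflTransGen.single hstep)
      exact Fin.succ_le_succ_iff.2 (Fin.castSucc_le_castSucc_iff.2 this)
    · exact absurd ⟨r, c, Relation.ReflTransGen.refl, hrc, fun x hx => hc ⟨x, hx⟩⟩ hH
  · intro r hr hl
    by_contra hc
    push Not at hc
    exact hl (hrowV r ⟨r, hr, hc, Relation.ReflTransGen.refl⟩)
  · intro c _ h0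
    by_contra hc
    exact h0 (by simp only [col, dif_neg hc])
  · intro r _ hr
    exact hrow0 r hr
  · intro r hrG hr
    exact hrowL r hrG hr
  · rintro k ⟨hk0, hkl⟩
    change k ≠ 0 at hk0
    change k ≠ Fin.last (d + 1) at hkl
    obtain ⟨k', rfl⟩ := Fin.exists_succ_eq.2 hk0
    have hk' : k' ≠ Fin.last d := fun h => hkl (by rw [h]; rfl)
    obtain ⟨k'', rfl⟩ := Fin.exists_castSucc_eq.2 hk'
    obtain ⟨x, rfl⟩ := hfs k''
    exact ⟨x.1, x.2.1, hrowS x.1 x.2⟩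
  · intro r hr r' hr' hsq heq
    obtain ⟨h0, hl⟩ := hsq
    change row r ≠ 0 at h0
    change row r ≠ Fin.last (d + 1) at hl
    change row r = row r' at heq
    have hs : Sq r := ⟨hr, fun h => h0 (hrowH r h), fun h => hl (hrowV r h)⟩
    have hs' : Sq r' := ⟨hr', fun h => h0 (heq.trans (hrowH r' h)),
      fun h => hl (heq.trans (hrowV r' h))⟩
    rw [hrowS r hs, hrowS r' hs'] at heq
    exact hfi ⟨r, hs⟩ ⟨r', hs'⟩ (Fin.castSucc_injective _ (Fin.succ_injective _ heq))

theorem GoodLabels.card_rows [DecidableEq R] [DecidableEq C] {G : BipGraph R C}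
    {M : Finset (R × C)} {D : BlockLabels R C} (hM : G.IsMaxMatching M) (h : GoodLabels G M D)
    (p : Fin (D.d + 2) → Prop) [DecidablePred p] (hp : ¬ p (Fin.last (D.d + 1))) :
    (G.rows.filter (fun r => p (D.row r))).card = (M.filter (fun e => p (D.row e.1))).card := by
  rw [← Finset.card_image_of_injOn (s := M.filter _) (f := Prod.fst)]
  · congr 1
    ext r
    simp only [Finset.mem_filter, Finset.mem_image]
    constructor
    · rintro ⟨hr, hpr⟩
      obtain ⟨c, hc⟩ := h.row_matched r hr (fun hl => hp (hl ▸ hpr))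
      exact ⟨(r, c), ⟨hc, hpr⟩, rfl⟩
    · rintro ⟨e, ⟨he, hpe⟩, rfl⟩
      exact ⟨(G.edges_mem e (hM.1.1 he)).1, hpe⟩
  · intro e he f hf hef
    exact hM.1.2 e (Finset.mem_filter.1 he).1 f (Finset.mem_filter.1 hf).1 (Or.inl hef)

theorem GoodLabels.card_cols [DecidableEq R] [DecidableEq C] {G : BipGraph R C}
    {M : Finset (R × C)} {D : BlockLabels R C} (hM : G.IsMaxMatching M) (h : GoodLabels G M D)
    (p : Fin (D.d + 2) → Prop) [DecidablePred p] (hp : ¬ p 0) :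
    (G.cols.filter (fun c => p (D.col c))).card = (M.filter (fun e => p (D.row e.1))).card := by
  rw [← Finset.card_image_of_injOn (s := M.filter _) (f := Prod.snd)]
  · congr 1
    ext c
    simp only [Finset.mem_filter, Finset.mem_image]
    constructor
    · rintro ⟨hc, hpc⟩
      obtain ⟨r, hr⟩ := h.col_matched c hc (fun hl => hp (hl ▸ hpc))
      exact ⟨(r, c), ⟨hr, by rw [h.matched r c hr]; exact hpc⟩, rfl⟩
    · rintro ⟨⟨r, c⟩, ⟨he, hpe⟩, rfl⟩
      exact ⟨(G.edges_mem _ (hM.1.1 he)).2, by rw [← h.matched r c he]; exact hpe⟩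
  · intro e he f hf hef
    exact hM.1.2 e (Finset.mem_filter.1 he).1 f (Finset.mem_filter.1 hf).1 (Or.inr hef)

theorem GoodLabels.inter_comp [DecidableEq R] [DecidableEq C] {G : BipGraph R C}
    {M : Finset (R × C)} {D : BlockLabels R C} (hM : G.IsMaxMatching M) (h : GoodLabels G M D)
    (k : Fin (D.d + 2)) :
    M ∩ (D.comp G k).edges = M.filter (fun e => D.row e.1 = k) := by
  ext ⟨r, c⟩
  simp only [Finset.mem_inter, BlockLabels.comp, Finset.mem_filter]
  constructor
  · rintro ⟨h1, -, h2, -⟩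
    exact ⟨h1, h2⟩
  · rintro ⟨h1, h2⟩
    exact ⟨h1, hM.1.1 h1, h2, by rw [← h.matched r c h1]; exact h2⟩

theorem inter_comp_isMatching [DecidableEq R] [DecidableEq C] {G : BipGraph R C}
    {N : Finset (R × C)} {D : BlockLabels R C} (hN : G.IsMatching N) (k : Fin (D.d + 2)) :
    (D.comp G k).IsMatching (N ∩ (D.comp G k).edges) :=
  ⟨Finset.inter_subset_right, fun e he f hf => hN.2 e (Finset.mem_inter.1 he).1 f
    (Finset.mem_inter.1 hf).1⟩

theorem GoodLabels.comp_isMaxMatching [DecidableEq R] [DecidableEq C] {G : BipGraph R C}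
    {M : Finset (R × C)} {D : BlockLabels R C} (hM : G.IsMaxMatching M) (h : GoodLabels G M D)
    (k : Fin (D.d + 2)) : (D.comp G k).IsMaxMatching (M ∩ (D.comp G k).edges) := by
  refine ⟨inter_comp_isMatching hM.1 k, fun N hN => ?_⟩
  rw [h.inter_comp hM]
  by_cases hk : k = Fin.last (D.d + 1)
  · have h0 : (0 : Fin (D.d + 2)) ≠ k := by rw [hk]; exact (Fin.last_pos).ne
    rw [← h.card_cols hM (fun x => x = k) h0]
    exact hN.card_le_cols
  · rw [← h.card_rows hM (fun x => x = k) (fun hl => hk hl.symm)]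
    exact hN.card_le_rows

theorem GoodLabels.maxMatching_iff [DecidableEq R] [DecidableEq C] {G : BipGraph R C}
    {M : Finset (R × C)} {D : BlockLabels R C} (hM : G.IsMaxMatching M) (h : GoodLabels G M D)
    (N : Finset (R × C)) : G.IsMaxMatching N ↔
      (∀ e ∈ N, ∃ k, e ∈ (D.comp G k).edges) ∧
      ∀ k, (D.comp G k).IsMaxMatching (N ∩ (D.comp G k).edges) := by
  have hsum : ∀ N : Finset (R × C), (∀ e ∈ N, ∃ k, e ∈ (D.comp G k).edges) →
      N.card = ∑ k, (N ∩ (D.comp G k).edges).card := by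
    intro N hN
    rw [Finset.card_eq_sum_card_fiberwise (f := fun e => D.row e.1) (t := Finset.univ)
      (fun _ _ => Finset.mem_coe.2 (Finset.mem_univ _))]
    refine Finset.sum_congr rfl fun k _ => ?_
    congr 1
    ext e
    simp only [Finset.mem_filter, Finset.mem_inter]
    constructor
    · rintro ⟨h1, h2⟩
      obtain ⟨k', hk'⟩ := hN e h1
      have h3 := (Finset.mem_filter.1 hk').2.1
      have : k' = k := h3.symm.trans h2
      exact ⟨h1, this ▸ hk'⟩
    · rintro ⟨h1, h2⟩
      exact ⟨h1, (Finset.mem_filter.1 h2).2.1⟩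
  have hMk : ∀ e ∈ M, ∃ k, e ∈ (D.comp G k).edges := by
    rintro ⟨r, c⟩ he
    exact ⟨D.row r, Finset.mem_filter.2 ⟨hM.1.1 he, rfl, (h.matched r c he).symm⟩⟩
  have hMc := h.comp_isMaxMatching hM
  constructor
  · intro hN
    have hcard : N.card = M.card := le_antisymm (hM.2 N hN.1) (hN.2 M hM.1)
    have hNk : ∀ e ∈ N, ∃ k, e ∈ (D.comp G k).edges := by
      rintro ⟨r, c⟩ he
      refine ⟨D.row r, Finset.mem_filter.2 ⟨hN.1.1 he, rfl, ?_⟩⟩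
      by_contra hne
      have hlt : D.row r < D.col c := lt_of_le_of_ne (h.tri r c (hN.1.1 he)) (fun h => hne h.symm)
      set b := D.col c with hb
      have hA := h.card_rows hM (fun x => x < b) (fun hl => absurd (Fin.le_last b) (not_le.2 hl))
      have hB := h.card_cols hM (fun x => ¬ x < b)
        (fun h0 => h0 (lt_of_le_of_lt (Fin.zero_le _) hlt))
      have hMsplit := Finset.card_filter_add_card_filter_not (s := M) (fun e => D.row e.1 < b)
      have hNsplit := Finset.card_filter_add_card_filter_not (s := N) (fun e => D.row e.1 < b)
      have hNA : (N.filter (fun e => D.row e.1 < b)).card ≤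
          (G.rows.filter (fun r => D.row r < b)).card := by
        refine Finset.card_le_card_of_injOn Prod.fst ?_ ?_
        · intro e he
          obtain ⟨h1, h2⟩ := Finset.mem_filter.1 he
          exact Finset.mem_filter.2 ⟨(G.edges_mem e (hN.1.1 h1)).1, h2⟩
        · intro e he f hf hef
          exact hN.1.2 e (Finset.mem_filter.1 he).1 f (Finset.mem_filter.1 hf).1 (Or.inl hef)
      have hcmem : c ∈ G.cols.filter (fun c => ¬ D.col c < b) :=
        Finset.mem_filter.2 ⟨(G.edges_mem _ (hN.1.1 he)).2, by rw [← hb]; exact lt_irrefl b⟩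
      have hNB : (N.filter (fun e => ¬ D.row e.1 < b)).card ≤
          ((G.cols.filter (fun c => ¬ D.col c < b)).erase c).card := by
        refine Finset.card_le_card_of_injOn Prod.snd ?_ ?_
        · intro e he'
          obtain ⟨h1, h2⟩ := Finset.mem_filter.1 he'
          refine Finset.mem_coe.2 (Finset.mem_erase.2 ⟨?_, Finset.mem_filter.2
            ⟨(G.edges_mem e (hN.1.1 h1)).2, fun h3 => h2 ?_⟩⟩)
          · intro hec
            have := hN.1.2 e h1 (r, c) he (Or.inr hec)
            rw [this] at h2
            exact h2 hlt
          · exact lt_of_le_of_lt (h.tri e.1 e.2 (hN.1.1 h1)) h3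
        · intro e he f hf hef
          exact hN.1.2 e (Finset.mem_filter.1 he).1 f (Finset.mem_filter.1 hf).1 (Or.inr hef)
      have := Finset.card_erase_add_one hcmem
      omega
    refine ⟨hNk, fun k => ⟨inter_comp_isMatching hN.1 k, fun N' hN' => ?_⟩⟩
    have hle : ∀ k ∈ Finset.univ, (N ∩ (D.comp G k).edges).card ≤ (M ∩ (D.comp G k).edges).card :=
      fun k _ => (hMc k).2 _ (inter_comp_isMatching hN.1 k)
    have heq := (Finset.sum_eq_sum_iff_of_le hle).1
      (by rw [← hsum N hNk, ← hsum M hMk, hcard]) k (Finset.mem_univ k)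
    rw [heq]
    exact (hMc k).2 N' hN'
  · rintro ⟨hNk, hNc⟩
    refine ⟨⟨?_, ?_⟩, fun N' hN' => (hM.2 N' hN').trans ?_⟩
    · intro e he
      obtain ⟨k, hk⟩ := hNk e he
      exact (Finset.mem_filter.1 hk).1
    · intro e he f hf hef
      obtain ⟨k, hk⟩ := hNk e he
      obtain ⟨k', hk'⟩ := hNk f hf
      have h1 := (Finset.mem_filter.1 hk).2
      have h2 := (Finset.mem_filter.1 hk').2
      have hkk : k = k' := by
        rcases hef with hef | hef
        · rw [← h1.1, ← h2.1, hef]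
        · rw [← h1.2, ← h2.2, hef]
      subst hkk
      exact (hNc k).1.2 e (Finset.mem_inter.2 ⟨he, hk⟩) f (Finset.mem_inter.2 ⟨hf, hk'⟩) hef
    · rw [hsum N hNk, hsum M hMk]
      exact Finset.sum_le_sum fun k _ => (hNc k).2 _ (hMc k).1

/-- Every edge of a component which is not the vertical tail is admissible. -/
theorem GoodLabels.admissible_rows [DecidableEq R] [DecidableEq C] {G : BipGraph R C}
    {M : Finset (R × C)} {D : BlockLabels R C} (hM : G.IsMaxMatching M) (h : GoodLabels G M D)
    (k : Fin (D.d + 2)) (hk : k ≠ Fin.last (D.d + 1)) (r : R) (c : C)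
    (he : (r, c) ∈ (D.comp G k).edges) :
    ∃ N, (D.comp G k).IsMaxMatching N ∧ (r, c) ∈ N := by
  obtain ⟨heG, hrk, hck⟩ := Finset.mem_filter.1 he
  simp only at hrk hck
  have hrmem := ((D.comp G k).edges_mem _ he).1
  obtain ⟨N, hNE, hNc, hNm, hN⟩ := hall_matching (D.comp G k).edges
    ((D.comp G k).rows.erase r) ((D.comp G k).cols.erase c) (by
    intro X hX
    by_contra hlt
    push Not at hlt
    have hXk : ∀ x ∈ X, x ∈ G.rows ∧ D.row x = k := fun x hx =>
      Finset.mem_filter.1 (Finset.mem_erase.1 (hX hx)).2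
    obtain ⟨Y, hYc, hY⟩ := exists_partners hM.1.2 X (fun x hx =>
      h.row_matched x (hXk x hx).1 (by rw [(hXk x hx).2]; exact hk))
    have hsub : Y.erase c ⊆ ((D.comp G k).cols.erase c).filter
        (fun c => ∃ x ∈ X, (x, c) ∈ (D.comp G k).edges) := by
      intro c' hc'
      obtain ⟨hne, hc'⟩ := Finset.mem_erase.1 hc'
      obtain ⟨x, hx, hxc⟩ := (hY c').1 hc'
      have hxe : (x, c') ∈ (D.comp G k).edges := Finset.mem_filter.2
        ⟨hM.1.1 hxc, (hXk x hx).2, (h.matched x c' hxc).symm.trans (hXk x hx).2⟩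
      exact Finset.mem_filter.2 ⟨Finset.mem_erase.2
        ⟨hne, ((D.comp G k).edges_mem _ hxe).2⟩, x, hx, hxe⟩
    have hle := Finset.card_le_card hsub
    have hcY : c ∈ Y := by
      by_contra hc
      rw [Finset.erase_eq_of_notMem hc] at hle
      omega
    have h1 := Finset.card_erase_add_one hcY
    have heq := Finset.eq_of_subset_of_card_le hsub (by omega)
    -- the columns adjacent to `X` inside the component are the partners of `X`
    have hadj : ∀ x ∈ X, ∀ c', (x, c') ∈ G.edges → D.col c' = k → c' ∈ Y := by
      intro x hx c' hxc hc'
      by_cases hcc : c' = c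
      · rw [hcc]; exact hcY
      have hxe : (x, c') ∈ (D.comp G k).edges :=
        Finset.mem_filter.2 ⟨hxc, (hXk x hx).2, hc'⟩
      have : c' ∈ Y.erase c := by
        rw [heq]
        exact Finset.mem_filter.2 ⟨Finset.mem_erase.2
          ⟨hcc, ((D.comp G k).edges_mem _ hxe).2⟩, x, hx, hxe⟩
      exact Finset.mem_of_mem_erase this
    obtain ⟨x₁, hx₁, hx₁c⟩ := (hY c).1 hcY
    have hmono : ∀ x y, Relation.ReflTransGen (AltStep G M) x y → D.row x ≤ D.row y := by
      intro x y hxy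
      induction hxy with
      | refl => exact le_rfl
      | tail _ hs ih =>
        obtain ⟨c', h2, h3⟩ := hs
        exact ih.trans ((h.tri _ _ h2).trans (h.matched _ _ h3).ge)
    have hclosed : ∀ y, Relation.ReflTransGen (AltStep G M) x₁ y → D.row y ≤ k → y ∈ X := by
      intro y hy
      induction hy with
      | refl => exact fun _ => hx₁
      | @tail y z hxy hs ih =>
        intro hz
        obtain ⟨c', h2, h3⟩ := hs
        have hyz : D.row y ≤ D.row z := (h.tri _ _ h2).trans (h.matched _ _ h3).ge
        have hy := ih (hyz.trans hz)
        have hzk : D.row z = k := le_antisymm hz ((hXk y hy).2 ▸ hyz)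
        have hc' := hadj y hy c' h2 ((h.matched _ _ h3).symm.trans hzk)
        obtain ⟨w, hw, hwc⟩ := (hY c').1 hc'
        have := congrArg Prod.fst (hM.1.2 _ hwc _ h3 (Or.inr rfl))
        simp only at this
        rw [← this]
        exact hw
    by_cases hk0 : k = 0
    · obtain ⟨r', c', h2, h3, h4⟩ := h.zero x₁ (hXk x₁ hx₁).1 ((hXk x₁ hx₁).2.trans hk0)
      have hc0 : D.col c' = 0 := by
        by_contra hc0
        obtain ⟨y, hy⟩ := h.col_matched c' (G.edges_mem _ h3).2 hc0
        exact h4 y hy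
      have hr'0 : D.row r' ≤ k := by rw [hk0, ← hc0]; exact h.tri _ _ h3
      obtain ⟨w, -, hwc⟩ := (hY c').1
        (hadj r' (hclosed r' h2 hr'0) c' h3 (hc0.trans hk0.symm))
      exact h4 w hwc
    · have hxr := h.conn x₁ (hXk x₁ hx₁).1 r (G.edges_mem _ heG).1
        (by rw [(hXk x₁ hx₁).2]; exact ⟨hk0, hk⟩) ((hXk x₁ hx₁).2.trans hrk.symm)
      exact (Finset.mem_erase.1 (hX (hclosed r hxr hrk.le))).1 rfl)
  have hnot : (r, c) ∉ N := fun hmem => (Finset.mem_erase.1 (hNm _ hmem).1).1 rfl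
  refine ⟨insert (r, c) N, ⟨⟨?_, ?_⟩, ?_⟩, Finset.mem_insert_self _ _⟩
  · intro e hee
    rcases Finset.mem_insert.1 hee with rfl | hee
    · exact he
    · exact hNE hee
  · intro e hee f hff hef
    rcases Finset.mem_insert.1 hee with rfl | hee <;> rcases Finset.mem_insert.1 hff with rfl | hff
    · rfl
    · rcases hef with hef | hef
      · exact absurd hef.symm (Finset.mem_erase.1 (hNm _ hff).1).1
      · exact absurd hef.symm (Finset.mem_erase.1 (hNm _ hff).2).1
    · rcases hef with hef | hef
      · exact absurd hef (Finset.mem_erase.1 (hNm _ hee).1).1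
      · exact absurd hef (Finset.mem_erase.1 (hNm _ hee).2).1
    · exact hN e hee f hff hef
  · intro N' hN'
    rw [Finset.card_insert_of_notMem hnot, hNc, Finset.card_erase_add_one hrmem]
    exact hN'.card_le_rows

/-- Every edge of the vertical tail is admissible. -/
theorem GoodLabels.admissible_last [DecidableEq R] [DecidableEq C] {G : BipGraph R C}
    {M : Finset (R × C)} {D : BlockLabels R C} (hM : G.IsMaxMatching M) (h : GoodLabels G M D)
    (k : Fin (D.d + 2)) (hk : k = Fin.last (D.d + 1)) (r : R) (c : C)
    (he : (r, c) ∈ (D.comp G k).edges) :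
    ∃ N, (D.comp G k).IsMaxMatching N ∧ (r, c) ∈ N := by
  have hk0 : k ≠ 0 := by rw [hk]; exact (Fin.last_pos).ne'
  have hcmem := ((D.comp G k).edges_mem _ he).2
  have hswap : ∀ (E : Finset (R × C)) (x : R) (y : C), (y, x) ∈ E.image Prod.swap ↔ (x, y) ∈ E := by
    intro E x y
    rw [Finset.mem_image]
    constructor
    · rintro ⟨⟨a, b⟩, hab, h2⟩
      simp only [Prod.swap_prod_mk, Prod.mk.injEq] at h2
      obtain ⟨rfl, rfl⟩ := h2
      exact hab
    · intro hxy
      exact ⟨(x, y), hxy, rfl⟩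
  have hMs : ∀ e ∈ M.image Prod.swap, ∀ f ∈ M.image Prod.swap,
      (e.1 = f.1 ∨ e.2 = f.2) → e = f := by
    rintro ⟨b, a⟩ h1 ⟨b', a'⟩ h2 h3
    have := hM.1.2 _ ((hswap M a b).1 h1) _ ((hswap M a' b').1 h2) h3.symm
    simp only [Prod.mk.injEq] at this ⊢
    exact this.symm
  obtain ⟨N, hNE, hNc, hNm, hN⟩ := hall_matching ((D.comp G k).edges.image Prod.swap)
    ((D.comp G k).cols.erase c) ((D.comp G k).rows.erase r) (by
    intro X hX
    by_contra hlt
    push Not at hlt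
    have hXk : ∀ x ∈ X, x ∈ G.cols ∧ D.col x = k := fun x hx =>
      Finset.mem_filter.1 (Finset.mem_erase.1 (hX hx)).2
    obtain ⟨Y, hYc, hY⟩ := exists_partners hMs X (fun x hx => by
      obtain ⟨y, hy⟩ := h.col_matched x (hXk x hx).1 (by rw [(hXk x hx).2]; exact hk0)
      exact ⟨y, (hswap M y x).2 hy⟩)
    have hYM : ∀ y, y ∈ Y → ∃ x ∈ X, (y, x) ∈ M := fun y hy => by
      obtain ⟨x, hx, hxy⟩ := (hY y).1 hy
      exact ⟨x, hx, (hswap M y x).1 hxy⟩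
    have hsub : Y.erase r ⊆ ((D.comp G k).rows.erase r).filter
        (fun y => ∃ x ∈ X, (x, y) ∈ (D.comp G k).edges.image Prod.swap) := by
      intro y hy
      obtain ⟨hne, hy⟩ := Finset.mem_erase.1 hy
      obtain ⟨x, hx, hyx⟩ := hYM y hy
      have hxe : (y, x) ∈ (D.comp G k).edges := Finset.mem_filter.2
        ⟨hM.1.1 hyx, (h.matched y x hyx).trans (hXk x hx).2, (hXk x hx).2⟩
      exact Finset.mem_filter.2 ⟨Finset.mem_erase.2
        ⟨hne, ((D.comp G k).edges_mem _ hxe).1⟩, x, hx, (hswap _ y x).2 hxe⟩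
    have hle := Finset.card_le_card hsub
    have hrY : r ∈ Y := by
      by_contra hr
      rw [Finset.erase_eq_of_notMem hr] at hle
      omega
    have h1 := Finset.card_erase_add_one hrY
    have heq := Finset.eq_of_subset_of_card_le hsub (by omega)
    have hadj : ∀ x ∈ X, ∀ y, (y, x) ∈ G.edges → D.row y = k → y ∈ Y := by
      intro x hx y hyx hyk
      by_cases hyr : y = r
      · rw [hyr]; exact hrY
      have hxe : (y, x) ∈ (D.comp G k).edges :=
        Finset.mem_filter.2 ⟨hyx, hyk, (hXk x hx).2⟩
      have : y ∈ Y.erase r := by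
        rw [heq]
        exact Finset.mem_filter.2 ⟨Finset.mem_erase.2
          ⟨hyr, ((D.comp G k).edges_mem _ hxe).1⟩, x, hx, (hswap _ y x).2 hxe⟩
      exact Finset.mem_of_mem_erase this
    obtain ⟨x₁, hx₁, hrx₁⟩ := hYM r hrY
    have hrG : r ∈ G.rows := (G.edges_mem _ (hM.1.1 hrx₁)).1
    obtain ⟨r₀, hr₀, hr₀M, hreach⟩ := h.last r hrG
      ((h.matched _ _ hrx₁).trans ((hXk x₁ hx₁).2.trans hk))
    have hback : ∀ y z, Relation.ReflTransGen (AltStep G M) y z → D.row y = k → z ∈ Y →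
        y ∈ Y := by
      intro y z hyz
      induction hyz using Relation.ReflTransGen.head_induction_on with
      | refl => exact fun _ hz => hz
      | @head y w hs _ ih =>
        intro hyk hz
        obtain ⟨c', h2, h3⟩ := hs
        have hwk : D.row w = k := by
          refine le_antisymm (hk ▸ Fin.le_last _) ?_
          rw [← hyk]
          exact (h.tri _ _ h2).trans (h.matched _ _ h3).ge
        obtain ⟨x, hx, hwx⟩ := hYM w (ih hwk hz)
        have := congrArg Prod.snd (hM.1.2 _ hwx _ h3 (Or.inl rfl))
        simp only at this
        exact hadj x hx y (this ▸ h2) hyk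
    have hr₀k : D.row r₀ = k := by
      by_contra hne
      obtain ⟨c', hc'⟩ := h.row_matched r₀ hr₀ (hk ▸ hne)
      exact hr₀M c' hc'
    obtain ⟨x, -, hx⟩ := hYM r₀ (hback r₀ r hreach hr₀k hrY)
    exact hr₀M x hx)
  have hNE' : ∀ x y, (x, y) ∈ N.image Prod.swap → (x, y) ∈ (D.comp G k).edges ∧ x ≠ r ∧ y ≠ c := by
    intro x y hxy
    obtain ⟨⟨b, a⟩, hab, h2⟩ := Finset.mem_image.1 hxy
    simp only [Prod.swap_prod_mk, Prod.mk.injEq] at h2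
    obtain ⟨rfl, rfl⟩ := h2
    exact ⟨(hswap _ _ _).1 (hNE hab), (Finset.mem_erase.1 (hNm _ hab).2).1,
      (Finset.mem_erase.1 (hNm _ hab).1).1⟩
  have hnot : (r, c) ∉ N.image Prod.swap := fun hmem => (hNE' _ _ hmem).2.1 rfl
  refine ⟨insert (r, c) (N.image Prod.swap), ⟨⟨?_, ?_⟩, ?_⟩, Finset.mem_insert_self _ _⟩
  · intro e hee
    rcases Finset.mem_insert.1 hee with rfl | hee
    · exact he
    · exact (hNE' e.1 e.2 hee).1
  · intro e hee f hff hef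
    rcases Finset.mem_insert.1 hee with rfl | hee <;> rcases Finset.mem_insert.1 hff with rfl | hff
    · rfl
    · rcases hef with hef | hef
      · exact absurd hef.symm (hNE' f.1 f.2 hff).2.1
      · exact absurd hef.symm (hNE' f.1 f.2 hff).2.2
    · rcases hef with hef | hef
      · exact absurd hef (hNE' e.1 e.2 hee).2.1
      · exact absurd hef (hNE' e.1 e.2 hee).2.2
    · obtain ⟨e', he', rfl⟩ := Finset.mem_image.1 hee
      obtain ⟨f', hf', rfl⟩ := Finset.mem_image.1 hff
      rw [hN e' he' f' hf' hef.symm]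
  · intro N' hN'
    rw [Finset.card_insert_of_notMem hnot, Finset.card_image_of_injective _ Prod.swap_injective,
      hNc, Finset.card_erase_add_one hcmem]
    exact hN'.card_le_cols

theorem GoodLabels.isBlockDecomposition [DecidableEq R] [DecidableEq C] {G : BipGraph R C}
    {M : Finset (R × C)} {D : BlockLabels R C} (hM : G.IsMaxMatching M) (h : GoodLabels G M D) :
    D.IsBlockDecomposition G := by
  have hrows : ∀ k, k ≠ Fin.last (D.d + 1) → (D.comp G k).mt = (D.comp G k).rows.card := by
    intro k hk
    rw [(h.comp_isMaxMatching hM k).mt_eq, h.inter_comp hM]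
    exact (h.card_rows hM (fun x => x = k) (fun hl => hk hl.symm)).symm
  have hcols : ∀ k, k ≠ 0 → (D.comp G k).mt = (D.comp G k).cols.card := by
    intro k hk
    rw [(h.comp_isMaxMatching hM k).mt_eq, h.inter_comp hM]
    exact (h.card_cols hM (fun x => x = k) (fun hl => hk hl.symm)).symm
  refine ⟨?_, ?_, ?_, ?_, ?_, h.maxMatching_iff hM⟩
  · intro k hk
    refine ⟨?_, hrows k hk.2, (hrows k hk.2).symm.trans (hcols k hk.1)⟩
    obtain ⟨r, hr, hrk⟩ := h.surj k hk
    exact ⟨r, Finset.mem_filter.2 ⟨hr, hrk⟩⟩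
  · rintro ⟨r, hr⟩
    have h0 := hrows 0 (Fin.last_pos).ne
    refine ⟨h0, ?_⟩
    rw [← h0]
    obtain ⟨hrG, hr0⟩ := Finset.mem_filter.1 hr
    obtain ⟨r', c, -, hrc, hc⟩ := h.zero r hrG hr0
    have hc0 : c ∈ (D.comp G 0).cols := by
      refine Finset.mem_filter.2 ⟨(G.edges_mem _ hrc).2, ?_⟩
      by_contra hne
      obtain ⟨x, hx⟩ := h.col_matched c (G.edges_mem _ hrc).2 hne
      exact hc x hx
    rw [(h.comp_isMaxMatching hM 0).mt_eq, ← Finset.card_erase_add_one hc0, Nat.lt_succ_iff]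
    have hmat := inter_comp_isMatching (D := D) hM.1 0
    refine Finset.card_le_card_of_injOn Prod.snd ?_ ?_
    · intro e he
      have he' := Finset.mem_coe.1 he
      refine Finset.mem_coe.2 (Finset.mem_erase.2 ⟨?_, ((D.comp G 0).edges_mem e (hmat.1 he')).2⟩)
      rintro rfl
      exact hc e.1 (Finset.mem_inter.1 he').1
    · intro e he f hf hef
      exact hmat.2 e he f hf (Or.inr hef)
  · rintro ⟨c, hc⟩
    have h0 := hcols (Fin.last (D.d + 1)) (Fin.last_pos).ne'
    refine ⟨h0, ?_⟩
    rw [← h0]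
    obtain ⟨hcG, hcl⟩ := Finset.mem_filter.1 hc
    obtain ⟨r, hr⟩ := h.col_matched c hcG (by rw [hcl]; exact (Fin.last_pos).ne')
    obtain ⟨r₀, hr₀, hr₀M, -⟩ := h.last r (G.edges_mem _ (hM.1.1 hr)).1
      ((h.matched r c hr).trans hcl)
    have hr0 : r₀ ∈ (D.comp G (Fin.last (D.d + 1))).rows := by
      refine Finset.mem_filter.2 ⟨hr₀, ?_⟩
      by_contra hne
      obtain ⟨x, hx⟩ := h.row_matched r₀ hr₀ hne
      exact hr₀M x hx
    rw [(h.comp_isMaxMatching hM _).mt_eq, ← Finset.card_erase_add_one hr0, Nat.lt_succ_iff]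
    have hmat := inter_comp_isMatching (D := D) hM.1 (Fin.last (D.d + 1))
    refine Finset.card_le_card_of_injOn Prod.fst ?_ ?_
    · intro e he
      have he' := Finset.mem_coe.1 he
      refine Finset.mem_coe.2 (Finset.mem_erase.2 ⟨?_, ((D.comp G _).edges_mem e (hmat.1 he')).1⟩)
      rintro rfl
      exact hr₀M e.2 (Finset.mem_inter.1 he').1
    · intro e he f hf hef
      exact hmat.2 e he f hf (Or.inl hef)
  · rintro k ⟨r, c⟩ he
    by_cases hk : k = Fin.last (D.d + 1)
    · exact h.admissible_last hM k hk r c he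
    · exact h.admissible_rows hM k hk r c he
  · rintro ⟨r, c⟩ he
    exact h.tri r c he

/-- Every finite bipartite graph has a Dulmage–Mendelsohn decomposition. -/
theorem BlockLabels.exists_isDMDecomposition [DecidableEq R] [DecidableEq C] (G : BipGraph R C) :
    ∃ D : BlockLabels R C, D.IsDMDecomposition G := by
  obtain ⟨M, hM⟩ := G.exists_isMaxMatching
  obtain ⟨D₀, hD₀⟩ := exists_goodLabels hM
  have hbound : ∀ D : BlockLabels R C, D.numComps G ≤ G.rows.card + G.cols.card := by
    intro D
    calc D.numComps G ≤ (G.rows.image D.row ∪ G.cols.image D.col).card := by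
          refine Finset.card_le_card ?_
          intro k hk
          rw [Finset.mem_union, Finset.mem_image, Finset.mem_image]
          rcases (Finset.mem_filter.1 hk).2 with ⟨r, hr⟩ | ⟨c, hc⟩
          · exact Or.inl ⟨r, Finset.mem_filter.1 hr⟩
          · exact Or.inr ⟨c, Finset.mem_filter.1 hc⟩
      _ ≤ _ := (Finset.card_union_le _ _).trans
          (add_le_add Finset.card_image_le Finset.card_image_le)
  have hfin : {k | ∃ D : BlockLabels R C, D.IsBlockDecomposition G ∧ D.numComps G = k}.Finite :=
    (Set.finite_Iic (G.rows.card + G.cols.card)).subset (by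
      rintro k ⟨D, -, rfl⟩
      exact hbound D)
  obtain ⟨k, ⟨D, hD, rfl⟩, hmax⟩ := hfin.exists_maximal ⟨_, D₀, hD₀.isBlockDecomposition hM, rfl⟩
  refine ⟨D, ⟨hD, fun D' hD' => ?_⟩⟩
  by_contra hlt
  exact hlt (hmax ⟨D', hD', rfl⟩ (not_le.1 hlt).le)

end Existence


/-! ### The graphs of a structured pair and the conditions of the theorem

In what follows `M` is the structured matrix `[A, B]`; its columns are indexed by `Fin n ⊕ Fin m`. -/

section Conditions

variable {n m : ℕ}

/-- The bipartite graph associated with `[A, B]`. -/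
def bipGraphOf (M : Matrix (Fin n) (Fin n ⊕ Fin m) Entry) : BipGraph (Fin n) (Fin n ⊕ Fin m) where
  rows := Finset.univ
  cols := Finset.univ
  edges := Finset.univ.filter (fun e => M e.1 e.2 ≠ Entry.zero)
  edges_mem := fun _ _ => ⟨Finset.mem_univ _, Finset.mem_univ _⟩

/-- The `λ`-edges `(v⁺_k, v⁻_k)`, `k = 1, …, n`. -/
def lambdaEdges (n m : ℕ) : Finset (Fin n × (Fin n ⊕ Fin m)) :=
  Finset.univ.filter (fun e => e.2 = Sum.inl e.1)

/-- The bipartite graph of the generic matrix pencil `H_λ = [A - λI, B]`. -/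
def pencilGraph (M : Matrix (Fin n) (Fin n ⊕ Fin m) Entry) :
    BipGraph (Fin n) (Fin n ⊕ Fin m) where
  rows := Finset.univ
  cols := Finset.univ
  edges := lambdaEdges n m ∪ (bipGraphOf M).edges
  edges_mem := fun _ _ => ⟨Finset.mem_univ _, Finset.mem_univ _⟩

/-- The bipartite graph of `H_λ` with its column `j` removed. -/
def pencilGraphDel (M : Matrix (Fin n) (Fin n ⊕ Fin m) Entry) (j : Fin n ⊕ Fin m) :
    BipGraph (Fin n) (Fin n ⊕ Fin m) :=
  (pencilGraph M).delCol j

/-- `γ_nz(G) = 1`, for a subgraph `G` of the graph of the pencil: either the maximum matchings of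
`G` do not all have the same number of `λ`-edges, or `G` contains a self-loop (a `λ`-edge that is
also an edge of the graph of `[A, B]`). -/
def GammaNZ (M : Matrix (Fin n) (Fin n ⊕ Fin m) Entry) (G : BipGraph (Fin n) (Fin n ⊕ Fin m)) :
    Prop :=
  G.gammaMin (lambdaEdges n m) < G.gammaMax (lambdaEdges n m) ∨
    ∃ e ∈ G.edges, e ∈ lambdaEdges n m ∧ e ∈ (bipGraphOf M).edges

/-- `Ω_j`: the square components with `γ_nz = 1`. -/
def Omega (M : Matrix (Fin n) (Fin n ⊕ Fin m) Entry) (j : Fin n ⊕ Fin m)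
    (D : BlockLabels (Fin n) (Fin n ⊕ Fin m)) : Set (Fin (D.d + 2)) :=
  {k | D.IsSquare k ∧ GammaNZ M (D.comp (pencilGraphDel M j) k)}

/-- `Ω_j^l`: the components in `Ω_j` that are not covered by at least one maximum matching of
`B(H_λ^{j_c}) - {v⁺_l}`. -/
def OmegaRow (M : Matrix (Fin n) (Fin n ⊕ Fin m) Entry) (j : Fin n ⊕ Fin m)
    (D : BlockLabels (Fin n) (Fin n ⊕ Fin m)) (l : Fin n) : Set (Fin (D.d + 2)) :=
  {k | k ∈ Omega M j D ∧ ∃ N, ((pencilGraphDel M j).delRow l).IsMaxMatching N ∧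
    ¬ BipGraph.Covers N (D.comp (pencilGraphDel M j) k)}

/-- Condition d1: some maximum matching of `B([A, B])` does not match `v⁻_j`. -/
def CondD1 (M : Matrix (Fin n) (Fin n ⊕ Fin m) Entry) (j : Fin n ⊕ Fin m) : Prop :=
  ∃ N, (bipGraphOf M).IsMaxMatching N ∧ ∀ e ∈ N, e.2 ≠ j

/-- Condition d2: `mt(B([A, B]) - {v⁺_k, v⁻_j}) = n - 2` (in the integers) for every neighbour
`v⁺_k ≠ v⁺_i` of `v⁻_j` in `B([A, B])`. -/
def CondD2 (M : Matrix (Fin n) (Fin n ⊕ Fin m) Entry) (i : Fin n) (j : Fin n ⊕ Fin m) : Prop :=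
  ∀ k, k ≠ i → (k, j) ∈ (bipGraphOf M).edges →
    (((bipGraphOf M).delRow k).delCol j).mt + 2 = n

/-- Condition d3: `mt(B([A, B]) - {v⁺_i, v⁻_j}) = n - 2` (in the integers). -/
def CondD3 (M : Matrix (Fin n) (Fin n ⊕ Fin m) Entry) (i : Fin n) (j : Fin n ⊕ Fin m) : Prop :=
  (((bipGraphOf M).delRow i).delCol j).mt + 2 = n

/-- Condition e1: `Ω_j^i = ∅`. -/
def CondE1 (M : Matrix (Fin n) (Fin n ⊕ Fin m) Entry) (i : Fin n) (j : Fin n ⊕ Fin m)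
    (D : BlockLabels (Fin n) (Fin n ⊕ Fin m)) : Prop :=
  OmegaRow M j D i = ∅

/-- Condition e2: `Ω_j^i ≠ ∅`, `i ≠ j`, and for every neighbour `v⁺_l ≠ v⁺_i` of `v⁻_j` in
`B(H_λ)`, every maximum matching of `B(H_λ^{j_c}) - {v⁺_l}` covers the union of the components in
`Ω_j^i`. -/
def CondE2 (M : Matrix (Fin n) (Fin n ⊕ Fin m) Entry) (i : Fin n) (j : Fin n ⊕ Fin m)
    (D : BlockLabels (Fin n) (Fin n ⊕ Fin m)) : Prop :=
  (OmegaRow M j D i).Nonempty ∧ j ≠ Sum.inl i ∧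
    ∀ l, l ≠ i → (l, j) ∈ (pencilGraph M).edges →
      ∀ N, ((pencilGraphDel M j).delRow l).IsMaxMatching N →
        BipGraph.Covers N (D.unionComp (pencilGraphDel M j) (OmegaRow M j D i))

end Conditions

/-- The graph of `H_λ` with column `j` removed has a DM-decomposition. -/
theorem exists_isDMDecomposition_pencilGraphDel {n m : ℕ}
    (M : Matrix (Fin n) (Fin n ⊕ Fin m) Entry) (j : Fin n ⊕ Fin m) :
    ∃ D : BlockLabels (Fin n) (Fin n ⊕ Fin m), D.IsDMDecomposition (pencilGraphDel M j) :=
  BlockLabels.exists_isDMDecomposition _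

/-! Outside a null set the values `p` of the `*` entries are algebraically independent over ℚ, so
one such `p` may be fixed. Let N(z) be the pencil [A − zI, B] with the `×` entry set to 0
(`genPencil`), and let φ(q) be the product of a row vector q with column j of N(z). By the
Popov–Belevitch–Hautus test the pair with `×` value x is uncontrollable exactly if, for some z, a
nonzero q annihilates every column of N(z) except possibly j and satisfies φ(q) + x q_i = 0.
Structural controllability provides, for almost all p, some x without such a q. Then for every z the
null vectors off column j form a space of dimension at most one, and controllability for all x ≠ 0
says that each of them has q_i = 0 or φ(q) = 0 (`ControllableAt.forall_ne_zero_iff`); otherwise x =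
−φ(q)/q_i is a bad value. The point z = 0 accounts for (ii), the points z ≠ 0 for (iii).

It remains to read the support of q and the vanishing of φ(q) from the graphs. The main tool is
`exists_common_position`. If a minor with a structural matching vanishes at z, then z is algebraic
over the parameters inside that minor, but not over ℚ. In the algebraic matroid of ℂ over ℚ,
closures of subsets of an independent set intersect in the closure of the intersection. Hence all
matched minors vanishing at the same z share a `*` position. This has two consequences: the support
of a null vector is closed under alternating paths (`IsNullVector.matchClosed_nullSupport`), and at
most one square component is singular at z (`eq_of_det_labelRows_eq_zero`). So q stems from one
component G_k, and its support is exactly the set of rows reachable from G_k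
(`IsNullVector.exists_component`).

The combinatorial translation is as follows. G_k is singular at some z ≠ 0 exactly if its γ_nz is 1
(`UniqueCross.gammaNZ_iff`). Row l is reachable from G_k exactly if deleting l allows a maximum
matching that does not cover G_k (`MatchLabels.exists_not_covers_iff`). Thus q_l ≠ 0 becomes k ∈
Ω_j^l. Moreover φ(q) ≠ 0 exactly if the support of q meets a structurally nonzero entry of column j:
q can be scaled to be algebraic over the other parameters, so no cancellation is possible
(`IsNullVector.sum_mul_ne_zero`). At z = 0 matched minors never vanish, and Hall's theorem shows
that q_r ≠ 0 exactly if the rows other than r can be matched off column j. -/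

/-! ### Generic points -/

/-- A nonzero complex polynomial vanishes only on a null set. -/
theorem MvPolynomial.ae_eval_ne_zero {ι : Type} [Fintype ι] (f : MvPolynomial ι ℂ) (hf : f ≠ 0) :
    ∀ᵐ p : ι → ℂ ∂volume, MvPolynomial.eval p f ≠ 0 := by
  classical
  revert f
  -- Induction on the number of variables, with Fubini in the step from `α` to `Option α`.
  refine Fintype.induction_empty_option
    (P := fun ι _ => ∀ f : MvPolynomial ι ℂ, f ≠ 0 →
      ∀ᵐ p : ι → ℂ ∂volume, MvPolynomial.eval p f ≠ 0) ?_ ?_ ?_ ι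
  · intro α β _ e ih f hf
    let _ := Fintype.ofEquiv β e.symm
    have h1 := ih (MvPolynomial.rename e.symm f)
      (fun h => hf (MvPolynomial.rename_injective _ e.symm.injective (by simpa using h)))
    have h2 := (volume_measurePreserving_piCongrLeft (fun _ : α => ℂ) e.symm).quasiMeasurePreserving.ae h1
    filter_upwards [h2] with p hp
    rw [MvPolynomial.eval_rename] at hp
    convert hp using 3
    ext b
    simp [MeasurableEquiv.piCongrLeft, Equiv.piCongrLeft, Equiv.piCongrLeft']
  · intro f hf
    refine Filter.Eventually.of_forall fun p => ?_
    obtain ⟨c, rfl⟩ := MvPolynomial.C_surjective PEmpty f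
    simp only [MvPolynomial.eval_C]
    rintro rfl
    simp at hf
  · intro α _ ih f hf
    have hg : MvPolynomial.optionEquivLeft ℂ α f ≠ 0 := fun h => hf (by simpa using h)
    set g := MvPolynomial.optionEquivLeft ℂ α f with hgdef
    -- As a polynomial in the new variable, `f` has a nonzero coefficient. Where this coefficient
    -- does not vanish, the slice of the zero set is finite.
    obtain ⟨a, ha⟩ : ∃ a, g.coeff a ≠ 0 := by
      by_contra! h
      exact hg (Polynomial.ext (by simpa using h))
    have hcoef := ih (g.coeff a) ha
    have key : ∀ (p : α → ℂ) (x : ℂ), MvPolynomial.eval (fun o : Option α => o.elim x p) f =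
        (g.map (MvPolynomial.eval p)).eval x := by
      intro p x
      rw [hgdef]
      exact MvPolynomial.optionEquivLeft_elim_eval ℂ α p x f
    let e := MeasurableEquiv.piOptionEquivProd (fun _ : Option α => ℂ)
    have hmp : Measure.map e.symm ((volume : Measure (α → ℂ)).prod (volume : Measure ℂ)) =
        (volume : Measure (Option α → ℂ)) :=
      Measure.pi_map_piOptionEquivProd (fun _ : Option α => (volume : Measure ℂ))
    have hcl : MeasurableSet {y : Option α → ℂ | MvPolynomial.eval y f = 0} :=
      (isClosed_eq (MvPolynomial.continuous_eval f) continuous_const).measurableSet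
    have hgoal : volume {y : Option α → ℂ | MvPolynomial.eval y f = 0} = 0 := by
      rw [← hmp, e.symm.map_apply, Measure.measure_prod_null (e.symm.measurable hcl)]
      filter_upwards [hcoef] with p hp
      have hne : g.map (MvPolynomial.eval p) ≠ 0 := fun h => hp (by
        rw [← Polynomial.coeff_map, h, Polynomial.coeff_zero])
      refine measure_mono_null (t := {x | (g.map (MvPolynomial.eval p)).IsRoot x}) ?_
        ((Polynomial.finite_setOfPred_isRoot hne).measure_zero _)
      intro x hx
      change Polynomial.eval x _ = 0
      rw [← key]
      have : e.symm (p, x) = fun o : Option α => o.elim x p := by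
        ext o
        cases o <;> rfl
      rw [← this]
      exact hx
    simpa [ae_iff] using hgoal

theorem MvPolynomial.countable_rat (ι : Type*) [Finite ι] : Countable (MvPolynomial ι ℚ) := by
  refine Function.Injective.countable (β := (ι →₀ ℕ) →₀ ℚ)
    (f := fun f => AddMonoidAlgebra.coeff f) ?_
  rintro ⟨f⟩ ⟨g⟩ h
  exact congrArg _ h

/-- There are only countably many polynomials over ℚ, and each nonzero one vanishes on a null set.
-/
theorem ae_algebraicIndependent {ι : Type} [Fintype ι] :
    ∀ᵐ p : ι → ℂ ∂volume, AlgebraicIndependent ℚ p := by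
  have hc := MvPolynomial.countable_rat ι
  have h : ∀ᵐ p : ι → ℂ ∂volume, ∀ f : MvPolynomial ι ℚ, f ≠ 0 → MvPolynomial.aeval p f ≠ 0 := by
    rw [ae_all_iff]
    intro f
    by_cases hf : f = 0
    · simp [hf]
    filter_upwards [MvPolynomial.ae_eval_ne_zero (MvPolynomial.map (algebraMap ℚ ℂ) f)
      (fun h => hf (MvPolynomial.map_injective _ (algebraMap ℚ ℂ).injective (by simpa using h)))]
      with p hp _
    rwa [MvPolynomial.eval_map] at hp
  filter_upwards [h] with p hp
  rw [algebraicIndependent_iff]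
  intro f hf
  by_contra hne
  exact hp f hne hf

/-! ### Generic pencils -/

section Pencil

variable {R C : Type*} [DecidableEq C]

/-- The pencil whose entry at a `*` position of `W` is the corresponding parameter, with `z`
subtracted at the positions `(r, ℓ r)`. -/
def genPencil {A : Type*} [CommRing A] (W : Matrix R C Entry) (ℓ : R → C) (t : StarPos W → A)
    (z : A) : Matrix R C A :=
  fun r c => (if h : W r c = Entry.star then t ⟨(r, c), h⟩ else 0) - if c = ℓ r then z else 0

/-- The positions at which `genPencil W ℓ t z` is structurally nonzero. -/
def PencilEdge {A : Type*} [CommRing A] (W : Matrix R C Entry) (ℓ : R → C) (z : A) (r : R)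
    (c : C) : Prop :=
  W r c = Entry.star ∨ (z ≠ 0 ∧ c = ℓ r)

/-- The square submatrix with rows in `S` and with columns `ν s`, `s ∈ S`. -/
def matchedMinor {A : Type*} (N : Matrix R C A) (S : Finset R) (ν : R → C) : Matrix S S A :=
  N.submatrix Subtype.val (fun s => ν s)

variable {W : Matrix R C Entry} {ℓ : R → C}

theorem genPencil_eq_zero {A : Type*} [CommRing A] {t : StarPos W → A} {z : A} {r : R} {c : C}
    (h : ¬ PencilEdge W ℓ z r c) : genPencil W ℓ t z r c = 0 := by
  unfold PencilEdge at h
  push Not at h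
  unfold genPencil
  rw [dif_neg h.1]
  split_ifs with hc
  · by_contra h0
    exact h.2 (fun hz => h0 (by simp [hz])) hc
  · simp

theorem map_genPencil {A A' : Type*} [CommRing A] [CommRing A'] (φ : A →+* A')
    (t : StarPos W → A) (z : A) (r : R) (c : C) :
    φ (genPencil W ℓ t z r c) = genPencil W ℓ (fun e => φ (t e)) (φ z) r c := by
  unfold genPencil
  split_ifs <;> simp

variable [DecidableEq R]

theorem map_det_matchedMinor {A A' : Type*} [CommRing A] [CommRing A'] (φ : A →+* A')
    (t : StarPos W → A) (z : A) (S : Finset R) (ν : R → C) :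
    φ (matchedMinor (genPencil W ℓ t z) S ν).det =
      (matchedMinor (genPencil W ℓ (fun e => φ (t e)) (φ z)) S ν).det := by
  rw [RingHom.map_det]
  congr 1
  ext r s
  exact map_genPencil φ t z r (ν s)

/-- This shows that the determinant of a structurally matched minor is not identically zero in the
parameters, even for a fixed `z`. The special parameters make the minor strictly diagonally dominant
along the matching. -/
theorem exists_det_matchedMinor_ne_zero {S : Finset R} {ν : R → C} (hν : Set.InjOn ν S) {z : ℂ}
    (he : ∀ r ∈ S, PencilEdge W ℓ z r (ν r)) :
    ∃ t : StarPos W → ℂ, (matchedMinor (genPencil W ℓ t z) S ν).det ≠ 0 := by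
  classical
  -- Off the diagonal only `-z` survives, at most once per row because `ν` is injective, and never
  -- if the diagonal position itself carries `-z`. The value `2‖z‖ + 1` dominates it.
  refine ⟨fun e => if e.1.2 = ν e.1.1 then ((2 * ‖z‖ + 1 : ℝ) : ℂ) else 0, ?_⟩
  apply det_ne_zero_of_sum_row_lt_diag
  intro r
  have hinj : ∀ s : S, ν s = ν r → s = r := fun s h => Subtype.ext (hν s.2 r.2 h)
  have hoff : ∑ s ∈ Finset.univ.erase r, ‖matchedMinor (genPencil W ℓ
      (fun e => if e.1.2 = ν e.1.1 then ((2 * ‖z‖ + 1 : ℝ) : ℂ) else 0) z) S ν r s‖ =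
      ∑ s ∈ Finset.univ.erase r, if ν s = ℓ r then ‖z‖ else 0 := by
    refine Finset.sum_congr rfl fun s hs => ?_
    have hsr : ¬ ν s = ν r := fun h => (Finset.mem_erase.1 hs).1 (hinj s h)
    simp only [matchedMinor, Matrix.submatrix_apply, genPencil, if_neg hsr, dite_eq_ite, ite_self,
      zero_sub, norm_neg]
    split_ifs <;> simp
  have hz := norm_nonneg z
  have hτ : ‖((2 * ‖z‖ + 1 : ℝ) : ℂ)‖ = 2 * ‖z‖ + 1 := by
    rw [Complex.norm_real, Real.norm_eq_abs, abs_of_nonneg (by positivity)]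
  rw [hoff]
  by_cases hr : ν r = ℓ r
  · rw [Finset.sum_eq_zero]
    · simp only [matchedMinor, Matrix.submatrix_apply, genPencil, if_pos hr, if_true, dite_eq_ite]
      rw [norm_pos_iff]
      split_ifs with h
      · intro h0
        have := congrArg norm (sub_eq_zero.1 h0)
        rw [hτ] at this
        linarith
      · rcases he r r.2 with h' | h'
        · exact absurd h' h
        · simpa using h'.1
    · intro s hs
      rw [if_neg]
      intro h
      exact (Finset.mem_erase.1 hs).1 (hinj s (h.trans hr.symm))
  · have hstar : W r (ν r) = Entry.star := (he r r.2).resolve_right (fun h => hr h.2)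
    simp only [matchedMinor, Matrix.submatrix_apply, genPencil, if_neg hr, if_true, hstar,
      dite_eq_ite, sub_zero, hτ]
    rw [← Finset.sum_filter, Finset.sum_const, nsmul_eq_mul]
    have hc : (((Finset.univ.erase r).filter (fun s : S => ν s = ℓ r)).card : ℝ) ≤ 1 := by
      rw [Nat.cast_le_one, Finset.card_le_one]
      intro a ha b hb
      exact Subtype.ext (hν a.2 b.2
        ((Finset.mem_filter.1 ha).2.trans (Finset.mem_filter.1 hb).2.symm))
    nlinarith

/-- A determinant that is nonzero at one specialization `y₀` is a nonzero polynomial over `K`, hence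
nonzero at an algebraically independent point. The polynomials `a`, `b` allow `z` to be either a
constant of `K` or a further variable. -/
theorem AlgebraicIndependent.det_matchedMinor_ne_zero {K : Type*} [Field K] [Algebra K ℂ]
    {σ : Type*} {y : σ → ℂ} (hy : AlgebraicIndependent K y) {a : StarPos W → MvPolynomial σ K}
    {b : MvPolynomial σ K} {S : Finset R} {ν : R → C} (y₀ : σ → ℂ)
    (h : (matchedMinor (genPencil W ℓ (fun e => MvPolynomial.aeval y₀ (a e))
      (MvPolynomial.aeval y₀ b)) S ν).det ≠ 0) :
    (matchedMinor (genPencil W ℓ (fun e => MvPolynomial.aeval y (a e))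
      (MvPolynomial.aeval y b)) S ν).det ≠ 0 := by
  have e1 := map_det_matchedMinor (W := W) (ℓ := ℓ) (MvPolynomial.aeval (R := K) y₀).toRingHom
    a b S ν
  have e2 := map_det_matchedMinor (W := W) (ℓ := ℓ) (MvPolynomial.aeval (R := K) y).toRingHom
    a b S ν
  intro h0
  apply h
  refine e1.symm.trans ?_
  have := algebraicIndependent_iff.1 hy _ (e2.trans h0)
  rw [this]
  simp

/-- A minor with a structural matching can vanish at an algebraic value of `z` only if there are
algebraic relations between the parameters. -/
theorem det_matchedMinor_ne_zero_of_isAlgebraic {p : StarPos W → ℂ}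
    (hp : AlgebraicIndependent ℚ p) {z : ℂ} (hz : IsAlgebraic ℚ z) {S : Finset R} {ν : R → C}
    (hν : Set.InjOn ν S) (he : ∀ r ∈ S, PencilEdge W ℓ z r (ν r)) :
    (matchedMinor (genPencil W ℓ p z) S ν).det ≠ 0 := by
  obtain ⟨t, ht⟩ := exists_det_matchedMinor_ne_zero hν he
  -- The parameters stay independent over the algebraic closure of ℚ, where `z` is a constant.
  let z' : algebraicClosure ℚ ℂ := ⟨z, mem_algebraicClosure_iff.2 hz⟩
  have := hp.algebraicClosure.det_matchedMinor_ne_zero (W := W) (ℓ := ℓ) (a := MvPolynomial.X)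
    (b := MvPolynomial.C z') (S := S) (ν := ν) t
  simp only [MvPolynomial.aeval_X, MvPolynomial.aeval_C] at this
  exact this ht

open AlgebraicIndependent in
/-- If a minor with a structural matching vanishes, then `z` is algebraic over its parameters. -/
theorem mem_closure_of_det_matchedMinor_eq_zero {p : StarPos W → ℂ}
    (hp : AlgebraicIndependent ℚ p) {z : ℂ} {S : Finset R} {ν : R → C}
    (hν : Set.InjOn ν S) (he : ∀ r ∈ S, PencilEdge W ℓ z r (ν r))
    (h0 : (matchedMinor (genPencil W ℓ p z) S ν).det = 0) :
    z ∈ (matroid ℚ ℂ).closure (p '' {e | e.1.1 ∈ S ∧ e.1.2 ∈ ν '' S}) := by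
  classical
  set U : Set (StarPos W) := {e | e.1.1 ∈ S ∧ e.1.2 ∈ ν '' S} with hU
  by_contra hz
  rw [matroid_closure_eq, SetLike.mem_coe, Subalgebra.mem_algebraicClosure] at hz
  have hx : AlgebraicIndependent ℚ (fun e : U => p e) := hp.comp _ Subtype.val_injective
  have hr : p '' U = Set.range (fun e : U => p e) := by rw [Set.image_eq_range]
  rw [hr] at hz
  -- If `z` were transcendental over the parameters of the minor, it would be one more independent
  -- variable. The specialization with `z = 1` then rules out a vanishing determinant.
  have hy := (hx.option_iff_transcendental z).2 hz
  obtain ⟨t, ht⟩ := exists_det_matchedMinor_ne_zero (z := 1) (W := W) (ℓ := ℓ) hν (fun r hr =>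
    (he r hr).imp id (fun h => ⟨one_ne_zero, h.2⟩))
  have key : ∀ (t : StarPos W → ℂ) (z : ℂ),
      matchedMinor (genPencil W ℓ (fun e => MvPolynomial.aeval (R := ℚ)
        (fun o : Option U => o.elim z (fun e => t e))
        (if h : e ∈ U then MvPolynomial.X (some ⟨e, h⟩) else 0))
        (MvPolynomial.aeval (R := ℚ) (fun o : Option U => o.elim z (fun e => t e))
          (MvPolynomial.X none))) S ν = matchedMinor (genPencil W ℓ t z) S ν := by
    intro t z
    ext r s
    simp only [matchedMinor, Matrix.submatrix_apply, genPencil]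
    split_ifs with h1 h2 h3 h4 <;> first
      | exact absurd ⟨r.2, s, s.2, rfl⟩ h2
      | simp
  have := hy.det_matchedMinor_ne_zero (W := W) (ℓ := ℓ) (S := S) (ν := ν)
    (a := fun e => if h : e ∈ U then MvPolynomial.X (some ⟨e, h⟩) else 0)
    (b := MvPolynomial.X none) (fun o : Option U => o.elim 1 (fun e => t e))
  rw [key, key] at this
  exact this ht h0

open AlgebraicIndependent in
/-- All vanishing minors with a structural matching involve a common position. -/
theorem exists_common_position {p : StarPos W → ℂ} (hp : AlgebraicIndependent ℚ p) {z : ℂ}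
    {S₀ : Finset R} {ν₀ : R → C} (hν₀ : Set.InjOn ν₀ S₀)
    (he₀ : ∀ r ∈ S₀, PencilEdge W ℓ z r (ν₀ r))
    (h₀ : (matchedMinor (genPencil W ℓ p z) S₀ ν₀).det = 0) :
    ∃ (r : R) (c : C), ∀ (S : Finset R) (ν : R → C), Set.InjOn ν S →
      (∀ r ∈ S, PencilEdge W ℓ z r (ν r)) →
      (matchedMinor (genPencil W ℓ p z) S ν).det = 0 → r ∈ S ∧ c ∈ ν '' S := by
  have hI : (matroid ℚ ℂ).Indep (Set.range p) := matroid_indep_iff.2 hp.to_subtype_range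
  let Js : Set (Set ℂ) := {J | ∃ (S : Finset R) (ν : R → C), Set.InjOn ν S ∧
      (∀ r ∈ S, PencilEdge W ℓ z r (ν r)) ∧
      (matchedMinor (genPencil W ℓ p z) S ν).det = 0 ∧
      J = p '' {e | e.1.1 ∈ S ∧ e.1.2 ∈ ν '' S}}
  have hne : Js.Nonempty := ⟨_, S₀, ν₀, hν₀, he₀, h₀, rfl⟩
  -- This is the matroid step: below an independent set, closure commutes with intersections. So `z`
  -- is algebraic over the parameters common to all vanishing matched minors.
  have hcl := hI.closure_sInter_eq_biInter_closure_of_forall_subset hne (by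
    rintro J ⟨S, ν, -, -, -, rfl⟩
    exact Set.image_subset_range _ _)
  have hz : z ∈ (matroid ℚ ℂ).closure (⋂₀ Js) := by
    rw [hcl, Set.mem_iInter₂]
    rintro J ⟨S, ν, hν, he, h, rfl⟩
    exact mem_closure_of_det_matchedMinor_eq_zero hp hν he h
  -- Without a common parameter `z` would be algebraic over ℚ, where matched minors do not vanish.
  rcases (⋂₀ Js).eq_empty_or_nonempty with h | ⟨x, hx⟩
  · rw [h, matroid_closure_eq, SetLike.mem_coe, Subalgebra.mem_algebraicClosure] at hz
    refine absurd h₀ (det_matchedMinor_ne_zero_of_isAlgebraic hp ?_ hν₀ he₀)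
    rw [Algebra.adjoin_empty] at hz
    exact Subalgebra.isAlgebraic_of_isAlgebraic_bot hz
  · obtain ⟨e, -, rfl⟩ := Set.mem_sInter.1 hx _ ⟨S₀, ν₀, hν₀, he₀, h₀, rfl⟩
    refine ⟨e.1.1, e.1.2, fun S ν hν he h => ?_⟩
    obtain ⟨e', he', hee⟩ := Set.mem_sInter.1 hx _ ⟨S, ν, hν, he, h, rfl⟩
    rwa [hp.injective hee] at he'

end Pencil

/-! ### Matchings as functions -/

section Reach

variable {R C : Type*}

/-- `X` is closed for the row-perfect matching `μ`: every neighbour of `X` is matched to `X`. -/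
def MatchClosed (adj : R → C → Prop) (μ : R → C) (X : Finset R) : Prop :=
  ∀ r ∈ X, ∀ c, adj r c → ∃ s ∈ X, μ s = c

/-- `s` is reachable from `r` by an alternating path. -/
def MatchReach (adj : R → C → Prop) (μ : R → C) : R → R → Prop :=
  Relation.ReflTransGen (fun r s => adj r (μ s))

variable {adj : R → C → Prop} {μ : R → C}

theorem MatchClosed.mem_of_reach (hμ : Function.Injective μ) {X : Finset R}
    (hX : MatchClosed adj μ X) {r s : R} (hr : r ∈ X) (h : MatchReach adj μ r s) : s ∈ X := by
  induction h with
  | refl => exact hr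
  | tail _ hst ih =>
    obtain ⟨s', hs', h⟩ := hX _ ih _ hst
    exact hμ h ▸ hs'

/-- The columns that can be avoided by a matching of the rows in `S`. -/
def Avoidable (adj : R → C → Prop) (S : Finset R) (c : C) : Prop :=
  ∃ ν : R → C, Set.InjOn ν S ∧ ∀ r ∈ S, adj r (ν r) ∧ ν r ≠ c

/-- Hall's theorem for matchings of `S` that avoid a column. -/
theorem avoidable_or_exists_closed [Fintype C] (hμ : Function.Injective μ)
    (hadj : ∀ r, adj r (μ r)) (S : Finset R) (c : C) :
    Avoidable adj S c ∨ ∃ X ⊆ S, MatchClosed adj μ X ∧ ∃ s ∈ X, μ s = c := by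
  classical
  let t : S → Finset C := fun s => Finset.univ.filter (fun c' => adj s c' ∧ c' ≠ c)
  by_cases hall : ∀ s : Finset S, s.card ≤ (s.biUnion t).card
  · obtain ⟨f, hf, hft⟩ := (Finset.all_card_le_biUnion_card_iff_exists_injective t).1 hall
    left
    refine ⟨fun r => if h : r ∈ S then f ⟨r, h⟩ else c, ?_, ?_⟩
    · intro r hr s hs hrs
      simp only [dif_pos (Finset.mem_coe.1 hr), dif_pos (Finset.mem_coe.1 hs)] at hrs
      exact congrArg Subtype.val (hf hrs)
    · intro r hr
      simp only [dif_pos hr]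
      exact (Finset.mem_filter.1 (hft ⟨r, hr⟩)).2
  · right
    push Not at hall
    obtain ⟨s, hs⟩ := hall
    let X : Finset R := s.map (Function.Embedding.subtype _)
    have hXc : X.card = s.card := Finset.card_map _
    -- A Hall violator `X` has fewer than `|X|` neighbours other than `c`, but all its partners
    -- except possibly `c` are among them. Hence `c` is a partner of `X`, and there are no other
    -- neighbours.
    have hsub : (X.image μ).erase c ⊆ s.biUnion t := by
      intro c' hc'
      obtain ⟨hne, hc'⟩ := Finset.mem_erase.1 hc'
      obtain ⟨r, hr, rfl⟩ := Finset.mem_image.1 hc'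
      obtain ⟨a, ha, rfl⟩ := Finset.mem_map.1 hr
      exact Finset.mem_biUnion.2 ⟨a, ha, Finset.mem_filter.2 ⟨Finset.mem_univ _, hadj _, hne⟩⟩
    have hle := Finset.card_le_card hsub
    have himg : (X.image μ).card = X.card := Finset.card_image_of_injective _ hμ
    have hc : c ∈ X.image μ := by
      by_contra h
      rw [Finset.erase_eq_of_notMem h] at hle
      omega
    have h1 := Finset.card_erase_add_one hc
    have heq := Finset.eq_of_subset_of_card_le hsub (by omega)
    refine ⟨X, ?_, ?_, ?_⟩
    · intro r hr
      obtain ⟨a, _, rfl⟩ := Finset.mem_map.1 hr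
      exact a.2
    · intro r hr c' hrc
      by_cases hcc : c' = c
      · subst hcc
        exact Finset.mem_image.1 hc
      have : c' ∈ (X.image μ).erase c := by
        rw [heq]
        obtain ⟨a, ha, rfl⟩ := Finset.mem_map.1 hr
        exact Finset.mem_biUnion.2 ⟨a, ha, Finset.mem_filter.2 ⟨Finset.mem_univ _, hrc, hcc⟩⟩
      exact Finset.mem_image.1 (Finset.mem_of_mem_erase this)
    · exact Finset.mem_image.1 hc

/-- A row of `S` matched to an unavoidable column has only unavoidable neighbours. -/
theorem not_avoidable_of_adj [Fintype C] (hμ : Function.Injective μ)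
    (hadj : ∀ r, adj r (μ r)) {S : Finset R} {r : R} {c : C}
    (h : ¬ Avoidable adj S (μ r)) (hrc : adj r c) :
    (∃ s ∈ S, μ s = c) ∧ ¬ Avoidable adj S c := by
  classical
  obtain ⟨X, hXS, hX, s, hs, hsr⟩ := (avoidable_or_exists_closed hμ hadj S (μ r)).resolve_left h
  have hrX : r ∈ X := hμ hsr ▸ hs
  obtain ⟨s', hs', hsc⟩ := hX r hrX c hrc
  refine ⟨⟨s', hXS hs', hsc⟩, ?_⟩
  rintro ⟨ν, hν, hνS⟩
  -- A matching of `S` avoiding `c` would send the closed set `X` into its `|X| - 1` partners other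
  -- than `c`.
  have h1 : X.card ≤ ((X.image μ).erase c).card := by
    refine Finset.card_le_card_of_injOn ν ?_ (hν.mono (Finset.coe_subset.2 hXS))
    intro x hx
    obtain ⟨hxa, hxc⟩ := hνS x (hXS hx)
    obtain ⟨y, hy, hyx⟩ := hX x hx _ hxa
    exact Finset.mem_coe.2 (Finset.mem_erase.2 ⟨hxc, Finset.mem_image.2 ⟨y, hy, hyx⟩⟩)
  have hc : c ∈ X.image μ := Finset.mem_image.2 ⟨s', hs', hsc⟩
  have h2 := Finset.card_erase_add_one hc
  have h3 : (X.image μ).card = X.card := Finset.card_image_of_injective _ hμ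
  omega

/-- The properties of a labelling by components, relative to a row-perfect matching `μ`. -/
structure MatchLabels (adj : R → C → Prop) (μ : R → C) (D : BlockLabels R C) : Prop where
  row_le_col : ∀ {r c}, adj r c → D.row r ≤ D.col c
  col_eq : ∀ s, D.col (μ s) = D.row s
  col_matched : ∀ {r c}, adj r c → D.col c ≠ 0 → ∃ s, μ s = c
  zero : ∀ {r}, D.row r = 0 → ∃ r' c, MatchReach adj μ r r' ∧ adj r' c ∧ ∀ s, μ s ≠ c
  ne_last : ∀ r, D.row r ≠ Fin.last (D.d + 1)
  conn : ∀ {r s}, D.IsSquare (D.row r) → D.row r = D.row s → MatchReach adj μ r s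

namespace MatchLabels

variable {D : BlockLabels R C}

theorem row_mono (h : MatchLabels adj μ D) {r s : R} (hrs : MatchReach adj μ r s) :
    D.row r ≤ D.row s := by
  induction hrs with
  | refl => exact le_rfl
  | tail _ hst ih => exact ih.trans ((h.row_le_col hst).trans (h.col_eq _).le)

/-- From the horizontal tail an unmatched column is reachable, which a closed set forbids; a
vertical tail has no rows in the presence of a row-perfect matching. -/
theorem isSquare_of_mem_closed (h : MatchLabels adj μ D) (hμ : Function.Injective μ)
    {X : Finset R} (hX : MatchClosed adj μ X) {r : R} (hr : r ∈ X) : D.IsSquare (D.row r) := by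
  refine ⟨fun h0 => ?_, h.ne_last r⟩
  obtain ⟨r', c, h1, h2, h3⟩ := h.zero h0
  obtain ⟨s, -, hs⟩ := hX r' (hX.mem_of_reach hμ hr h1) c h2
  exact h3 s hs

/-- The rows reachable from a square component. -/
noncomputable def reachSet [Fintype R] (adj : R → C → Prop) (μ : R → C) (D : BlockLabels R C)
    (k : Fin (D.d + 2)) : Finset R := by
  classical exact Finset.univ.filter (fun s => ∃ v, D.row v = k ∧ MatchReach adj μ v s)

theorem mem_reachSet [Fintype R] {k : Fin (D.d + 2)} {s : R} :
    s ∈ reachSet adj μ D k ↔ ∃ v, D.row v = k ∧ MatchReach adj μ v s := by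
  simp [reachSet]

theorem le_row_of_mem_reachSet [Fintype R] (h : MatchLabels adj μ D) {k : Fin (D.d + 2)} {s : R}
    (hs : s ∈ reachSet adj μ D k) : k ≤ D.row s := by
  obtain ⟨v, rfl, hv⟩ := mem_reachSet.1 hs
  exact h.row_mono hv

/-- From a square component no unmatched column is reachable. -/
theorem matchClosed_reachSet [Fintype R] (h : MatchLabels adj μ D) {k : Fin (D.d + 2)}
    (hk : k ≠ 0) : MatchClosed adj μ (reachSet adj μ D k) := by
  intro r hr c hrc
  obtain ⟨s, rfl⟩ := h.col_matched hrc (fun h0 => hk (Fin.le_zero_iff.1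
    (h0 ▸ (h.le_row_of_mem_reachSet hr).trans (h.row_le_col hrc))))
  obtain ⟨v, hv, hvr⟩ := mem_reachSet.1 hr
  exact ⟨s, mem_reachSet.2 ⟨v, hv, hvr.tail hrc⟩, rfl⟩

end MatchLabels
end Reach

/-! ### Decompositions and row-perfect matchings -/

section Decomposition

variable {R C : Type*} [DecidableEq R] [DecidableEq C]

/-- A matching that covers all rows is a maximum matching, and the maximum matchings then are those
covering all rows. -/
theorem BipGraph.isMaxMatching_iff_of_perfect {H : BipGraph R C} {ν : R → C}
    (hν : Set.InjOn ν H.rows) (hνe : ∀ r ∈ H.rows, (r, ν r) ∈ H.edges) {N : Finset (R × C)} :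
    H.IsMaxMatching N ↔ H.IsMatching N ∧ ∀ r ∈ H.rows, ∃ c, (r, c) ∈ N := by
  have himg : ∀ N, H.IsMatching N → (N.image Prod.fst).card = N.card := fun N hN =>
    Finset.card_image_of_injOn (fun e he f hf hef => hN.2 e he f hf (Or.inl hef))
  have hsub : ∀ N, H.IsMatching N → N.image Prod.fst ⊆ H.rows := fun N hN r hr => by
    obtain ⟨e, he, rfl⟩ := Finset.mem_image.1 hr
    exact (H.edges_mem e (hN.1 he)).1
  constructor
  · intro hN
    refine ⟨hN.1, fun r hr => ?_⟩
    have hM : H.IsMatching (H.rows.image (fun r => (r, ν r))) := by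
      constructor
      · intro e he
        obtain ⟨r, hr, rfl⟩ := Finset.mem_image.1 he
        exact hνe r hr
      · intro e he f hf
        obtain ⟨r, hr, rfl⟩ := Finset.mem_image.1 he
        obtain ⟨s, hs, rfl⟩ := Finset.mem_image.1 hf
        rintro (h | h)
        · rw [show r = s from h]
        · rw [hν hr hs h]
    have h1 := hN.2 _ hM
    rw [Finset.card_image_of_injective _ (fun r s h => congrArg Prod.fst h), ← himg N hN.1] at h1
    have h2 := Finset.eq_of_subset_of_card_le (hsub N hN.1) h1
    rw [← h2] at hr
    obtain ⟨e, he, rfl⟩ := Finset.mem_image.1 hr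
    exact ⟨e.2, he⟩
  · rintro ⟨hN, h⟩
    refine ⟨hN, fun N' hN' => hN'.card_le_rows.trans ?_⟩
    rw [← himg N hN]
    refine Finset.card_le_card fun r hr => ?_
    obtain ⟨c, hc⟩ := h r hr
    exact Finset.mem_image.2 ⟨_, hc, rfl⟩

/-- The matching given by a function. -/
def matchingOf [Fintype R] (μ : R → C) : Finset (R × C) := Finset.univ.image (fun r => (r, μ r))

theorem mem_matchingOf [Fintype R] {μ : R → C} {r : R} {c : C} : (r, c) ∈ matchingOf μ ↔ μ r = c := by
  simp [matchingOf]

variable {G : BipGraph R C} {μ : R → C}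

theorem isMaxMatching_matchingOf [Fintype R] (hμ : Function.Injective μ)
    (hadj : ∀ r, (r, μ r) ∈ G.edges) : G.IsMaxMatching (matchingOf μ) := by
  rw [BipGraph.isMaxMatching_iff_of_perfect hμ.injOn (fun r _ => hadj r)]
  refine ⟨⟨?_, ?_⟩, fun r _ => ⟨μ r, mem_matchingOf.2 rfl⟩⟩
  · rintro ⟨r, c⟩ h
    rw [mem_matchingOf] at h
    exact h ▸ hadj r
  · rintro ⟨r, c⟩ h ⟨s, d⟩ h' hef
    rw [mem_matchingOf] at h h'
    subst h h'
    rcases hef with hef | hef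
    · rw [show r = s from hef]
    · rw [hμ hef]

/-- The components of a decomposition that cannot be refined are the components of the alternating
paths of any row-perfect matching. -/
theorem BlockLabels.IsDMDecomposition.matchLabels [Fintype R] {D : BlockLabels R C}
    (hD : D.IsDMDecomposition G) (hμ : Function.Injective μ)
    (hadj : ∀ r, (r, μ r) ∈ G.edges) : MatchLabels (fun r c => (r, c) ∈ G.edges) μ D := by
  classical
  have hM := isMaxMatching_matchingOf hμ hadj
  -- `D'` is the labelling built from alternating paths. It refines `D`, and since `D` has the
  -- largest number of components, both have the same classes of rows; so `D` inherits the
  -- reachability properties of `D'`.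
  obtain ⟨D', hD'⟩ := exists_goodLabels hM
  have hrow : ∀ r, r ∈ G.rows := fun r => (G.edges_mem _ (hadj r)).1
  have hcolG : ∀ r, μ r ∈ G.cols := fun r => (G.edges_mem _ (hadj r)).2
  have hcol : ∀ s, D.col (μ s) = D.row s := by
    intro s
    obtain ⟨k, hk⟩ := ((hD.maxMatching_iff _).1 hM).1 (s, μ s) (mem_matchingOf.2 rfl)
    have := (Finset.mem_filter.1 hk).2
    exact this.2.trans this.1.symm
  have hcol' : ∀ s, D'.col (μ s) = D'.row s := fun s =>
    (hD'.matched s (μ s) (mem_matchingOf.2 rfl)).symm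
  have hrc : ∀ k, (D.comp G k).rows.image μ ⊆ (D.comp G k).cols := by
    intro k c hc
    obtain ⟨r, hr, rfl⟩ := Finset.mem_image.1 hc
    exact Finset.mem_filter.2 ⟨hcolG r, (hcol r).trans (Finset.mem_filter.1 hr).2⟩
  have hcard : ∀ k, ((D.comp G k).rows.image μ).card = (D.comp G k).rows.card := fun k =>
    Finset.card_image_of_injective _ hμ
  -- `μ` embeds the rows of each component into its columns, so the vertical tail cannot have more
  -- rows than columns.
  have hlast : ¬ (D.comp G (Fin.last (D.d + 1))).cols.Nonempty := by
    intro h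
    have h1 := (hD.vertical h).2
    have h2 := Finset.card_le_card (hrc (Fin.last (D.d + 1)))
    rw [hcard] at h2
    omega
  have hne_last : ∀ r, D.row r ≠ Fin.last (D.d + 1) := fun r hr =>
    hlast ⟨μ r, Finset.mem_filter.2 ⟨hcolG r, (hcol r).trans hr⟩⟩
  have hunm : ∀ c ∈ G.cols, (∀ s, μ s ≠ c) → D.col c = 0 := by
    intro c hc hs
    by_contra h0
    by_cases hl : D.col c = Fin.last (D.d + 1)
    · exact hlast ⟨c, Finset.mem_filter.2 ⟨hc, hl⟩⟩
    have h1 := hD.square (D.col c) ⟨h0, hl⟩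
    have h2 := Finset.eq_of_subset_of_card_le (hrc (D.col c)) (by rw [hcard, h1.2.2])
    have h3 : c ∈ (D.comp G (D.col c)).cols := Finset.mem_filter.2 ⟨hc, rfl⟩
    rw [← h2] at h3
    obtain ⟨s, -, h4⟩ := Finset.mem_image.1 h3
    exact hs s h4
  have hunm' : ∀ c ∈ G.cols, (∀ s, μ s ≠ c) → D'.col c = 0 := by
    intro c hc hs
    by_contra h0
    obtain ⟨r, hr⟩ := hD'.col_matched c hc h0
    exact hs r (mem_matchingOf.1 hr)
  have hstep : ∀ r s, AltStep G (matchingOf μ) r s ↔ (r, μ s) ∈ G.edges := by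
    intro r s
    constructor
    · rintro ⟨c, h1, h2⟩
      rw [mem_matchingOf] at h2
      exact h2 ▸ h1
    · intro h
      exact ⟨μ s, h, mem_matchingOf.2 rfl⟩
  have hreach : ∀ r s, Relation.ReflTransGen (AltStep G (matchingOf μ)) r s →
      MatchReach (fun r c => (r, c) ∈ G.edges) μ r s := fun r s h =>
    Relation.ReflTransGen.mono (fun a b hab => (hstep a b).1 hab) _ _ h
  have hmono : ∀ r s, MatchReach (fun r c => (r, c) ∈ G.edges) μ r s → D.row r ≤ D.row s := by
    intro r s hrs
    induction hrs with
    | refl => exact le_rfl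
    | tail _ hst ih => exact ih.trans ((hD.triangular _ hst).trans (hcol _).le)
  have hzero' : ∀ r, D'.row r = 0 → ∃ r' c,
      MatchReach (fun r c => (r, c) ∈ G.edges) μ r r' ∧ (r', c) ∈ G.edges ∧ ∀ s, μ s ≠ c := by
    intro r hr
    obtain ⟨r', c, h1, h2, h3⟩ := hD'.zero r (hrow r) hr
    exact ⟨r', c, hreach _ _ h1, h2, fun s hs => h3 s (mem_matchingOf.2 hs)⟩
  have hlast' : ∀ r, D'.row r ≠ Fin.last (D'.d + 1) := by
    intro r hr
    obtain ⟨r₀, -, h, -⟩ := hD'.last r (hrow r) hr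
    exact h (μ r₀) (mem_matchingOf.2 rfl)
  have hzz : ∀ r, D'.row r = 0 → D.row r = 0 := by
    intro r hr
    obtain ⟨r', c, h1, h2, h3⟩ := hzero' r hr
    refine Fin.le_zero_iff.1 ((hmono _ _ h1).trans ((hD.triangular _ h2).trans ?_))
    exact (hunm c (G.edges_mem _ h2).2 h3).le
  have hfine : ∀ r s, D'.row r = D'.row s → D.row r = D.row s := by
    intro r s hrs
    by_cases h0 : D'.row r = 0
    · rw [hzz r h0, hzz s (hrs ▸ h0)]
    · refine le_antisymm (hmono _ _ (hreach _ _ ?_)) (hmono _ _ (hreach _ _ ?_))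
      · exact hD'.conn r (hrow r) s (hrow s) ⟨h0, hlast' r⟩ hrs
      · exact hD'.conn s (hrow s) r (hrow r) ⟨hrs ▸ h0, hlast' s⟩ hrs.symm
  -- `ψ` picks a class of `D'` inside each class of `D`. The default 0 serves a horizontal tail of
  -- `D` that consists of unmatched columns only.
  let ψ : Fin (D.d + 2) → Fin (D'.d + 2) := fun k =>
    if h : ∃ r, D.row r = k then D'.row h.choose else 0
  have hψ : ∀ k, (∃ r, D.row r = k ∧ D'.row r = ψ k) ∨ ((∀ r, D.row r ≠ k) ∧ ψ k = 0) := by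
    intro k
    by_cases h : ∃ r, D.row r = k
    · exact Or.inl ⟨h.choose, h.choose_spec, by simp only [ψ, dif_pos h]⟩
    · refine Or.inr ⟨fun r hr => h ⟨r, hr⟩, by simp only [ψ, dif_neg h]⟩
  let K := Finset.univ.filter
    (fun k => (D.comp G k).rows.Nonempty ∨ (D.comp G k).cols.Nonempty)
  let K' := Finset.univ.filter
    (fun k => (D'.comp G k).rows.Nonempty ∨ (D'.comp G k).cols.Nonempty)
  have hK : ∀ k, k ∈ K ↔ (D.comp G k).rows.Nonempty ∨ (D.comp G k).cols.Nonempty := fun k => by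
    simp [K]
  have hK' : ∀ k, k ∈ K' ↔ (D'.comp G k).rows.Nonempty ∨ (D'.comp G k).cols.Nonempty :=
    fun k => by simp [K']
  have hrowK' : ∀ r, D'.row r ∈ K' := fun r =>
    (hK' _).2 (Or.inl ⟨r, Finset.mem_filter.2 ⟨hrow r, rfl⟩⟩)
  have hemp : ∀ k ∈ K, (∀ r, D.row r ≠ k) →
      k = 0 ∧ ∃ c ∈ G.cols, ∀ s, μ s ≠ c := by
    intro k hk hr
    rcases (hK k).1 hk with ⟨r, h⟩ | ⟨c, h⟩
    · exact absurd (Finset.mem_filter.1 h).2 (hr r)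
    · obtain ⟨hc, hck⟩ := Finset.mem_filter.1 h
      have hs : ∀ s, μ s ≠ c := by
        rintro s rfl
        exact hr s ((hcol s).symm.trans hck)
      exact ⟨hck.symm.trans (hunm c hc hs), c, hc, hs⟩
  have hmaps : Set.MapsTo ψ K K' := by
    intro k hk
    rcases hψ k with ⟨r, -, h⟩ | ⟨h1, h2⟩
    · exact h ▸ hrowK' r
    · obtain ⟨-, c, hc, hs⟩ := hemp k hk h1
      rw [h2]
      exact (hK' _).2 (Or.inr ⟨c, Finset.mem_filter.2 ⟨hc, hunm' c hc hs⟩⟩)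
  have hinj : Set.InjOn ψ K := by
    intro k hk l hl hkl
    rcases hψ k with ⟨r, h1, h2⟩ | ⟨h1, h2⟩ <;> rcases hψ l with ⟨s, h3, h4⟩ | ⟨h3, h4⟩
    · rw [← h1, ← h3]
      exact hfine r s (h2.trans (hkl.trans h4.symm))
    · rw [(hemp l hl h3).1, ← h1]
      exact hzz r (h2.trans (hkl.trans h4))
    · rw [(hemp k hk h1).1, ← h3]
      exact (hzz s (h4.trans (hkl.symm.trans h2))).symm
    · rw [(hemp k hk h1).1, (hemp l hl h3).1]
  -- Maximality of `D` enters here: an injection from the nonempty components of `D` to the no more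
  -- numerous ones of `D'` is onto, so no class of `D` splits.
  have hsurj : K.image ψ = K' := by
    refine Finset.eq_of_subset_of_card_le ?_ ?_
    · intro x hx
      obtain ⟨k, hk, rfl⟩ := Finset.mem_image.1 hx
      exact hmaps hk
    · rw [Finset.card_image_of_injOn hinj]
      exact hD.maximal D' (hD'.isBlockDecomposition hM)
  have hψrow : ∀ r, D'.row r = ψ (D.row r) := by
    intro r
    have := hrowK' r
    rw [← hsurj] at this
    obtain ⟨k, hk, h⟩ := Finset.mem_image.1 this
    rcases hψ k with ⟨s, h1, h2⟩ | ⟨h1, h2⟩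
    · rw [hfine r s (h.symm.trans h2.symm), h1, h]
    · rw [hzz r (h.symm.trans h2), ← h, (hemp k hk h1).1]
  refine ⟨fun h => hD.triangular _ h, hcol, ?_, ?_, hne_last, ?_⟩
  · intro r c h h0
    by_contra hs
    push Not at hs
    exact h0 (hunm c (G.edges_mem _ h).2 hs)
  · intro r hr
    refine hzero' r ?_
    have h1 := hD.horizontal ⟨r, Finset.mem_filter.2 ⟨hrow r, hr⟩⟩
    obtain ⟨c, hc, hcn⟩ := Finset.exists_of_ssubset (Finset.ssubset_iff_subset_ne.2
      ⟨hrc 0, fun h => by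
        have := congrArg Finset.card h
        rw [hcard] at this
        omega⟩)
    obtain ⟨hcG, hc0⟩ := Finset.mem_filter.1 hc
    have hs : ∀ s, μ s ≠ c := by
      rintro s rfl
      exact hcn (Finset.mem_image.2 ⟨s, Finset.mem_filter.2 ⟨hrow s, (hcol s).symm.trans hc0⟩, rfl⟩)
    -- The unmatched column `c` lies in both horizontal tails, so that of `D'` is nonempty and is
    -- hit by `ψ`; it can only be the image of the tail of `D`.
    have h0 : (0 : Fin (D'.d + 2)) ∈ K' :=
      (hK' _).2 (Or.inr ⟨c, Finset.mem_filter.2 ⟨hcG, hunm' c hcG hs⟩⟩)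
    rw [← hsurj] at h0
    obtain ⟨k, hk, h⟩ := Finset.mem_image.1 h0
    rw [hψrow, hr]
    rcases hψ k with ⟨s, h3, h4⟩ | ⟨h3, h4⟩
    · rw [← hzz s (h4.trans h), h3, h]
    · rw [← (hemp k hk h3).1, h]
  · intro r s hsq hrs
    have h1 : D'.row r = D'.row s := by rw [hψrow, hψrow, hrs]
    exact hreach _ _ (hD'.conn r (hrow r) s (hrow s)
      ⟨fun h => hsq.1 (hzz r h), hlast' r⟩ h1)

namespace MatchLabels

variable {D : BlockLabels R C}

/-- Since `μ` matches every component row-perfectly, covering a component amounts to matching all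
its rows inside it. -/
theorem covers_comp_iff (h : MatchLabels (fun r c => (r, c) ∈ G.edges) μ D)
    (hμ : Function.Injective μ) (hadj : ∀ r, (r, μ r) ∈ G.edges) {N : Finset (R × C)}
    (hN : G.IsMatching N) (k : Fin (D.d + 2)) :
    BipGraph.Covers N (D.comp G k) ↔ ∀ r, D.row r = k → ∃ c, (r, c) ∈ N ∧ D.col c = k := by
  rw [BipGraph.Covers, BipGraph.isMaxMatching_iff_of_perfect hμ.injOn (fun r hr =>
    Finset.mem_filter.2 ⟨hadj r, (Finset.mem_filter.1 hr).2,
      (h.col_eq r).trans (Finset.mem_filter.1 hr).2⟩)]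
  constructor
  · rintro ⟨-, h2⟩ r hr
    obtain ⟨c, hc⟩ := h2 r (Finset.mem_filter.2 ⟨(G.edges_mem _ (hadj r)).1, hr⟩)
    obtain ⟨h3, h4⟩ := Finset.mem_inter.1 hc
    exact ⟨c, h3, (Finset.mem_filter.1 h4).2.2⟩
  · intro h2
    refine ⟨inter_comp_isMatching hN k, fun r hr => ?_⟩
    have hrk := (Finset.mem_filter.1 hr).2
    obtain ⟨c, h3, h4⟩ := h2 r hrk
    exact ⟨c, Finset.mem_inter.2 ⟨h3, Finset.mem_filter.2 ⟨hN.1 h3, hrk, h4⟩⟩⟩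

theorem covers_unionComp_iff (h : MatchLabels (fun r c => (r, c) ∈ G.edges) μ D)
    (hμ : Function.Injective μ) (hadj : ∀ r, (r, μ r) ∈ G.edges) {N : Finset (R × C)}
    (hN : G.IsMatching N) (K : Set (Fin (D.d + 2))) :
    BipGraph.Covers N (D.unionComp G K) ↔ ∀ k ∈ K, BipGraph.Covers N (D.comp G k) := by
  classical
  have hmem : ∀ r, r ∈ (D.unionComp G K).rows ↔ D.row r ∈ K := fun r => by
    simp only [BlockLabels.unionComp, Finset.mem_filter, and_iff_right_iff_imp]
    exact fun _ => (G.edges_mem _ (hadj r)).1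
  have hedge : ∀ e, e ∈ (D.unionComp G K).edges ↔
      e ∈ G.edges ∧ D.row e.1 = D.col e.2 ∧ D.row e.1 ∈ K := fun e => by
    simp only [BlockLabels.unionComp, Finset.mem_filter]
  rw [BipGraph.Covers, BipGraph.isMaxMatching_iff_of_perfect hμ.injOn (fun r hr =>
    (hedge _).2 ⟨hadj r, (h.col_eq r).symm, (hmem r).1 hr⟩)]
  simp only [h.covers_comp_iff hμ hadj hN]
  constructor
  · rintro ⟨-, h2⟩ k hk r hr
    obtain ⟨c, hc⟩ := h2 r ((hmem r).2 (hr ▸ hk))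
    obtain ⟨h3, h4⟩ := Finset.mem_inter.1 hc
    exact ⟨c, h3, ((hedge _).1 h4).2.1.symm.trans hr⟩
  · intro h2
    refine ⟨⟨Finset.inter_subset_right, fun e he f hf => hN.2 e (Finset.mem_inter.1 he).1 f
      (Finset.mem_inter.1 hf).1⟩, fun r hr => ?_⟩
    obtain ⟨c, h3, h4⟩ := h2 _ ((hmem r).1 hr) r rfl
    exact ⟨c, Finset.mem_inter.2 ⟨h3, (hedge _).2 ⟨hN.1 h3, h4.symm, (hmem r).1 hr⟩⟩⟩

theorem isMaxMatching_delRow_iff (hμ : Function.Injective μ) (hadj : ∀ r, (r, μ r) ∈ G.edges)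
    {l : R} {N : Finset (R × C)} : (G.delRow l).IsMaxMatching N ↔
      (G.delRow l).IsMatching N ∧ ∀ r, r ≠ l → ∃ c, (r, c) ∈ N := by
  have hmem : ∀ r, r ∈ (G.delRow l).rows ↔ r ≠ l := fun r => by
    simp only [BipGraph.delRow, Finset.mem_erase, and_iff_left_iff_imp]
    exact fun _ => (G.edges_mem _ (hadj r)).1
  rw [BipGraph.isMaxMatching_iff_of_perfect hμ.injOn (fun r hr =>
    Finset.mem_filter.2 ⟨hadj r, (hmem r).1 hr⟩)]
  simp only [hmem]

/-- This turns the matching condition in the definition of Ω_j^l into reachability by alternating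
paths. The rows reachable from G_k have only their own partners as neighbours. If `l` is not among
them, counting forces each matching to cover G_k; if `l` is reachable, deleting it frees a partner
column of G_k. -/
theorem exists_not_covers_iff [Fintype R] [Fintype C] (h : MatchLabels (fun r c => (r, c) ∈ G.edges) μ D)
    (hμ : Function.Injective μ) (hadj : ∀ r, (r, μ r) ∈ G.edges) {k : Fin (D.d + 2)}
    (hk : D.IsSquare k) (l : R) :
    (∃ N, (G.delRow l).IsMaxMatching N ∧ ¬ BipGraph.Covers N (D.comp G k)) ↔
      l ∈ reachSet (fun r c => (r, c) ∈ G.edges) μ D k := by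
  classical
  have hGm : ∀ {N}, (G.delRow l).IsMatching N → G.IsMatching N := fun hN =>
    ⟨hN.1.trans (Finset.filter_subset _ _), hN.2⟩
  constructor
  · rintro ⟨N, hN, hcov⟩
    by_contra hl
    apply hcov
    rw [isMaxMatching_delRow_iff hμ hadj] at hN
    obtain ⟨hN, hNp⟩ := hN
    rw [h.covers_comp_iff hμ hadj (hGm hN)]
    set Y := reachSet (fun r c => (r, c) ∈ G.edges) μ D k with hY
    -- The reachable rows with label above `k` use up all of their partner columns, by triangularity
    -- and a count. This leaves only columns labelled `k` for the rows labelled `k`.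
    let Z := Y.filter (fun r => D.row r ≠ k)
    have : Nonempty C := ⟨μ l⟩
    choose! ν hν using hNp
    have hYl : ∀ r ∈ Y, r ≠ l := fun r hr hrl => hl (hrl ▸ hr)
    have hYν : ∀ r ∈ Y, ∃ s ∈ Y, μ s = ν r := fun r hr =>
      h.matchClosed_reachSet hk.1 r hr _ ((hGm hN).1 (hν r (hYl r hr)))
    have hZY : ∀ r ∈ Z, r ∈ Y := fun r hr => (Finset.mem_filter.1 hr).1
    have hZcard : (Z.image ν).card = Z.card := by
      refine Finset.card_image_of_injOn fun r hr s hs hrs => ?_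
      exact congrArg Prod.fst (hN.2 _ (hν r (hYl r (hZY r hr))) _ (hν s (hYl s (hZY s hs)))
        (Or.inr hrs))
    have hZsub : Z.image ν ⊆ Z.image μ := by
      intro c hc
      obtain ⟨r, hr, rfl⟩ := Finset.mem_image.1 hc
      obtain ⟨s, hs, hsr⟩ := hYν r (hZY r hr)
      refine Finset.mem_image.2 ⟨s, Finset.mem_filter.2 ⟨hs, ?_⟩, hsr⟩
      have h1 := h.le_row_of_mem_reachSet (hZY r hr)
      have h2 : D.row r ≤ D.row s := by
        rw [← h.col_eq s, hsr]
        exact h.row_le_col ((hGm hN).1 (hν r (hYl r (hZY r hr))))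
      intro h3
      exact (Finset.mem_filter.1 hr).2 (le_antisymm (h2.trans h3.le) h1)
    have hZeq := Finset.eq_of_subset_of_card_le hZsub (by
      rw [hZcard, Finset.card_image_of_injective _ hμ])
    intro r hr
    have hrY : r ∈ Y := mem_reachSet.2 ⟨r, hr, Relation.ReflTransGen.refl⟩
    refine ⟨ν r, hν r (hYl r hrY), ?_⟩
    obtain ⟨s, hs, hsr⟩ := hYν r hrY
    rw [← hsr, h.col_eq]
    by_contra hsk
    have : μ s ∈ Z.image μ := Finset.mem_image.2 ⟨s, Finset.mem_filter.2 ⟨hs, hsk⟩, rfl⟩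
    rw [← hZeq] at this
    obtain ⟨r', hr', hrr⟩ := Finset.mem_image.1 this
    have : r = r' := congrArg Prod.fst (hN.2 _ (hν r (hYl r hrY)) _
      (hν r' (hYl r' (hZY r' hr'))) (Or.inr (hsr.symm.trans hrr.symm)))
    exact (Finset.mem_filter.1 hr').2 (this ▸ hr)
  · intro hl
    obtain ⟨v, hv, hvl⟩ := mem_reachSet.1 hl
    -- The remaining rows are matched so as to avoid the column `μ v` of G_k. An obstruction would
    -- be a closed set containing `v` but not `l`, although `l` is reachable from `v`.
    rcases avoidable_or_exists_closed (adj := fun r c => (r, c) ∈ G.edges) hμ hadj (Finset.univ.erase l) (μ v) with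
      ⟨ν, hν, hνS⟩ | ⟨X, hX, hXc, s, hs, hsv⟩
    · have hN : (G.delRow l).IsMaxMatching ((Finset.univ.erase l).image (fun r => (r, ν r))) := by
        rw [isMaxMatching_delRow_iff hμ hadj]
        refine ⟨⟨?_, ?_⟩, fun r hr => ⟨ν r, Finset.mem_image.2 ⟨r, by simpa using hr, rfl⟩⟩⟩
        · intro e he
          obtain ⟨r, hr, rfl⟩ := Finset.mem_image.1 he
          exact Finset.mem_filter.2 ⟨(hνS r hr).1, (Finset.mem_erase.1 hr).1⟩
        · intro e he f hf
          obtain ⟨r, hr, rfl⟩ := Finset.mem_image.1 he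
          obtain ⟨s, hs, rfl⟩ := Finset.mem_image.1 hf
          rintro (h | h)
          · rw [show r = s from h]
          · rw [hν hr hs h]
      refine ⟨_, hN, ?_⟩
      rw [h.covers_comp_iff hμ hadj (hGm hN.1)]
      intro hcov
      let V := Finset.univ.filter (fun r => D.row r = k)
      have hV : ∀ r ∈ V, r ∈ Finset.univ.erase l ∧ D.col (ν r) = k := by
        intro r hr
        obtain ⟨c, hc, hck⟩ := hcov r (Finset.mem_filter.1 hr).2
        obtain ⟨r', hr', hrr⟩ := Finset.mem_image.1 hc
        obtain ⟨rfl, rfl⟩ := Prod.mk.inj hrr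
        exact ⟨hr', hck⟩
      -- Covering G_k without the column `μ v` would match its rows into one column too few.
      have h1 : V.card ≤ ((V.image μ).erase (μ v)).card := by
        refine Finset.card_le_card_of_injOn ν ?_ (hν.mono (fun r hr => (hV r hr).1))
        intro r hr
        obtain ⟨hr1, hr2⟩ := hV r hr
        obtain ⟨hr3, hr4⟩ := hνS r hr1
        obtain ⟨s, hs⟩ := h.col_matched hr3 (fun h0 => hk.1 (hr2.symm.trans h0))
        refine Finset.mem_coe.2 (Finset.mem_erase.2 ⟨hr4, Finset.mem_image.2 ⟨s, ?_, hs⟩⟩)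
        refine Finset.mem_filter.2 ⟨Finset.mem_univ _, ?_⟩
        rw [← h.col_eq, hs, hr2]
      have hvV : v ∈ V := Finset.mem_filter.2 ⟨Finset.mem_univ v, hv⟩
      have h2 := Finset.card_erase_add_one (Finset.mem_image_of_mem μ hvV)
      have h3 : (V.image μ).card = V.card := Finset.card_image_of_injective _ hμ
      omega
    · have := hX (hXc.mem_of_reach hμ (hμ hsv ▸ hs) hvl)
      exact absurd rfl (Finset.mem_erase.1 this).1

end MatchLabels

end Decomposition

/-! ### Left null vectors of a generic pencil -/

section NullVectors

variable {R C : Type*}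

theorem det_matchedMinor_eq_zero [DecidableEq R] {N : Matrix R C ℂ} {S : Finset R} {ν : R → C} {q : R → ℂ}
    (hq : ∃ r ∈ S, q r ≠ 0) (h : ∀ s ∈ S, ∑ r ∈ S, q r * N r (ν s) = 0) :
    (matchedMinor N S ν).det = 0 := by
  apply Matrix.exists_vecMul_eq_zero_iff.1
  obtain ⟨r, hr, hqr⟩ := hq
  refine ⟨fun r => q r, fun h0 => hqr (congrFun h0 ⟨r, hr⟩), ?_⟩
  ext s
  simp only [Matrix.vecMul, dotProduct, matchedMinor, Matrix.submatrix_apply, Pi.zero_apply]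
  rw [Finset.sum_coe_sort S (fun r => q r * N r (ν s))]
  exact h s s.2

variable [Fintype R]

/-- The support of a left null vector. -/
noncomputable def nullSupport (q : R → ℂ) : Finset R := by
  classical exact Finset.univ.filter (fun r => q r ≠ 0)

theorem mem_nullSupport {q : R → ℂ} {r : R} : r ∈ nullSupport q ↔ q r ≠ 0 := by
  simp [nullSupport]

/-- The rows with a given label. -/
def labelRows (D : BlockLabels R C) (k : Fin (D.d + 2)) : Finset R :=
  Finset.univ.filter (fun r => D.row r = k)

theorem mem_labelRows {D : BlockLabels R C} {k : Fin (D.d + 2)} {r : R} :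
    r ∈ labelRows D k ↔ D.row r = k := by
  simp [labelRows]

variable [DecidableEq R]

/-- `q` is a left null vector of the matrix `N` without its column `j`. -/
def IsNullVector (N : Matrix R C ℂ) (j : C) (q : R → ℂ) : Prop :=
  ∀ c, c ≠ j → ∑ r, q r * N r c = 0

variable {W : Matrix R C Entry} {ℓ : R → C} {p : StarPos W → ℂ} {z : ℂ} {j : C} {μ : R → C}

/-- The edges of the pencil outside of the column `j`. -/
def PencilAdj (W : Matrix R C Entry) (ℓ : R → C) (z : ℂ) (j : C) (r : R) (c : C) : Prop :=
  PencilEdge W ℓ z r c ∧ c ≠ j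

/-- A null vector restricted to `S` still annihilates the chosen columns if the rows outside `S`
contribute nothing to them. This is how singular minors are obtained from null vectors. -/
theorem det_matchedMinor_support {S : Finset R} {ν : R → C} {q : R → ℂ} {N : Matrix R C ℂ}
    (hN : IsNullVector N j q) (hS : ∃ r ∈ S, q r ≠ 0) (hνj : ∀ s ∈ S, ν s ≠ j)
    (h : ∀ r, r ∉ S → ∀ s ∈ S, q r * N r (ν s) = 0) : (matchedMinor N S ν).det = 0 := by
  refine det_matchedMinor_eq_zero hS fun s hs => ?_
  rw [← hN (ν s) (hνj s hs)]
  exact Finset.sum_subset (Finset.subset_univ _) (fun r _ hr => h r hr s hs)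

variable [DecidableEq C]

/-- The support of a left null vector of a generic pencil is closed. -/
theorem IsNullVector.matchClosed_nullSupport [Fintype C] (hp : AlgebraicIndependent ℚ p)
    (hμ : Function.Injective μ) (hadj : ∀ r, PencilAdj W ℓ z j r (μ r)) {q : R → ℂ}
    (hq : IsNullVector (genPencil W ℓ p z) j q) :
    MatchClosed (PencilAdj W ℓ z j) μ (nullSupport q) := by
  classical
  set S := nullSupport q with hS
  have hdet : ∀ ν : R → C, (∀ r ∈ S, PencilAdj W ℓ z j r (ν r)) → S.Nonempty →
      (matchedMinor (genPencil W ℓ p z) S ν).det = 0 := by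
    rintro ν hν ⟨r, hr⟩
    refine det_matchedMinor_support hq ⟨r, hr, mem_nullSupport.1 hr⟩ (fun s hs => (hν s hs).2) ?_
    intro r hr s _
    rw [hS, mem_nullSupport, not_not] at hr
    rw [hr, zero_mul]
  -- If no partner of the support can be avoided, Hall's theorem confines the neighbours of the
  -- support to its partners.
  have hall : ∀ r ∈ S, ¬ Avoidable (PencilAdj W ℓ z j) S (μ r) := by
    by_contra! hex
    obtain ⟨t, ht, hta⟩ := hex
    obtain ⟨r₀, c₀, hcommon⟩ := exists_common_position hp (hμ.injOn (s := S))
      (fun r _ => (hadj r).1) (hdet μ (fun r _ => hadj r) ⟨t, ht⟩)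
    -- Rows of the support outside `T` have zero entries in the columns `μ(T)`, so the minor on `T`
    -- vanishes as well. The common column is therefore some `μ s` with `s ∈ T`.
    let T := S.filter (fun r => Avoidable (PencilAdj W ℓ z j) S (μ r))
    have htT : t ∈ T := Finset.mem_filter.2 ⟨ht, hta⟩
    obtain ⟨-, s, hs, rfl⟩ := hcommon T μ hμ.injOn (fun r _ => (hadj r).1) (by
      refine det_matchedMinor_support hq ⟨t, htT, mem_nullSupport.1 ht⟩ (fun s _ => (hadj s).2) ?_
      intro r hr s hs
      by_cases hrS : r ∈ S
      · have hra : ¬ Avoidable (PencilAdj W ℓ z j) S (μ r) := fun h =>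
          hr (Finset.mem_filter.2 ⟨hrS, h⟩)
        rw [genPencil_eq_zero, mul_zero]
        intro he
        exact (not_avoidable_of_adj hμ hadj hra ⟨he, (hadj s).2⟩).2 (Finset.mem_filter.1 hs).2
      · rw [hS, mem_nullSupport, not_not] at hrS
        rw [hrS, zero_mul])
    obtain ⟨ν, hν, hνS⟩ := (Finset.mem_filter.1 hs).2
    -- A matching `ν` of the support that avoids `μ s` gives another vanishing minor, without the
    -- supposedly common column.
    obtain ⟨-, s', hs', h⟩ := hcommon S ν hν (fun r hr => (hνS r hr).1.1)
      (hdet ν (fun r hr => (hνS r hr).1) ⟨t, ht⟩)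
    exact (hνS s' hs').2 h
  intro r hr c hrc
  exact (not_avoidable_of_adj hμ hadj (hall r hr) hrc).1

open MatchLabels in
/-- A singular component gives rise to a left null vector. -/
theorem MatchLabels.exists_isNullVector
    (hadj : ∀ r, PencilAdj W ℓ z j r (μ r)) {D : BlockLabels R C}
    (hD : MatchLabels (PencilAdj W ℓ z j) μ D) {k : Fin (D.d + 2)} (hk : k ≠ 0)
    (hdet : (matchedMinor (genPencil W ℓ p z) (labelRows D k) μ).det = 0) :
    ∃ q : R → ℂ, q ≠ 0 ∧ IsNullVector (genPencil W ℓ p z) j q ∧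
      ∀ r, r ∉ reachSet (PencilAdj W ℓ z j) μ D k → q r = 0 := by
  classical
  -- The minor on the reachable rows is block triangular with the singular block `k` on its
  -- diagonal: a right kernel vector of that block, extended by zero, is a kernel vector of the
  -- whole.
  have hYdet : (matchedMinor (genPencil W ℓ p z)
      (reachSet (PencilAdj W ℓ z j) μ D k) μ).det = 0 := by
    obtain ⟨w, hw0, hw⟩ := Matrix.exists_mulVec_eq_zero_iff.2 hdet
    let w' : R → ℂ := fun r => if h : r ∈ labelRows D k then w ⟨r, h⟩ else 0
    apply Matrix.exists_mulVec_eq_zero_iff.1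
    have hsub : labelRows D k ⊆ reachSet (PencilAdj W ℓ z j) μ D k := fun v hv =>
      mem_reachSet.2 ⟨v, mem_labelRows.1 hv, Relation.ReflTransGen.refl⟩
    refine ⟨fun r => w' r, ?_, ?_⟩
    · obtain ⟨v, hv⟩ := Function.ne_iff.1 hw0
      intro h0
      apply hv
      have := congrFun h0 ⟨v, hsub v.2⟩
      simp only [w', dif_pos v.2] at this
      exact this
    · ext r
      have e1 : ∑ s ∈ reachSet (PencilAdj W ℓ z j) μ D k, genPencil W ℓ p z r (μ s) * w' s =
          ∑ s ∈ labelRows D k, genPencil W ℓ p z r (μ s) * w' s := by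
        refine (Finset.sum_subset hsub fun s _ hs => ?_).symm
        simp only [w', dif_neg hs, mul_zero]
      simp only [Matrix.mulVec, dotProduct, matchedMinor, Matrix.submatrix_apply, Pi.zero_apply]
      rw [Finset.sum_coe_sort (reachSet (PencilAdj W ℓ z j) μ D k)
        (fun s => genPencil W ℓ p z r (μ s) * w' s), e1]
      by_cases hrk : D.row r = k
      · have := congrFun hw ⟨r, mem_labelRows.2 hrk⟩
        simp only [Matrix.mulVec, dotProduct, matchedMinor, Matrix.submatrix_apply,
          Pi.zero_apply] at this
        rw [← this, ← Finset.sum_coe_sort (labelRows D k)]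
        refine Finset.sum_congr rfl fun s _ => ?_
        simp only [w', dif_pos s.2]
      · refine Finset.sum_eq_zero fun s hs => ?_
        rw [genPencil_eq_zero, zero_mul]
        intro he
        refine hrk (le_antisymm ?_ (hD.le_row_of_mem_reachSet r.2))
        exact (hD.row_le_col ⟨he, (hadj s).2⟩).trans
          ((hD.col_eq s).trans (mem_labelRows.1 hs)).le
  obtain ⟨y, hy0, hy⟩ := Matrix.exists_vecMul_eq_zero_iff.2 hYdet
  let y' : R → ℂ := fun r =>
    if h : r ∈ reachSet (PencilAdj W ℓ z j) μ D k then y ⟨r, h⟩ else 0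
  -- The reachable set is closed, so its rows vanish in every column other than `j` that is not a
  -- partner. A left kernel vector of the minor thus extends by zero.
  have hnull : IsNullVector (genPencil W ℓ p z) j y' := by
    intro c hc
    rw [← Finset.sum_subset (Finset.subset_univ (reachSet (PencilAdj W ℓ z j) μ D k))
      (fun s _ hs => by simp only [y', dif_neg hs, zero_mul])]
    by_cases hcY : ∃ s ∈ reachSet (PencilAdj W ℓ z j) μ D k, μ s = c
    · obtain ⟨s, hs, rfl⟩ := hcY
      have := congrFun hy ⟨s, hs⟩
      simp only [Matrix.vecMul, dotProduct, matchedMinor, Matrix.submatrix_apply,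
        Pi.zero_apply] at this
      rw [← this, ← Finset.sum_coe_sort (reachSet (PencilAdj W ℓ z j) μ D k)]
      refine Finset.sum_congr rfl fun r _ => ?_
      simp only [y', dif_pos r.2]
    · refine Finset.sum_eq_zero fun s hs => ?_
      rw [genPencil_eq_zero, mul_zero]
      intro he
      exact hcY (hD.matchClosed_reachSet hk s hs c ⟨he, hc⟩)
  refine ⟨y', ?_, hnull, fun r hr => by simp only [y', dif_neg hr]⟩
  intro h0
  apply hy0
  ext s
  have := congrFun h0 s
  simp only [y', dif_pos s.2] at this
  exact this

open MatchLabels in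
/-- The structure of the left null vectors of a generic pencil whose rank deficiency is one: such a
vector stems from a single square component. -/
theorem IsNullVector.exists_component [Fintype C] (hp : AlgebraicIndependent ℚ p)
    (hμ : Function.Injective μ) (hadj : ∀ r, PencilAdj W ℓ z j r (μ r)) {D : BlockLabels R C}
    (hD : MatchLabels (PencilAdj W ℓ z j) μ D) {q : R → ℂ} (hq0 : q ≠ 0)
    (hq : IsNullVector (genPencil W ℓ p z) j q)
    (huniq : ∀ q', IsNullVector (genPencil W ℓ p z) j q' → ∃ a : ℂ, q' = a • q) :
    ∃ k, D.IsSquare k ∧ (matchedMinor (genPencil W ℓ p z) (labelRows D k) μ).det = 0 ∧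
      ∀ r, q r ≠ 0 ↔ r ∈ reachSet (PencilAdj W ℓ z j) μ D k := by
  classical
  have hcl := hq.matchClosed_nullSupport hp hμ hadj
  obtain ⟨r₁, hr₁⟩ : ∃ r, q r ≠ 0 := Function.ne_iff.1 hq0
  -- The component with the smallest label in the support receives no contributions from other rows
  -- of the support, so its block is singular.
  obtain ⟨r₀, hr₀, hmin⟩ := Finset.exists_min_image (nullSupport q) D.row
    ⟨r₁, mem_nullSupport.2 hr₁⟩
  set k := D.row r₀ with hk
  have hsq : D.IsSquare k := hD.isSquare_of_mem_closed hμ hcl hr₀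
  have hdet : (matchedMinor (genPencil W ℓ p z) (labelRows D k) μ).det = 0 := by
    refine det_matchedMinor_support hq ⟨r₀, mem_labelRows.2 rfl, mem_nullSupport.1 hr₀⟩
      (fun s _ => (hadj s).2) ?_
    intro r hr s hs
    by_cases hqr : q r = 0
    · rw [hqr, zero_mul]
    rw [genPencil_eq_zero, mul_zero]
    intro he
    refine hr (mem_labelRows.2 (le_antisymm ?_ (hmin r (mem_nullSupport.2 hqr))))
    exact (hD.row_le_col ⟨he, (hadj s).2⟩).trans
      ((hD.col_eq s).trans (mem_labelRows.1 hs)).le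
  refine ⟨k, hsq, hdet, fun r => ⟨fun hr => ?_, fun hr => ?_⟩⟩
  · obtain ⟨y, hy0, hnull, hyY⟩ := hD.exists_isNullVector hadj hsq.1 hdet
    obtain ⟨a, ha⟩ := huniq y hnull
    have ha0 : a ≠ 0 := by
      rintro rfl
      exact hy0 (ha.trans (zero_smul _ _))
    by_contra hrY
    have := congrFun ha r
    rw [hyY r hrY, Pi.smul_apply, smul_eq_mul] at this
    exact (mul_ne_zero ha0 hr) this.symm
  · obtain ⟨v, hv, hvr⟩ := mem_reachSet.1 hr
    refine mem_nullSupport.1 (hcl.mem_of_reach hμ hr₀ ?_)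
    exact (hD.conn hsq (hk.symm.trans hv.symm)).trans hvr

/-- At most one square component is singular. -/
theorem eq_of_det_labelRows_eq_zero (hp : AlgebraicIndependent ℚ p)
    (hμ : Function.Injective μ) (hadj : ∀ r, PencilAdj W ℓ z j r (μ r)) {D : BlockLabels R C}
    {k k' : Fin (D.d + 2)}
    (hk : (matchedMinor (genPencil W ℓ p z) (labelRows D k) μ).det = 0)
    (hk' : (matchedMinor (genPencil W ℓ p z) (labelRows D k') μ).det = 0) : k = k' := by
  obtain ⟨r, c, h⟩ := exists_common_position hp hμ.injOn (fun r _ => (hadj r).1) hk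
  rw [← mem_labelRows.1 (h _ μ hμ.injOn (fun r _ => (hadj r).1) hk).1,
    ← mem_labelRows.1 (h _ μ hμ.injOn (fun r _ => (hadj r).1) hk').1]

open AlgebraicIndependent in
/-- A left null vector annihilates the generic column `j` only if its support avoids the
structurally nonzero entries of this column. -/
theorem IsNullVector.sum_mul_ne_zero [Fintype C] (hp : AlgebraicIndependent ℚ p)
    (hℓ : Function.Injective ℓ) {q : R → ℂ} (hq0 : q ≠ 0)
    (hq : IsNullVector (genPencil W ℓ p z) j q)
    (huniq : ∀ q', IsNullVector (genPencil W ℓ p z) j q' → ∃ a : ℂ, q' = a • q)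
    (hz : z ∈ (matroid ℚ ℂ).closure (p '' {e | e.1.2 ≠ j})) {l : R} (hl : q l ≠ 0)
    (he : PencilEdge W ℓ z l j) : ∑ r, q r * genPencil W ℓ p z r j ≠ 0 := by
  classical
  by_cases hstar : ∃ l, q l ≠ 0 ∧ W l j = Entry.star
  · obtain ⟨l, hl, hlj⟩ := hstar
    let e₀ : StarPos W := ⟨(l, j), hlj⟩
    set T : Set ℂ := p '' {e | e ≠ e₀} with hT
    -- `K` consists of the numbers algebraic over all parameters except `p e₀`. It contains `z` and
    -- every entry outside column `j`, but not `p e₀`.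
    let K := Subalgebra.algebraicClosure (Algebra.adjoin ℚ T) ℂ
    have hKcl : ∀ x, x ∈ K ↔ x ∈ (matroid ℚ ℂ).closure T := fun x => by
      rw [matroid_closure_eq]; rfl
    have hpK : ∀ e, e ≠ e₀ → p e ∈ K := fun e he => (hKcl _).2
      ((matroid ℚ ℂ).mem_closure_of_mem ⟨e, he, rfl⟩)
    have hjT : {e : StarPos W | e.1.2 ≠ j} ⊆ {e | e ≠ e₀} := by
      rintro e he rfl
      exact he rfl
    have hzK : z ∈ K := (hKcl _).2 ((matroid ℚ ℂ).closure_subset_closure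
      (Set.image_mono hjT) hz)
    have hp₀ : p e₀ ∉ K := by
      intro h
      have hI : (matroid ℚ ℂ).Indep (Set.range p) := matroid_indep_iff.2 hp.to_subtype_range
      have h1 := hI.notMem_closure_sdiff_of_mem (Set.mem_range_self e₀)
      apply h1
      refine (matroid ℚ ℂ).closure_subset_closure ?_ ((hKcl _).1 h)
      rintro _ ⟨e, he, rfl⟩
      exact ⟨⟨e, rfl⟩, fun h => he (hp.injective h)⟩
    let t' : StarPos W → K := fun e => if h : e = e₀ then 0 else ⟨p e, hpK e h⟩
    let v : R → C → K := fun r c => if c = j then 0 else genPencil W ℓ t' ⟨z, hzK⟩ r c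
    have hv : ∀ r c, c ≠ j → (v r c : ℂ) = genPencil W ℓ p z r c := by
      intro r c hc
      simp only [v, if_neg hc]
      refine (map_genPencil (W := W) (ℓ := ℓ) (algebraMap K ℂ) t' ⟨z, hzK⟩ r c).trans ?_
      unfold genPencil
      congr 1
      split_ifs with h
      · have : (⟨(r, c), h⟩ : StarPos W) ≠ e₀ := fun h' => hc (congrArg (fun e => e.1.2) h')
        simp only [t', dif_neg this]
        rfl
      · rfl
    -- Linear dependence over ℂ of rows with entries in `K` descends to `K`. By uniqueness, `q` is
    -- then proportional to a vector `g` with entries in `K`.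
    have hdep : ¬ LinearIndependent K v := by
      rw [← linearIndependent_algebraMap_comp_iff (S := ℂ), Fintype.linearIndependent_iff]
      intro h
      apply hq0
      ext r
      refine h q ?_ r
      ext c
      by_cases hc : c = j
      · simp [v, hc]
      · rw [Finset.sum_apply]
        refine Eq.trans (Finset.sum_congr rfl fun r _ => ?_) (hq c hc)
        rw [← hv r c hc]
        rfl
    rw [Fintype.linearIndependent_iff] at hdep
    push Not at hdep
    obtain ⟨g, hg, r₁, hgr⟩ := hdep
    obtain ⟨a, ha⟩ := huniq (fun r => (g r : ℂ)) (by
      intro c hc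
      have := congrArg (fun x : K => (x : ℂ)) (congrFun hg c)
      simp only [Finset.sum_apply, Pi.smul_apply, smul_eq_mul, Pi.zero_apply,
        AddSubmonoidClass.coe_finsetSum, MulMemClass.coe_mul, ZeroMemClass.coe_zero] at this
      rw [← this]
      exact Finset.sum_congr rfl fun r _ => by rw [hv r c hc])
    have ha0 : a ≠ 0 := by
      rintro rfl
      apply hgr
      have := congrFun ha r₁
      simpa using this
    have hgl : (g l : ℂ) ≠ 0 := by
      have := congrFun ha l
      simp only [Pi.smul_apply, smul_eq_mul] at this
      rw [this]
      exact mul_ne_zero ha0 hl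
    intro h0
    have h0' : ∑ r, (g r : ℂ) * genPencil W ℓ p z r j = 0 := by
      have : ∀ r, (g r : ℂ) = a * q r := fun r => congrFun ha r
      simp only [this, mul_assoc]
      rw [← Finset.mul_sum, h0, mul_zero]
    -- If `g` annihilated column `j`, this equation could be solved for `p e₀` within `K`.
    have hmem : (g l : ℂ) * p e₀ ∈ K := by
      rw [← Finset.add_sum_erase _ _ (Finset.mem_univ l)] at h0'
      have h1 : genPencil W ℓ p z l j = p e₀ - if j = ℓ l then z else 0 := by
        simp only [genPencil, dif_pos hlj, e₀]
      have h2 : (g l : ℂ) * p e₀ = (g l : ℂ) * (if j = ℓ l then z else 0) -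
          ∑ r ∈ Finset.univ.erase l, (g r : ℂ) * genPencil W ℓ p z r j := by
        rw [h1] at h0'
        linear_combination h0'
      have hite : ∀ r, (if j = ℓ r then z else 0) ∈ K := fun r => by
        split_ifs
        · exact hzK
        · exact K.zero_mem
      rw [h2]
      refine K.sub_mem (K.mul_mem (g l).2 (hite l)) (K.sum_mem fun r hr => ?_)
      refine K.mul_mem (g r).2 (K.sub_mem ?_ (hite r))
      split_ifs with h
      · refine hpK _ (fun h' => (Finset.mem_erase.1 hr).1 (congrArg (fun e => e.1.1) h'))
      · exact K.zero_mem
    apply hp₀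
    have hinv : (g l : ℂ)⁻¹ ∈ K := by
      have : IsAlgebraic (Algebra.adjoin ℚ T) (g l : ℂ) := (g l).2
      exact this.inv
    have := K.mul_mem hinv hmem
    rwa [inv_mul_cancel_left₀ hgl] at this
  · push Not at hstar
    -- Without a parameter on the support, column `j` contributes only the single term coming from
    -- `-z` in row `l`.
    obtain ⟨hz0, hjl⟩ := he.resolve_left (hstar l hl)
    rw [Finset.sum_eq_single l]
    · refine mul_ne_zero hl ?_
      rw [genPencil, dif_neg (hstar l hl), if_pos hjl]
      simpa using hz0
    · intro r _ hr
      by_cases hqr : q r = 0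
      · rw [hqr, zero_mul]
      · rw [genPencil, dif_neg (hstar r hqr), if_neg (fun h => hr (hℓ (h.symm.trans hjl)))]
        simp
    · simp

end NullVectors

/-! ### Nonzero roots of the determinant of a component -/

/-- Over ℂ a nonzero polynomial whose only possible root is 0 is a monomial. -/
theorem Polynomial.exists_ne_zero_root_of_coeff_ne_zero {f : Polynomial ℂ} {a b : ℕ} (hab : a ≠ b)
    (ha : f.coeff a ≠ 0) (hb : f.coeff b ≠ 0) : ∃ z, z ≠ 0 ∧ f.eval z = 0 := by
  by_contra! h
  have hf : f ≠ 0 := by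
    rintro rfl
    simp at ha
  have hr : f.roots = Multiset.replicate (Multiset.card f.roots) 0 := by
    rw [Multiset.eq_replicate]
    refine ⟨rfl, fun z hz => ?_⟩
    by_contra hz0
    exact h z hz0 (Polynomial.isRoot_of_mem_roots hz)
  have hs := (IsAlgClosed.splits f).eq_prod_roots
  rw [hr] at hs
  simp only [Multiset.map_replicate, Polynomial.C_0, sub_zero, Multiset.prod_replicate] at hs
  rw [hs, Polynomial.coeff_C_mul_X_pow] at ha hb
  exact hab ((ite_ne_right_iff.1 ha).1.trans (ite_ne_right_iff.1 hb).1.symm)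

section Gamma

variable {R C : Type*} [DecidableEq R] [DecidableEq C]
  {W : Matrix R C Entry} {ℓ : R → C} {p : StarPos W → ℂ} {μ : R → C}

/-- If all structural matchings contain the same number of positions `(r, ℓ r)` and none of these
positions carries a parameter, the determinant is a monomial in `z`. -/
theorem det_matchedMinor_eq_pow_mul {V : Finset R} {s : ℕ} {z : ℂ} (hz : z ≠ 0)
    (hloop : ∀ r ∈ V, ∀ v ∈ V, μ v = ℓ r → W r (μ v) ≠ Entry.star)
    (hs : ∀ τ : Equiv.Perm V, (∀ r : V, PencilEdge W ℓ z r (μ (τ r))) →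
      (Finset.univ.filter (fun r : V => μ (τ r) = ℓ r)).card = s) :
    (matchedMinor (genPencil W ℓ p z) V μ).det =
      z ^ s * (matchedMinor (genPencil W ℓ p 1) V μ).det := by
  rw [← Matrix.det_transpose, Matrix.det_apply', ← Matrix.det_transpose, Matrix.det_apply',
    Finset.mul_sum]
  refine Finset.sum_congr rfl fun τ _ => ?_
  simp only [Matrix.transpose_apply, matchedMinor, Matrix.submatrix_apply]
  by_cases hτ : ∀ r : V, PencilEdge W ℓ z r (μ (τ r))
  · rw [← hs τ hτ, mul_left_comm]
    congr 1
    rw [← Finset.prod_const, Finset.prod_filter, ← Finset.prod_mul_distrib]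
    refine Finset.prod_congr rfl fun r _ => ?_
    by_cases hr : μ (τ r) = ℓ r
    · have := hloop r r.2 (τ r) (τ r).2 hr
      simp only [genPencil, dif_neg this, if_pos hr]
      ring
    · simp only [genPencil, if_neg hr, one_mul]
  · push Not at hτ
    obtain ⟨r, hr⟩ := hτ
    rw [Finset.prod_eq_zero (Finset.mem_univ r) (genPencil_eq_zero hr),
      Finset.prod_eq_zero (Finset.mem_univ r) (genPencil_eq_zero (fun h => hr
        (h.imp id (fun h => ⟨hz, h.2⟩)))), mul_zero, mul_zero]

/-- `Q` selects the rows in which the matching `τ` uses a parameter; the other rows use `-z`. By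
genericity it is enough to find one parameter vector for which the coefficient of this power of `z`
is nonzero. A self-loop may be put inside or outside `Q`. -/
theorem coeff_det_matchedMinor_ne_zero {V : Finset R} (hμ : Function.Injective μ)
    (hp : AlgebraicIndependent ℚ p) (τ : Equiv.Perm V) (Q : Finset V)
    (hQ : ∀ r ∈ Q, W r (μ (τ r)) = Entry.star) (hQ' : ∀ r ∉ Q, μ (τ r) = ℓ r) :
    (matchedMinor (genPencil W ℓ (fun e => Polynomial.C (p e)) Polynomial.X) V μ).det.coeff
      Qᶜ.card ≠ 0 := by
  classical
  let F : Polynomial (MvPolynomial (StarPos W) ℚ) :=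
    (matchedMinor (genPencil W ℓ (fun e => Polynomial.C (MvPolynomial.X (R := ℚ) e)) Polynomial.X) V μ).det
  have hF : ∀ t : StarPos W → ℂ, (matchedMinor (genPencil W ℓ (fun e => Polynomial.C (t e))
      Polynomial.X) V μ).det.coeff Qᶜ.card = MvPolynomial.aeval t (F.coeff Qᶜ.card) := by
    intro t
    have h1 := map_det_matchedMinor (W := W) (ℓ := ℓ)
      (Polynomial.mapRingHom (MvPolynomial.aeval (R := ℚ) t).toRingHom)
      (fun e => Polynomial.C (MvPolynomial.X (R := ℚ) e)) Polynomial.X V μ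
    simp only [Polynomial.coe_mapRingHom, Polynomial.map_C, Polynomial.map_X, AlgHom.toRingHom_eq_coe,
      RingHom.coe_coe, MvPolynomial.aeval_X] at h1
    rw [← h1, Polynomial.coeff_map]
    rfl
  rw [hF]
  intro h0
  have hzero : F.coeff Qᶜ.card = 0 := algebraicIndependent_iff.1 hp _ h0
  -- With the value 1 at the selected positions and 0 elsewhere, the permuted matrix is diag(`d`)
  -- times a matrix `N` that is the identity at `X = 0`. So the lowest coefficient of its
  -- determinant is ±1, in degree `Qᶜ.card`.
  let t : StarPos W → ℂ := fun e => if ∃ r ∈ Q, e.1 = (r.1, μ (τ r)) then 1 else 0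
  have h1 := hF t
  rw [hzero, map_zero] at h1
  set M := matchedMinor (genPencil W ℓ (fun e => Polynomial.C (t e)) Polynomial.X) V μ with hM
  have hinj : ∀ r s : V, μ (τ r) = μ (τ s) → r = s := fun r s h =>
    τ.injective (Subtype.ext (hμ h))
  have hperm := Matrix.det_permute' τ M
  let d : V → Polynomial ℂ := fun r => if r ∈ Q then 1 else - Polynomial.X
  let N : Matrix V V (Polynomial ℂ) := fun r s =>
    if r ∈ Q then M r (τ s) else if s = r then 1 else 0
  have hent : ∀ r s : V, M r (τ s) =
      (if r ∈ Q ∧ s = r then 1 else 0) - if μ (τ s) = ℓ r then Polynomial.X else 0 := by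
    intro r s
    have h1 : (∃ x ∈ Q, ((r.1, μ (τ s)) : R × C) = (x.1, μ (τ x))) ↔ r ∈ Q ∧ s = r := by
      constructor
      · rintro ⟨x, hx, hxe⟩
        obtain ⟨h2, h3⟩ := Prod.mk.inj hxe
        obtain rfl := Subtype.ext h2
        exact ⟨hx, hinj _ _ h3⟩
      · rintro ⟨hr, rfl⟩
        exact ⟨_, hr, rfl⟩
    simp only [hM, matchedMinor, Matrix.submatrix_apply, genPencil, t, h1]
    congr 1
    by_cases h : r ∈ Q ∧ s = r
    · have := hQ r h.1
      rw [if_pos h, if_pos h, dif_pos (h.2 ▸ this), Polynomial.C_1]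
    · simp only [if_neg h, Polynomial.C_0, dite_eq_ite, ite_self]
  have hfac : M.submatrix id τ = Matrix.diagonal d * N := by
    ext1 r s
    rw [Matrix.diagonal_mul]
    simp only [d, N, Matrix.submatrix_apply, id, hent]
    by_cases h : r ∈ Q
    · simp only [if_pos h, one_mul]
    · by_cases h' : s = r
      · simp [h', hQ' r h, h]
      · have h2 : ¬ μ (τ s) = ℓ r := fun h2 => h' (hinj s r (h2.trans (hQ' r h).symm))
        simp [h, h', h2]
  have hN : N.det.coeff 0 = 1 := by
    rw [Polynomial.coeff_zero_eq_eval_zero, ← Polynomial.coe_evalRingHom, RingHom.map_det]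
    have : (Polynomial.evalRingHom 0).mapMatrix N = 1 := by
      ext r s
      rw [RingHom.mapMatrix_apply, Matrix.map_apply, Matrix.one_apply]
      simp only [N, hent, eq_comm (a := r) (b := s)]
      by_cases h : r ∈ Q <;> by_cases h' : s = r <;> simp [h, h'] <;>
        split_ifs <;> simp
    rw [this, Matrix.det_one]
  have hd : ∏ r, d r = (- Polynomial.X) ^ Qᶜ.card := by
    rw [Finset.prod_ite, Finset.prod_const_one, one_mul, Finset.prod_const]
    congr 2
    ext r
    simp
  rw [hfac, Matrix.det_mul, Matrix.det_diagonal, hd] at hperm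
  have h2 := congrArg (fun f => Polynomial.coeff f Qᶜ.card) hperm
  simp only [neg_pow (Polynomial.X : Polynomial ℂ), mul_assoc] at h2
  rw [← Polynomial.C_1, ← Polynomial.C_neg, ← Polynomial.C_pow, Polynomial.coeff_C_mul,
    Polynomial.coeff_X_pow_mul', if_pos le_rfl, Nat.sub_self, hN] at h2
  rcases Int.units_eq_one_or (Equiv.Perm.sign τ) with hτ | hτ <;> simp [hτ, h1] at h2

/-- Two different powers of `z` occur in the determinant, so it is not a monomial. -/
theorem exists_root_det_matchedMinor {V : Finset R} (hμ : Function.Injective μ)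
    (hp : AlgebraicIndependent ℚ p) {τ τ' : Equiv.Perm V} {Q Q' : Finset V}
    (hQ : ∀ r ∈ Q, W r (μ (τ r)) = Entry.star) (hQc : ∀ r ∉ Q, μ (τ r) = ℓ r)
    (hQ' : ∀ r ∈ Q', W r (μ (τ' r)) = Entry.star) (hQc' : ∀ r ∉ Q', μ (τ' r) = ℓ r)
    (hne : Qᶜ.card ≠ Q'ᶜ.card) :
    ∃ z, z ≠ 0 ∧ (matchedMinor (genPencil W ℓ p z) V μ).det = 0 := by
  obtain ⟨z, hz, h⟩ := Polynomial.exists_ne_zero_root_of_coeff_ne_zero hne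
    (coeff_det_matchedMinor_ne_zero hμ hp τ Q hQ hQc)
    (coeff_det_matchedMinor_ne_zero hμ hp τ' Q' hQ' hQc')
  refine ⟨z, hz, ?_⟩
  have h1 := map_det_matchedMinor (W := W) (ℓ := ℓ) (Polynomial.evalRingHom z)
    (fun e => Polynomial.C (p e)) Polynomial.X V μ
  simp only [Polynomial.coe_evalRingHom, Polynomial.eval_C, Polynomial.eval_X] at h1
  exact h1.symm.trans h

end Gamma

/-! ### The invariant γ_nz and singular components -/

section GammaNZ

namespace BipGraph

variable {R C : Type*} [DecidableEq R] [DecidableEq C]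

theorem gammaMin_lt_gammaMax_iff {H : BipGraph R C} {L : Finset (R × C)} :
    H.gammaMin L < H.gammaMax L ↔ ∃ M N, H.IsMaxMatching M ∧ H.IsMaxMatching N ∧
      (M ∩ L).card ≠ (N ∩ L).card := by
  set S := {k | ∃ M, H.IsMaxMatching M ∧ (M ∩ L).card = k} with hS
  have hbdd : BddAbove S := ⟨L.card, by
    rintro k ⟨M, -, rfl⟩
    exact Finset.card_le_card Finset.inter_subset_right⟩
  obtain ⟨M₀, hM₀⟩ := H.exists_isMaxMatching
  have hne : S.Nonempty := ⟨_, M₀, hM₀, rfl⟩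
  constructor
  · intro h
    obtain ⟨M, hM, hM'⟩ := Nat.sInf_mem hne
    obtain ⟨N, hN, hN'⟩ := Nat.sSup_mem hne hbdd
    refine ⟨M, N, hM, hN, ?_⟩
    rw [hM', hN']
    exact h.ne
  · rintro ⟨M, N, hM, hN, h⟩
    have hM1 : (M ∩ L).card ∈ S := ⟨M, hM, rfl⟩
    have hN1 : (N ∩ L).card ∈ S := ⟨N, hN, rfl⟩
    have e1 : H.gammaMin L = sInf S := rfl
    have e2 : H.gammaMax L = sSup S := rfl
    rw [e1, e2]
    have := Nat.sInf_le hM1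
    have := Nat.sInf_le hN1
    have := le_csSup hbdd hM1
    have := le_csSup hbdd hN1
    omega

end BipGraph

variable {R C : Type*} [DecidableEq R] [DecidableEq C] [Fintype R] {G : BipGraph R C} {μ : R → C}
  {D : BlockLabels R C}

/-- The maximum matchings of a square component, as permutations of its rows. -/
theorem MatchLabels.isMaxMatching_comp_iff (h : MatchLabels (fun r c => (r, c) ∈ G.edges) μ D)
    (hμ : Function.Injective μ) (hadj : ∀ r, (r, μ r) ∈ G.edges) {k : Fin (D.d + 2)}
    (hk : k ≠ 0) {N : Finset (R × C)} : (D.comp G k).IsMaxMatching N ↔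
      ∃ τ : Equiv.Perm (labelRows D k), (∀ r : labelRows D k, (r.1, μ (τ r)) ∈ G.edges) ∧
        N = Finset.univ.image (fun r : labelRows D k => (r.1, μ (τ r))) := by
  have hrows : ∀ r, r ∈ (D.comp G k).rows ↔ D.row r = k := fun r => by
    simp only [BlockLabels.comp, Finset.mem_filter, and_iff_right_iff_imp]
    exact fun _ => (G.edges_mem _ (hadj r)).1
  rw [BipGraph.isMaxMatching_iff_of_perfect hμ.injOn (fun r hr =>
    Finset.mem_filter.2 ⟨hadj r, (hrows r).1 hr, (h.col_eq r).trans ((hrows r).1 hr)⟩)]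
  constructor
  · rintro ⟨hN, hp⟩
    have hex : ∀ r : labelRows D k, ∃ s : labelRows D k, (r.1, μ s) ∈ N := by
      intro r
      obtain ⟨c, hc⟩ := hp r ((hrows r).2 (mem_labelRows.1 r.2))
      obtain ⟨h1, h2, h3⟩ := Finset.mem_filter.1 (hN.1 hc)
      obtain ⟨s, rfl⟩ := h.col_matched h1 (fun h0 => hk (h3.symm.trans h0))
      exact ⟨⟨s, mem_labelRows.2 ((h.col_eq s).symm.trans h3)⟩, hc⟩
    choose f hf using hex
    have hinj : Function.Injective f := fun r s hrs => by
      have := hN.2 _ (hf r) _ (hf s) (Or.inr (by rw [hrs]))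
      exact Subtype.ext (Prod.mk.inj this).1
    refine ⟨Equiv.ofBijective f (Finite.injective_iff_bijective.1 hinj),
      fun r => (Finset.mem_filter.1 (hN.1 (hf r))).1, ?_⟩
    ext ⟨r, c⟩
    simp only [Finset.mem_image, Finset.mem_univ, true_and, Equiv.ofBijective_apply]
    constructor
    · intro hrc
      have hrk := (Finset.mem_filter.1 (hN.1 hrc)).2.1
      refine ⟨⟨r, mem_labelRows.2 hrk⟩, ?_⟩
      exact hN.2 _ (hf ⟨r, mem_labelRows.2 hrk⟩) _ hrc (Or.inl rfl)
    · rintro ⟨x, hx⟩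
      exact hx ▸ hf x
  · rintro ⟨τ, hτ, rfl⟩
    refine ⟨⟨?_, ?_⟩, ?_⟩
    · intro e he
      obtain ⟨r, -, rfl⟩ := Finset.mem_image.1 he
      exact Finset.mem_filter.2 ⟨hτ r, mem_labelRows.1 r.2,
        (h.col_eq _).trans (mem_labelRows.1 (τ r).2)⟩
    · intro e he f hf
      obtain ⟨r, -, rfl⟩ := Finset.mem_image.1 he
      obtain ⟨s, -, rfl⟩ := Finset.mem_image.1 hf
      rintro (hrs | hrs)
      · rw [Subtype.ext hrs]
      · rw [τ.injective (Subtype.ext (hμ hrs))]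
    · intro r hr
      exact ⟨_, Finset.mem_image.2 ⟨⟨r, mem_labelRows.2 ((hrows r).1 hr)⟩, Finset.mem_univ _, rfl⟩⟩

variable {n m : ℕ}

theorem card_inter_lambdaEdges {V : Finset (Fin n)} {ν : V → Fin n ⊕ Fin m} :
    (Finset.univ.image (fun r : V => (r.1, ν r)) ∩ lambdaEdges n m).card =
      (Finset.univ.filter (fun r : V => ν r = Sum.inl r.1)).card := by
  rw [← Finset.card_image_of_injective (Finset.univ.filter (fun r : V => ν r = Sum.inl r.1))
    (f := fun r : V => (r.1, ν r)) (fun r s h => Subtype.ext (Prod.mk.inj h).1)]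
  congr 1
  ext e
  simp only [Finset.mem_inter, Finset.mem_image, Finset.mem_univ, true_and, lambdaEdges,
    Finset.mem_filter]
  constructor
  · rintro ⟨⟨r, rfl⟩, h⟩
    exact ⟨r, h, rfl⟩
  · rintro ⟨r, h, rfl⟩
    exact ⟨⟨r, rfl⟩, h⟩

theorem mem_pencilGraph_edges {M : Matrix (Fin n) (Fin n ⊕ Fin m) Entry} {r : Fin n}
    {c : Fin n ⊕ Fin m} :
    (r, c) ∈ (pencilGraph M).edges ↔ M r c ≠ Entry.zero ∨ c = Sum.inl r := by
  simp only [pencilGraph, lambdaEdges, bipGraphOf, Finset.mem_union, Finset.mem_filter,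
    Finset.mem_univ, true_and, or_comm]

/-- `(i, j)` is the only `×` entry of `M`. -/
def UniqueCross (M : Matrix (Fin n) (Fin n ⊕ Fin m) Entry) (i : Fin n) (j : Fin n ⊕ Fin m) :
    Prop :=
  ∀ k l, M k l = Entry.cross ↔ k = i ∧ l = j

variable {M : Matrix (Fin n) (Fin n ⊕ Fin m) Entry} {i : Fin n} {j : Fin n ⊕ Fin m}

theorem starPart_eq_star {ι κ : Type*} {M : Matrix ι κ Entry} {r : ι} {c : κ} :
    starPart M r c = Entry.star ↔ M r c = Entry.star := by
  unfold starPart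
  split_ifs with h <;> simp [h]

theorem UniqueCross.ne_zero_iff (hM : UniqueCross M i j) {r : Fin n} {c : Fin n ⊕ Fin m} :
    M r c ≠ Entry.zero ↔ starPart M r c = Entry.star ∨ (r = i ∧ c = j) := by
  rw [starPart_eq_star, ← hM r c]
  cases M r c <;> simp

/-- Deleting column `j` removes the only `×` entry, so just parameters and `λ`-edges remain. -/
theorem UniqueCross.mem_pencilGraphDel (hM : UniqueCross M i j) {z : ℂ} (hz : z ≠ 0) {r : Fin n}
    {c : Fin n ⊕ Fin m} : (r, c) ∈ (pencilGraphDel M j).edges ↔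
      PencilAdj (starPart M) Sum.inl z j r c := by
  unfold pencilGraphDel BipGraph.delCol
  simp only [Finset.mem_filter, mem_pencilGraph_edges, hM.ne_zero_iff, PencilAdj, PencilEdge]
  grind

/-- Matchings with different numbers of `λ`-edges, or a self-loop, produce two different powers of
`z` in the determinant of the component and hence a nonzero root. Otherwise the determinant is a
monomial in `z`, with a coefficient that is nonzero for generic parameters. -/
theorem UniqueCross.gammaNZ_iff (hM : UniqueCross M i j) {p : StarPos (starPart M) → ℂ}
    (hp : AlgebraicIndependent ℚ p) {D : BlockLabels (Fin n) (Fin n ⊕ Fin m)}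
    (hD : D.IsDMDecomposition (pencilGraphDel M j)) {μ : Fin n → Fin n ⊕ Fin m}
    (hμ : Function.Injective μ) (hadj : ∀ r, (r, μ r) ∈ (pencilGraphDel M j).edges)
    {k : Fin (D.d + 2)} (hk : D.IsSquare k) :
    GammaNZ M (D.comp (pencilGraphDel M j) k) ↔ ∃ z : ℂ, z ≠ 0 ∧
      (matchedMinor (genPencil (starPart M) Sum.inl p z) (labelRows D k) μ).det = 0 := by
  classical
  have hL := hD.matchLabels hμ hadj
  have hedge : ∀ {r c}, (r, c) ∈ (pencilGraphDel M j).edges ↔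
      (starPart M r c = Entry.star ∨ c = Sum.inl r) ∧ c ≠ j := by
    intro r c
    rw [hM.mem_pencilGraphDel one_ne_zero]
    simp [PencilAdj, PencilEdge]
  have hcompl : ∀ τ : Equiv.Perm (labelRows D k),
      (Finset.univ.filter (fun r : labelRows D k => μ (τ r) ≠ Sum.inl r.1))ᶜ =
        Finset.univ.filter (fun r : labelRows D k => μ (τ r) = Sum.inl r.1) := by
    intro τ
    ext r
    simp
  have hstar : ∀ τ : Equiv.Perm (labelRows D k),
      (∀ r : labelRows D k, (r.1, μ (τ r)) ∈ (pencilGraphDel M j).edges) → ∀ r,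
      μ (τ r) ≠ Sum.inl r.1 → starPart M r (μ (τ r)) = Entry.star := fun τ hτ r hr =>
    (hedge.1 (hτ r)).1.resolve_right hr
  constructor
  · rintro (h | ⟨⟨r₀, c₀⟩, he, h1, h2⟩)
    · obtain ⟨N, N', hN, hN', hne⟩ := BipGraph.gammaMin_lt_gammaMax_iff.1 h
      obtain ⟨τ, hτ, rfl⟩ := (hL.isMaxMatching_comp_iff hμ hadj hk.1).1 hN
      obtain ⟨τ', hτ', rfl⟩ := (hL.isMaxMatching_comp_iff hμ hadj hk.1).1 hN'
      rw [card_inter_lambdaEdges, card_inter_lambdaEdges] at hne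
      refine exists_root_det_matchedMinor hμ hp (τ := τ) (τ' := τ')
        (Q := Finset.univ.filter (fun r => μ (τ r) ≠ Sum.inl r.1))
        (Q' := Finset.univ.filter (fun r => μ (τ' r) ≠ Sum.inl r.1)) ?_ ?_ ?_ ?_ ?_
      · exact fun r hr => hstar τ hτ r (Finset.mem_filter.1 hr).2
      · exact fun r hr => by simpa using hr
      · exact fun r hr => hstar τ' hτ' r (Finset.mem_filter.1 hr).2
      · exact fun r hr => by simpa using hr
      · rw [hcompl, hcompl]
        exact hne
    · obtain ⟨N, hN, heN⟩ := hD.admissible k _ he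
      obtain ⟨τ, hτ, rfl⟩ := (hL.isMaxMatching_comp_iff hμ hadj hk.1).1 hN
      obtain ⟨r₁, -, hr₁⟩ := Finset.mem_image.1 heN
      obtain ⟨hr0, hc0⟩ := Prod.mk.inj hr₁
      have hc : c₀ = Sum.inl r₀ := (Finset.mem_filter.1 h1).2
      have hcj : c₀ ≠ j := (hedge.1 (Finset.mem_filter.1 he).1).2
      have hst : starPart M r₁ (μ (τ r₁)) = Entry.star := by
        rw [hr0, hc0]
        have h3 : M r₀ c₀ ≠ Entry.zero := (Finset.mem_filter.1 h2).2
        exact (hM.ne_zero_iff.1 h3).resolve_right (fun h => hcj h.2)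
      have hloop : μ (τ r₁) = Sum.inl r₁.1 := by rw [hc0, hr0, hc]
      -- One matching through the self-loop suffices: its diagonal entry is a parameter minus `z`,
      -- and each of the two terms gives its own power of `z`.
      refine exists_root_det_matchedMinor hμ hp (τ := τ) (τ' := τ)
        (Q := Finset.univ.filter (fun r => μ (τ r) ≠ Sum.inl r.1))
        (Q' := insert r₁ (Finset.univ.filter (fun r => μ (τ r) ≠ Sum.inl r.1))) ?_ ?_ ?_ ?_ ?_
      · exact fun r hr => hstar τ hτ r (Finset.mem_filter.1 hr).2
      · exact fun r hr => by simpa using hr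
      · intro r hr
        rcases Finset.mem_insert.1 hr with rfl | hr
        · exact hst
        · exact hstar τ hτ r (Finset.mem_filter.1 hr).2
      · intro r hr
        have := fun h => hr (Finset.mem_insert_of_mem h)
        simpa using this
      · have hmem : r₁ ∉ Finset.univ.filter
            (fun r : labelRows D k => μ (τ r) ≠ Sum.inl r.1) := by simpa using hloop
        have h3 := Finset.card_insert_of_notMem hmem
        rw [Finset.card_compl, Finset.card_compl, h3]
        have h4 := Finset.card_le_univ (insert r₁ (Finset.univ.filter
            (fun r : labelRows D k => μ (τ r) ≠ Sum.inl r.1)))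
        omega
  · rintro ⟨z, hz, hdet⟩
    by_contra hno
    unfold GammaNZ at hno
    push Not at hno
    obtain ⟨h1, h2⟩ := hno
    have hpe : ∀ r, PencilEdge (starPart M) Sum.inl (1 : ℂ) r (μ r) := fun r =>
      ((hM.mem_pencilGraphDel one_ne_zero).1 (hadj r)).1
    -- The coefficient of the monomial is the value at `z = 1`, and 1 is algebraic.
    have h3 := det_matchedMinor_ne_zero_of_isAlgebraic hp isAlgebraic_one
      (hμ.injOn (s := labelRows D k)) (fun r _ => hpe r)
    refine mul_ne_zero (pow_ne_zero (Finset.univ.filter (fun r : labelRows D k =>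
      μ r = Sum.inl r.1)).card hz) h3 ?_
    rw [← hdet]
    refine (det_matchedMinor_eq_pow_mul hz ?_ ?_).symm
    · intro r hr v hv hvr hst
      have hvj : μ v ≠ j := (hedge.1 (hadj v)).2
      refine h2 (r, μ v) (Finset.mem_filter.2 ⟨hedge.2 ⟨Or.inl hst, hvj⟩, mem_labelRows.1 hr,
        (hL.col_eq v).trans (mem_labelRows.1 hv)⟩) (Finset.mem_filter.2 ⟨Finset.mem_univ _, hvr⟩)
        (Finset.mem_filter.2 ⟨Finset.mem_univ _, hM.ne_zero_iff.2 (Or.inl hst)⟩)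
    · intro τ hτ
      by_contra hne
      apply h1.not_gt
      refine BipGraph.gammaMin_lt_gammaMax_iff.2 ⟨_, _,
        (hL.isMaxMatching_comp_iff hμ hadj hk.1).2 ⟨τ, fun r =>
          (hM.mem_pencilGraphDel hz).2 ⟨hτ r, (hedge.1 (hadj _)).2⟩, rfl⟩,
        (hL.isMaxMatching_comp_iff hμ hadj hk.1).2 ⟨1, fun r => hadj r, rfl⟩, ?_⟩
      rw [card_inter_lambdaEdges, card_inter_lambdaEdges]
      exact hne

end GammaNZ

/-! ### Controllability -/

section Control

variable {n m : ℕ}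

theorem isControllable_iff_vecMul_ctrbMatrix (A : Matrix (Fin n) (Fin n) ℂ)
    (B : Matrix (Fin n) (Fin m) ℂ) :
    IsControllable A B ↔ ∀ q, Matrix.vecMul q (ctrbMatrix A B) = 0 → q = 0 := by
  have h1 : (∀ q, Matrix.vecMul q (ctrbMatrix A B) = 0 → q = 0) ↔
      LinearIndependent ℂ (ctrbMatrix A B).row := by
    rw [← Matrix.vecMul_injective_iff]
    exact (injective_iff_map_eq_zero (Matrix.vecMulLinear (ctrbMatrix A B))).symm
  rw [h1, IsControllable, linearIndependent_iff_card_eq_finrank_span, Fintype.card_fin,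
    Matrix.rank_eq_finrank_span_row, eq_comm]
  rfl

theorem vecMul_ctrbMatrix_eq_zero_iff (A : Matrix (Fin n) (Fin n) ℂ)
    (B : Matrix (Fin n) (Fin m) ℂ) (q : Fin n → ℂ) :
    Matrix.vecMul q (ctrbMatrix A B) = 0 ↔ ∀ k < n, Matrix.vecMul q (A ^ k * B) = 0 := by
  constructor
  · intro h k hk
    ext l
    exact congrFun h (⟨k, hk⟩, l)
  · intro h
    ext ⟨k, l⟩
    exact congrFun (h k k.2) l

/-- If `q A^k B` vanishes for `k < n`, it vanishes for all `k`. -/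
theorem vecMul_pow_mul_eq_zero {A : Matrix (Fin n) (Fin n) ℂ} {B : Matrix (Fin n) (Fin m) ℂ}
    {q : Fin n → ℂ} (h : ∀ k < n, Matrix.vecMul q (A ^ k * B) = 0) (k : ℕ) :
    Matrix.vecMul q (A ^ k * B) = 0 := by
  -- For `n = 0` the characteristic polynomial is 1, and no remainder has degree below 0.
  rcases Nat.eq_zero_or_pos n with rfl | hn
  · have : q = 0 := Subsingleton.elim _ _
    rw [this, Matrix.zero_vecMul]
  have hdeg : (Polynomial.X ^ k %ₘ A.charpoly).natDegree < n := by
    have := Polynomial.natDegree_modByMonic_lt (Polynomial.X ^ k : Polynomial ℂ)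
      A.charpoly_monic (by
        intro h1
        have := A.charpoly_natDegree_eq_dim
        rw [h1, Polynomial.natDegree_one, Fintype.card_fin] at this
        omega)
    rwa [A.charpoly_natDegree_eq_dim, Fintype.card_fin] at this
  rw [A.pow_eq_aeval_mod_charpoly k, Polynomial.aeval_eq_sum_range' hdeg, Matrix.sum_mul,
    Matrix.vecMul_sum]
  refine Finset.sum_eq_zero fun l hl => ?_
  rw [Matrix.smul_mul, Matrix.vecMul_smul, h l (Finset.mem_range.1 hl), smul_zero]

/-- The Popov–Belevitch–Hautus criterion. -/
theorem isControllable_iff_eigenvector (A : Matrix (Fin n) (Fin n) ℂ)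
    (B : Matrix (Fin n) (Fin m) ℂ) :
    IsControllable A B ↔
      ∀ (z : ℂ) (q : Fin n → ℂ), Matrix.vecMul q A = z • q → Matrix.vecMul q B = 0 → q = 0 := by
  rw [isControllable_iff_vecMul_ctrbMatrix]
  constructor
  · intro h z q hA hB
    refine h q ((vecMul_ctrbMatrix_eq_zero_iff A B q).2 fun k _ => ?_)
    have hpow : ∀ k, Matrix.vecMul q (A ^ k) = z ^ k • q := by
      intro k
      induction k with
      | zero => simp
      | succ k ih =>
        rw [pow_succ, ← Matrix.vecMul_vecMul, ih, Matrix.smul_vecMul, hA, smul_smul, pow_succ]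
    rw [← Matrix.vecMul_vecMul, hpow, Matrix.smul_vecMul, hB, smul_zero]
  · intro h q hq
    by_contra hq0
    -- The row vectors annihilating every A^k B form a subspace invariant under A. If it is nonzero,
    -- it contains an eigenvector.
    let V : Submodule ℂ (Fin n → ℂ) :=
      ⨅ k : ℕ, LinearMap.ker (Matrix.vecMulLinear (A ^ k * B))
    have hV : ∀ v, v ∈ V ↔ ∀ k : ℕ, Matrix.vecMul v (A ^ k * B) = 0 := fun v => by
      simp [V, Submodule.mem_iInf]
    have hqV : q ∈ V :=
      (hV q).2 (vecMul_pow_mul_eq_zero ((vecMul_ctrbMatrix_eq_zero_iff A B q).1 hq))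
    have hinv : ∀ v ∈ V, Matrix.vecMulLinear A v ∈ V := by
      intro v hv
      refine (hV _).2 fun k => ?_
      rw [Matrix.vecMulLinear_apply, Matrix.vecMul_vecMul, ← Matrix.mul_assoc, ← pow_succ']
      exact (hV v).1 hv (k + 1)
    have : Nontrivial V := ⟨⟨⟨q, hqV⟩, 0, fun he => hq0 (congrArg Subtype.val he)⟩⟩
    obtain ⟨z, hz⟩ := Module.End.exists_eigenvalue ((Matrix.vecMulLinear A).restrict hinv)
    obtain ⟨v, hv⟩ := hz.exists_hasEigenvector
    refine hv.2 (Subtype.ext (h z v ?_ ?_))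
    · exact congrArg Subtype.val hv.apply_eq_smul
    · simpa using (hV v).1 v.2 0

open scoped ComplexOrder in
/-- Controllability of a pair depending polynomially on parameters is generic as soon as it holds
at one point. -/
theorem ae_isControllable {ι : Type} [Fintype ι]
    (T : Matrix (Fin n) (Fin n ⊕ Fin m) (MvPolynomial ι ℂ)) (p₀ : ι → ℂ)
    (h : IsControllable (T.map (MvPolynomial.eval p₀)).toCols₁
      (T.map (MvPolynomial.eval p₀)).toCols₂) :
    ∀ᵐ p : ι → ℂ ∂volume, IsControllable (T.map (MvPolynomial.eval p)).toCols₁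
      (T.map (MvPolynomial.eval p)).toCols₂ := by
  let Q₀ := ctrbMatrix (T.map (MvPolynomial.eval p₀)).toCols₁ (T.map (MvPolynomial.eval p₀)).toCols₂
  let Q : Matrix (Fin n) (Fin n × Fin m) (MvPolynomial ι ℂ) :=
    fun r kl => (T.toCols₁ ^ (kl.1 : ℕ) * T.toCols₂) r kl.2
  have hQ : ∀ p, Q.map (MvPolynomial.eval p) =
      ctrbMatrix (T.map (MvPolynomial.eval p)).toCols₁ (T.map (MvPolynomial.eval p)).toCols₂ := by
    intro p
    ext r kl
    have h1 : (T.map (MvPolynomial.eval p)).toCols₁ = T.toCols₁.map (MvPolynomial.eval p) := rfl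
    have h2 : (T.map (MvPolynomial.eval p)).toCols₂ = T.toCols₂.map (MvPolynomial.eval p) := rfl
    rw [ctrbMatrix, h1, h2, ← Matrix.map_pow, ← Matrix.map_mul]
    rfl
  -- Multiplication by the fixed conjugate transpose of the controllability matrix at `p₀` replaces
  -- the choice of a maximal minor: at `p₀` the determinant is a Gram determinant, hence nonzero.
  let Q' : Matrix (Fin n × Fin m) (Fin n) (MvPolynomial ι ℂ) := Q₀.conjTranspose.map MvPolynomial.C
  let F : Matrix (Fin n) (Fin n) (MvPolynomial ι ℂ) := Q * Q'
  let f : MvPolynomial ι ℂ := F.det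
  have hf : ∀ p, MvPolynomial.eval p f =
      (Q.map (MvPolynomial.eval p) * Q₀.conjTranspose).det := by
    intro p
    rw [show f = F.det from rfl, RingHom.map_det, RingHom.mapMatrix_apply,
      show F = Q * Q' from rfl, Matrix.map_mul]
    congr 2
    ext a b
    simp [Q']
  have hf0 : f ≠ 0 := by
    intro h0
    have := hf p₀
    rw [h0, map_zero, hQ] at this
    obtain ⟨q, hq0, hq⟩ := Matrix.exists_vecMul_eq_zero_iff.2 this.symm
    rw [Matrix.vecMul_self_mul_conjTranspose_eq_zero] at hq
    exact hq0 ((isControllable_iff_vecMul_ctrbMatrix _ _).1 h q hq)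
  filter_upwards [MvPolynomial.ae_eval_ne_zero f hf0] with p hp
  rw [isControllable_iff_vecMul_ctrbMatrix, ← hQ]
  intro q hq
  by_contra hq0
  refine hp ?_
  rw [hf]
  refine Matrix.exists_vecMul_eq_zero_iff.1 ⟨q, hq0, ?_⟩
  rw [← Matrix.vecMul_vecMul, hq, Matrix.zero_vecMul]

end Control

/-! ### Hall's theorem and linear dependence -/

section NullVectors

/-- Either the rows in `S` can be matched into the columns, or they are linearly dependent. -/
theorem exists_injOn_or_exists_sum_eq_zero {R C : Type*} [Fintype R] [Fintype C] [Nonempty C]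
    (adj : R → C → Prop) (N : Matrix R C ℂ) (hN : ∀ r c, N r c ≠ 0 → adj r c) (S : Finset R) :
    (∃ ν : R → C, Set.InjOn ν S ∧ ∀ r ∈ S, adj r (ν r)) ∨
      ∃ q : R → ℂ, q ≠ 0 ∧ (∀ r ∉ S, q r = 0) ∧ ∀ c, ∑ r, q r * N r c = 0 := by
  classical
  let t : S → Finset C := fun s => Finset.univ.filter (fun c => adj s c)
  by_cases hall : ∀ s : Finset S, s.card ≤ (s.biUnion t).card
  · obtain ⟨f, hf, hft⟩ := (Finset.all_card_le_biUnion_card_iff_exists_injective t).1 hall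
    left
    refine ⟨fun r => if h : r ∈ S then f ⟨r, h⟩ else Classical.arbitrary C, ?_, ?_⟩
    · intro r hr s hs hrs
      have hr' : r ∈ S := hr
      have hs' : s ∈ S := hs
      simp only [dif_pos hr', dif_pos hs'] at hrs
      exact congrArg Subtype.val (hf hrs)
    · intro r hr
      simp only [dif_pos hr]
      exact (Finset.mem_filter.1 (hft ⟨r, hr⟩)).2
  · right
    push Not at hall
    obtain ⟨s, hs⟩ := hall
    -- The rows of a Hall violator live in fewer columns than there are rows, so they are dependent.
    let g : (s → ℂ) →ₗ[ℂ] (s.biUnion t → ℂ) :=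
      Matrix.vecMulLinear (Matrix.of fun (r : s) (c : s.biUnion t) => N r.1.1 c.1)
    obtain ⟨x, hx, hx0⟩ := (Submodule.ne_bot_iff _).1
      (LinearMap.ker_ne_bot_of_finrank_lt (f := g) (by
        rw [Module.finrank_fintype_fun_eq_card, Module.finrank_fintype_fun_eq_card,
          Fintype.card_coe, Fintype.card_coe]
        exact hs))
    let q : R → ℂ := fun r => if h : ∃ hr : r ∈ S, (⟨r, hr⟩ : S) ∈ s then x ⟨⟨r, h.1⟩, h.2⟩ else 0
    have hq : ∀ (r : R) (hr : r ∈ S) (hrs : ⟨r, hr⟩ ∈ s), q r = x ⟨⟨r, hr⟩, hrs⟩ :=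
      fun r hr hrs => dif_pos ⟨hr, hrs⟩
    refine ⟨q, fun h0 => hx0 (funext fun r => ?_), fun r hr => dif_neg (fun h => hr h.1),
      fun c => ?_⟩
    · rw [← hq r.1.1 r.1.2 r.2, h0]
      rfl
    · by_cases hc : c ∈ s.biUnion t
      · have h1 := congrFun (LinearMap.mem_ker.1 hx) ⟨c, hc⟩
        have h2 : ∑ r : s, x r * N r.1.1 c = 0 := h1
        rw [← h2]
        symm
        refine Finset.sum_of_injOn (fun r : s => r.1.1) ?_ (by simp) ?_ ?_
        · intro a _ b _ hab
          exact Subtype.ext (Subtype.ext hab)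
        · intro r _ hr
          have : q r = 0 := dif_neg fun h => hr ⟨(⟨(⟨r, h.1⟩ : S), h.2⟩ : ↥s), by simp, rfl⟩
          rw [this, zero_mul]
        · intro r _
          rw [hq r.1.1 r.1.2 r.2]
      · refine Finset.sum_eq_zero fun r _ => ?_
        by_cases hr : ∃ hr : r ∈ S, (⟨r, hr⟩ : S) ∈ s
        · by_cases h0 : N r c = 0
          · rw [h0, mul_zero]
          · exact absurd (Finset.mem_biUnion.2 ⟨(⟨r, hr.1⟩ : S), hr.2,
              Finset.mem_filter.2 ⟨Finset.mem_univ _, hN r c h0⟩⟩) hc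
        · have : q r = 0 := dif_neg hr
          rw [this, zero_mul]

/-- Either the rows in `S` can be matched into the columns other than `j`, or they become linearly
dependent when the column `j` is removed. -/
theorem avoidable_or_exists_isNullVector {R C : Type*} [Fintype R] [Fintype C] [DecidableEq R]
    (adj : R → C → Prop) (N : Matrix R C ℂ) (j : C) (hN : ∀ r c, c ≠ j → N r c ≠ 0 → adj r c)
    (S : Finset R) :
    Avoidable adj S j ∨ ∃ q : R → ℂ, q ≠ 0 ∧ (∀ r ∉ S, q r = 0) ∧ IsNullVector N j q := by
  classical
  have : Nonempty C := ⟨j⟩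
  rcases exists_injOn_or_exists_sum_eq_zero (fun r c => adj r c ∧ c ≠ j)
    (fun r c => if c = j then 0 else N r c) (fun r c h => by
      split_ifs at h with hc
      · exact absurd rfl h
      · exact ⟨hN r c hc h, hc⟩) S with h | ⟨q, h1, h2, h3⟩
  · exact Or.inl h
  · exact Or.inr ⟨q, h1, h2, fun c hc => by simpa [hc] using h3 c⟩

end NullVectors

/-! ### Controllability as a function of the single `×` value -/

section SingleCross

variable {n m : ℕ} {M : Matrix (Fin n) (Fin n ⊕ Fin m) Entry} {i : Fin n} {j : Fin n ⊕ Fin m}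

/-- The pair with the value `x` at the position `(i, j)` and the values `p` at the `*` entries is
controllable. -/
def ControllableAt (M : Matrix (Fin n) (Fin n ⊕ Fin m) Entry) (i : Fin n) (j : Fin n ⊕ Fin m)
    (p : StarPos (starPart M) → ℂ) (x : ℂ) : Prop :=
  IsControllable (ofParams (starPart M) p + Matrix.single i j x).toCols₁
    (ofParams (starPart M) p + Matrix.single i j x).toCols₂

theorem sum_mul_single (q : Fin n → ℂ) (x : ℂ) (c : Fin n ⊕ Fin m) :
    ∑ r, q r * Matrix.single i j x r c = if c = j then x * q i else 0 := by
  split_ifs with hc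
  · subst hc
    rw [Finset.sum_eq_single i]
    · simp [mul_comm]
    · intro r _ hr
      rw [Matrix.single_apply_of_row_ne (Ne.symm hr), mul_zero]
    · simp
  · refine Finset.sum_eq_zero fun r _ => ?_
    rw [Matrix.single_apply_of_col_ne _ _ (Ne.symm hc), mul_zero]

theorem sum_mul_genPencil (W : Matrix (Fin n) (Fin n ⊕ Fin m) Entry) (p : StarPos W → ℂ)
    (q : Fin n → ℂ) (z : ℂ) (c : Fin n ⊕ Fin m) :
    ∑ r, q r * genPencil W Sum.inl p z r c =
      ∑ r, q r * ofParams W p r c - c.elim (fun s => z * q s) (fun _ => 0) := by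
  simp only [genPencil, ofParams, mul_sub, Finset.sum_sub_distrib]
  congr 1
  rcases c with s | s <;> simp [mul_comm]

/-- The eigenvector criterion, split so that `x` appears only in the equation of column `j`. -/
theorem controllableAt_iff (p : StarPos (starPart M) → ℂ) (x : ℂ) :
    ControllableAt M i j p x ↔ ∀ z q, IsNullVector (genPencil (starPart M) Sum.inl p z) j q →
      ∑ r, q r * genPencil (starPart M) Sum.inl p z r j + x * q i = 0 → q = 0 := by
  rw [ControllableAt, isControllable_iff_eigenvector]
  refine forall₂_congr fun z q => ?_
  rw [← and_imp, ← and_imp]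
  refine imp_congr_left ?_
  have key : ∀ c, ∑ r, q r * genPencil (starPart M) Sum.inl p z r c +
      (if c = j then x * q i else 0) = 
      ∑ r, q r * (ofParams (starPart M) p + Matrix.single i j x) r c -
        c.elim (fun s => z * q s) (fun _ => 0) := by
    intro c
    rw [sum_mul_genPencil, ← sum_mul_single]
    simp only [Matrix.add_apply, mul_add, Finset.sum_add_distrib]
    ring
  have h1 : (IsNullVector (genPencil (starPart M) Sum.inl p z) j q ∧
      ∑ r, q r * genPencil (starPart M) Sum.inl p z r j + x * q i = 0) ↔
      ∀ c, ∑ r, q r * (ofParams (starPart M) p + Matrix.single i j x) r c -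
        c.elim (fun s => z * q s) (fun _ => 0) = 0 := by
    simp only [← key]
    constructor
    · rintro ⟨h1, h2⟩ c
      split_ifs with hc
      · rw [hc, h2]
      · rw [h1 c hc, add_zero]
    · intro h
      exact ⟨fun c hc => by simpa [hc] using h c, by simpa using h j⟩
  rw [h1, Sum.forall]
  simp only [Sum.elim_inl, Sum.elim_inr, sub_zero, sub_eq_zero]
  rw [funext_iff, funext_iff]
  rfl

theorem UniqueCross.mem_realizations_crossPart (hM : UniqueCross M i j)
    {X : Matrix (Fin n) (Fin n ⊕ Fin m) ℂ} :
    X ∈ realizations (crossPart M) ↔ ∃ x, x ≠ 0 ∧ X = Matrix.single i j x := by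
  have h1 : ∀ r c, crossPart M r c = Entry.cross ↔ r = i ∧ c = j := fun r c => by
    rw [← hM r c]
    unfold crossPart
    split_ifs with h <;> simp [h]
  have h2 : ∀ r c, crossPart M r c = Entry.zero ↔ ¬ (r = i ∧ c = j) := fun r c => by
    rw [← hM r c]
    unfold crossPart
    split_ifs with h <;> simp [h]
  constructor
  · intro hX
    refine ⟨X i j, (hX i j).1 ((h1 i j).2 ⟨rfl, rfl⟩), ?_⟩
    ext r c
    rw [Matrix.single_apply]
    split_ifs with h
    · rw [h.1, h.2]
    · exact (hX r c).2 ((h2 r c).2 fun h' => h ⟨h'.1.symm, h'.2.symm⟩)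
  · rintro ⟨x, hx, rfl⟩ r c
    constructor
    · intro h
      obtain ⟨rfl, rfl⟩ := (h1 r c).1 h
      simpa using hx
    · intro h
      rw [Matrix.single_apply, if_neg]
      exact fun h' => (h2 r c).1 h ⟨h'.1.symm, h'.2.symm⟩

theorem UniqueCross.isPSSC_iff {A : Matrix (Fin n) (Fin n) Entry}
    {B : Matrix (Fin n) (Fin m) Entry} (hM : UniqueCross (Matrix.fromCols A B) i j) :
    IsPSSC A B ↔ ∀ᵐ p : StarPos (starPart (Matrix.fromCols A B)) → ℂ ∂volume,
      ∀ x, x ≠ 0 → ControllableAt (Matrix.fromCols A B) i j p x := by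
  refine Filter.eventually_congr (Filter.Eventually.of_forall fun p => ?_)
  simp only [hM.mem_realizations_crossPart, forall_exists_index, and_imp]
  constructor
  · intro h x hx
    exact h _ x hx rfl
  · rintro h _ x hx rfl
    exact h x hx

theorem UniqueCross.ofParams_add_single_eq_zero (hM : UniqueCross M i j)
    (p : StarPos (starPart M) → ℂ) (x : ℂ) {r : Fin n} {c : Fin n ⊕ Fin m}
    (h0 : M r c = Entry.zero) : (ofParams (starPart M) p + Matrix.single i j x) r c = 0 := by
  have h1 : starPart M r c ≠ Entry.star := fun hs => (hM.ne_zero_iff.2 (Or.inl hs)) h0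
  have h2 : ¬ (i = r ∧ j = c) := fun hs =>
    (hM.ne_zero_iff.2 (Or.inr ⟨hs.1.symm, hs.2.symm⟩)) h0
  rw [Matrix.add_apply, Matrix.single_apply, if_neg h2, add_zero, ofParams, dif_neg h1]

theorem ControllableAt.isStructurallyControllable {A : Matrix (Fin n) (Fin n) Entry}
    {B : Matrix (Fin n) (Fin m) Entry} (hM : UniqueCross (Matrix.fromCols A B) i j)
    {p : StarPos (starPart (Matrix.fromCols A B)) → ℂ} {x : ℂ}
    (h : ControllableAt (Matrix.fromCols A B) i j p x) : IsStructurallyControllable A B := by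
  refine ⟨_, _, ?_, h⟩
  rw [Matrix.fromCols_toCols]
  intro r c
  constructor
  · intro hrc
    unfold allStar at hrc
    split_ifs at hrc
  · intro hrc
    have h0 : Matrix.fromCols A B r c = Entry.zero := by
      unfold allStar at hrc
      split_ifs at hrc
      assumption
    exact hM.ofParams_add_single_eq_zero p x h0

/-- The `×` entry is frozen at its value in a controllable realization and only the `*` entries
vary. This value may be zero. -/
theorem IsStructurallyControllable.ae_controllableAt {A : Matrix (Fin n) (Fin n) Entry}
    {B : Matrix (Fin n) (Fin m) Entry} (hM : UniqueCross (Matrix.fromCols A B) i j)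
    (h : IsStructurallyControllable A B) :
    ∀ᵐ p : StarPos (starPart (Matrix.fromCols A B)) → ℂ ∂volume,
      ∃ x, ControllableAt (Matrix.fromCols A B) i j p x := by
  obtain ⟨A', B', hr, hc⟩ := h
  set N := Matrix.fromCols A' B' with hN
  set W := starPart (Matrix.fromCols A B) with hW
  let T : Matrix (Fin n) (Fin n ⊕ Fin m) (MvPolynomial (StarPos W) ℂ) :=
    fun r c => (if h : W r c = Entry.star then MvPolynomial.X ⟨(r, c), h⟩ else 0) +
      MvPolynomial.C (Matrix.single i j (N i j) r c)
  have hT : ∀ p : StarPos W → ℂ, T.map (MvPolynomial.eval p) =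
      ofParams W p + Matrix.single i j (N i j) := by
    intro p
    ext r c
    exact (map_add (MvPolynomial.eval p) _ _).trans (congrArg₂ (· + ·)
      ((apply_dite (MvPolynomial.eval p) _ _ _).trans
        (by simp only [MvPolynomial.eval_X, map_zero]; rfl)) (MvPolynomial.eval_C _))
  have h0 : ofParams W (fun e => N e.1.1 e.1.2) + Matrix.single i j (N i j) = N := by
    ext r c
    rw [Matrix.add_apply, Matrix.single_apply, ofParams]
    by_cases hrc : Matrix.fromCols A B r c = Entry.zero
    · have h1 : W r c ≠ Entry.star := fun hs => (hM.ne_zero_iff.2 (Or.inl hs)) hrc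
      have h2 : ¬ (i = r ∧ j = c) := fun hs =>
        (hM.ne_zero_iff.2 (Or.inr ⟨hs.1.symm, hs.2.symm⟩)) hrc
      rw [dif_neg h1, if_neg h2, add_zero]
      exact ((hr r c).2 (by rw [allStar, if_pos hrc])).symm
    · by_cases h2 : i = r ∧ j = c
      · obtain ⟨rfl, rfl⟩ := h2
        have h1 : W i j ≠ Entry.star := fun hs => by
          rw [hW, starPart_eq_star, (hM i j).2 ⟨rfl, rfl⟩] at hs
          exact absurd hs (by decide)
        rw [dif_neg h1]
        simp
      · have h1 : W r c = Entry.star :=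
          (hM.ne_zero_iff.1 hrc).resolve_right fun h' => h2 ⟨h'.1.symm, h'.2.symm⟩
        rw [dif_pos h1, if_neg h2, add_zero]
  have := ae_isControllable T (fun e => N e.1.1 e.1.2) (by
    rw [hT, h0, hN, Matrix.toCols₁_fromCols, Matrix.toCols₂_fromCols]
    exact hc)
  simp only [hT] at this
  filter_upwards [this] with p hp
  exact ⟨N i j, hp⟩

/-- Where the pair is controllable for some value of the `×` entry, left null vectors are unique up
to scalars. -/
theorem ControllableAt.exists_eq_smul {p : StarPos (starPart M) → ℂ} {x : ℂ}
    (h : ControllableAt M i j p x) {z : ℂ} {q q' : Fin n → ℂ} (hq0 : q ≠ 0)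
    (hq : IsNullVector (genPencil (starPart M) Sum.inl p z) j q)
    (hq' : IsNullVector (genPencil (starPart M) Sum.inl p z) j q') : ∃ a : ℂ, q' = a • q := by
  rw [controllableAt_iff] at h
  let φ : (Fin n → ℂ) → ℂ := fun q =>
    ∑ r, q r * genPencil (starPart M) Sum.inl p z r j + x * q i
  -- Controllability makes the linear functional `φ` injective on the null vectors, so their space
  -- has dimension at most one.
  have hφ : φ q ≠ 0 := fun h0 => hq0 (h z q hq h0)
  have hlin : ∀ (a : ℂ) (c : Fin n ⊕ Fin m) (b : Fin n → ℂ),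
      ∑ r, (q' - a • q) r * b r = ∑ r, q' r * b r - a * ∑ r, q r * b r := by
    intro a c b
    simp only [Pi.sub_apply, Pi.smul_apply, smul_eq_mul, sub_mul, Finset.sum_sub_distrib,
      Finset.mul_sum, mul_assoc]
  refine ⟨φ q' / φ q, sub_eq_zero.1 (h z _ (fun c hc => ?_) ?_)⟩
  · rw [hlin _ c, hq c hc, hq' c hc, mul_zero, sub_zero]
  · rw [hlin _ j]
    have : φ q' - φ q' / φ q * φ q = 0 := by field_simp; ring
    rw [← this]
    simp only [φ, Pi.sub_apply, Pi.smul_apply, smul_eq_mul]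
    ring

/-- If both quantities are nonzero for some `q`, their ratio up to sign is a nonzero bad value of
`x`. If one of them is zero, whether the equation of column `j` holds does not depend on the nonzero
`x`, and the comparison with `x₀` gives `q = 0`. -/
theorem ControllableAt.forall_ne_zero_iff {p : StarPos (starPart M) → ℂ} {x₀ : ℂ}
    (h : ControllableAt M i j p x₀) : (∀ x, x ≠ 0 → ControllableAt M i j p x) ↔
      ∀ z q, IsNullVector (genPencil (starPart M) Sum.inl p z) j q →
        q i = 0 ∨ ∑ r, q r * genPencil (starPart M) Sum.inl p z r j = 0 := by
  simp only [controllableAt_iff] at h ⊢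
  constructor
  · intro H z q hq
    by_contra hne
    push Not at hne
    have := H _ (neg_ne_zero.2 (div_ne_zero hne.2 hne.1)) z q hq (by
      have := hne.1
      field_simp
      ring)
    exact hne.1 (by rw [this]; rfl)
  · intro H x hx z q hq hx'
    refine h z q hq ?_
    rcases H z q hq with h0 | h0
    · rw [h0, mul_zero] at hx' ⊢
      exact hx'
    · rw [h0, zero_add] at hx' ⊢
      rw [(mul_eq_zero.1 hx').resolve_left hx, mul_zero]

end SingleCross

/-! ### Matching numbers and injections -/

section MatchingNumber

variable {R C : Type*} [DecidableEq R]

theorem BipGraph.card_le_mt [DecidableEq C] {H : BipGraph R C} {T : Finset R} {ν : R → C} (hν : Set.InjOn ν T)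
    (hνe : ∀ r ∈ T, (r, ν r) ∈ H.edges) : T.card ≤ H.mt := by
  obtain ⟨N, hN⟩ := H.exists_isMaxMatching
  rw [hN.mt_eq, ← Finset.card_image_of_injective T
    (f := fun r => (r, ν r)) (fun r s h => (Prod.mk.inj h).1)]
  refine hN.2 _ ⟨?_, ?_⟩
  · intro e he
    obtain ⟨r, hr, rfl⟩ := Finset.mem_image.1 he
    exact hνe r hr
  · intro e he f hf hef
    obtain ⟨r, hr, rfl⟩ := Finset.mem_image.1 he
    obtain ⟨s, hs, rfl⟩ := Finset.mem_image.1 hf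
    have : r = s := hef.elim id (fun h => hν hr hs h)
    rw [this]

theorem BipGraph.exists_injOn_of_mt_eq [Nonempty C] {H : BipGraph R C}
    (h : H.mt = H.rows.card) :
    ∃ ν : R → C, Set.InjOn ν H.rows ∧ ∀ r ∈ H.rows, (r, ν r) ∈ H.edges := by
  classical
  obtain ⟨N, hN⟩ := H.exists_isMaxMatching
  have himg : N.image Prod.fst = H.rows := by
    refine Finset.eq_of_subset_of_card_le (fun r hr => ?_) ?_
    · obtain ⟨e, he, rfl⟩ := Finset.mem_image.1 hr
      exact (H.edges_mem e (hN.1.1 he)).1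
    · rw [← h, hN.mt_eq, Finset.card_image_of_injOn
        (fun e he f hf hef => hN.1.2 e he f hf (Or.inl hef))]
  have hex : ∀ r ∈ H.rows, ∃ c, (r, c) ∈ N := by
    intro r hr
    rw [← himg] at hr
    obtain ⟨e, he, rfl⟩ := Finset.mem_image.1 hr
    exact ⟨e.2, he⟩
  choose! ν hν using hex
  refine ⟨ν, fun r hr s hs hrs => ?_, fun r hr => hN.1.1 (hν r hr)⟩
  exact congrArg Prod.fst (hN.1.2 _ (hν r hr) _ (hν s hs) (Or.inr hrs))

end MatchingNumber

/-! ### Perfect matchings of the graphs of a controllable pair -/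

section SingleCross

variable {n m : ℕ} {M : Matrix (Fin n) (Fin n ⊕ Fin m) Entry} {i : Fin n} {j : Fin n ⊕ Fin m}
  {p : StarPos (starPart M) → ℂ} {x : ℂ}

/-- The pencil of a controllable pair has a row-perfect matching that avoids any given column. -/
theorem UniqueCross.exists_perfect_pencilGraphDel (hM : UniqueCross M i j)
    (h : ControllableAt M i j p x) :
    ∃ μ : Fin n → Fin n ⊕ Fin m, Function.Injective μ ∧
      ∀ r, (r, μ r) ∈ (pencilGraphDel M j).edges := by
  -- The `λ`-edges form a row-perfect matching. An obstruction to avoiding `j` is a set `X` of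
  -- states whose rows have nonzero entries only in the state columns of `X`: it is invariant and no
  -- input acts on it.
  rcases avoidable_or_exists_closed (adj := fun r c => (r, c) ∈ (pencilGraph M).edges)
    (μ := Sum.inl) Sum.inl_injective (fun r => mem_pencilGraph_edges.2 (Or.inr rfl))
    Finset.univ j with ⟨ν, hν, hνe⟩ | ⟨X, -, hX, s, hs, hsj⟩
  · exact ⟨ν, fun r s hrs => hν (by simp) (by simp) hrs, fun r => Finset.mem_filter.2
      (hνe r (Finset.mem_univ r))⟩
  · exfalso
    set N := ofParams (starPart M) p + Matrix.single i j x with hN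
    have hcl : ∀ r ∈ X, ∀ c, (∀ s ∈ X, Sum.inl s ≠ c) → N r c = 0 := by
      intro r hr c hc
      by_contra h0
      obtain ⟨s, hs, hsc⟩ := hX r hr c (mem_pencilGraph_edges.2 (Or.inl fun hz =>
        h0 (hM.ofParams_add_single_eq_zero p x hz)))
      exact hc s hs hsc
    have hzero : ∀ {l : ℕ} (v : Fin n → ℂ) (K : Matrix (Fin n) (Fin l) ℂ) (t : Fin l),
        (∀ r, v r * K r t = 0) → Matrix.vecMul v K t = 0 :=
      fun v K t ht => (Finset.sum_eq_zero fun r _ => ht r : ∑ r, v r * K r t = 0)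
    have hpow : ∀ k, ∀ t ∉ X, Matrix.vecMul (Pi.single s 1) (N.toCols₁ ^ k) t = 0 := by
      intro k
      induction k with
      | zero =>
        intro t ht
        rw [pow_zero, Matrix.vecMul_one, Pi.single_eq_of_ne]
        rintro rfl
        exact ht hs
      | succ k ih =>
        intro t ht
        rw [pow_succ, ← Matrix.vecMul_vecMul]
        refine hzero _ _ _ fun r => ?_
        by_cases hr : r ∈ X
        · rw [show N.toCols₁ r t = 0 from hcl r hr _ (fun s hs he => by
            cases he; exact ht hs), mul_zero]
        · rw [ih r hr, zero_mul]
    have h0 := (isControllable_iff_vecMul_ctrbMatrix _ _).1 h (Pi.single s 1)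
      ((vecMul_ctrbMatrix_eq_zero_iff _ _ _).2 fun k _ => by
        rw [← Matrix.vecMul_vecMul]
        ext t
        refine hzero _ _ _ fun r => ?_
        by_cases hr : r ∈ X
        · rw [show N.toCols₂ r t = 0 from hcl r hr _ (fun s _ => by simp), mul_zero]
        · rw [hpow k r hr, zero_mul])
    simpa using congrFun h0 s

/-- The graph of a controllable pair has a row-perfect matching. -/
theorem UniqueCross.exists_perfect_bipGraphOf (hM : UniqueCross M i j)
    (h : ControllableAt M i j p x) :
    ∃ ν : Fin n → Fin n ⊕ Fin m, Function.Injective ν ∧ ∀ r, M r (ν r) ≠ Entry.zero := by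
  have : Nonempty (Fin n ⊕ Fin m) := ⟨j⟩
  rcases exists_injOn_or_exists_sum_eq_zero (fun r c => M r c ≠ Entry.zero)
    (ofParams (starPart M) p + Matrix.single i j x)
    (fun r c h0 hz => h0 (hM.ofParams_add_single_eq_zero p x hz)) Finset.univ with
    ⟨ν, hν, hνe⟩ | ⟨q, hq0, -, hq⟩
  · exact ⟨ν, fun r s hrs => hν (by simp) (by simp) hrs, fun r => hνe r (Finset.mem_univ r)⟩
  · exfalso
    simp only [Matrix.add_apply, mul_add, Finset.sum_add_distrib, sum_mul_single] at hq
    -- A row dependency of [A, B] is a null vector at the eigenvalue 0.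
    have hgen : ∀ c, ∑ r, q r * genPencil (starPart M) Sum.inl p 0 r c =
        ∑ r, q r * ofParams (starPart M) p r c := by
      intro c
      rw [sum_mul_genPencil]
      rcases c with c | c <;> simp
    refine hq0 ((controllableAt_iff p x).1 h 0 q (fun c hc => ?_) ?_)
    · rw [hgen]
      simpa [hc] using hq c
    · rw [hgen]
      simpa using hq j

theorem condD1_iff {ν : Fin n → Fin n ⊕ Fin m} (hν : Function.Injective ν)
    (hνe : ∀ r, M r (ν r) ≠ Entry.zero) :
    CondD1 M j ↔ Avoidable (fun r c => M r c ≠ Entry.zero) Finset.univ j := by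
  have hmem : ∀ {r c}, (r, c) ∈ (bipGraphOf M).edges ↔ M r c ≠ Entry.zero := by
    intro r c
    simp [bipGraphOf]
  constructor
  · rintro ⟨N, hN, hNj⟩
    rw [BipGraph.isMaxMatching_iff_of_perfect hν.injOn (fun r _ => hmem.2 (hνe r))] at hN
    choose f hf using fun r => hN.2 r (Finset.mem_univ r)
    refine ⟨f, fun r _ s _ hrs => ?_, fun r _ => ⟨hmem.1 (hN.1.1 (hf r)), hNj _ (hf r)⟩⟩
    exact congrArg Prod.fst (hN.1.2 _ (hf r) _ (hf s) (Or.inr hrs))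
  · rintro ⟨f, hf, hfe⟩
    refine ⟨matchingOf f, isMaxMatching_matchingOf
      (fun r s hrs => hf (by simp) (by simp) hrs)
      (fun r => hmem.2 (hfe r (Finset.mem_univ r)).1), ?_⟩
    rintro ⟨r, c⟩ he
    rw [mem_matchingOf] at he
    exact he ▸ (hfe r (Finset.mem_univ r)).2

/-- A row-perfect matching loses at most two edges when a row and a column are deleted. The matching
number is thus `n - 1` or `n - 2`, and `n - 1` means that the other rows can all be matched off
column `j`. -/
theorem mt_delRow_delCol_add_two_iff {ν : Fin n → Fin n ⊕ Fin m} (hν : Function.Injective ν)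
    (hνe : ∀ r, M r (ν r) ≠ Entry.zero) (k : Fin n) :
    (((bipGraphOf M).delRow k).delCol j).mt + 2 = n ↔
      ¬ Avoidable (fun r c => M r c ≠ Entry.zero) (Finset.univ.erase k) j := by
  have : Nonempty (Fin n ⊕ Fin m) := ⟨j⟩
  set H := ((bipGraphOf M).delRow k).delCol j with hH
  have hrows : H.rows = Finset.univ.erase k := rfl
  have hcard : H.rows.card + 1 = n := by
    rw [hrows, Finset.card_erase_add_one (Finset.mem_univ k), Finset.card_univ, Fintype.card_fin]
  have hmem : ∀ {r c}, (r, c) ∈ H.edges ↔ (M r c ≠ Entry.zero ∧ r ≠ k) ∧ c ≠ j := by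
    intro r c
    simp [hH, BipGraph.delCol, BipGraph.delRow, bipGraphOf]
  constructor
  · rintro h ⟨f, hf, hfe⟩
    have := BipGraph.card_le_mt (H := H) (T := H.rows) hf (fun r hr =>
      hmem.2 ⟨⟨(hfe r hr).1, Finset.ne_of_mem_erase hr⟩, (hfe r hr).2⟩)
    omega
  · intro h
    have h1 : H.mt ≤ H.rows.card := by
      obtain ⟨N, hN⟩ := H.exists_isMaxMatching
      rw [hN.mt_eq]
      exact hN.1.card_le_rows
    have h2 : H.mt ≠ H.rows.card := by
      intro he
      obtain ⟨f, hf, hfe⟩ := BipGraph.exists_injOn_of_mt_eq he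
      exact h ⟨f, hf, fun r hr => ⟨(hmem.1 (hfe r hr)).1.1, (hmem.1 (hfe r hr)).2⟩⟩
    have h3 : H.rows.card ≤ H.mt + 1 := by
      have h4 := BipGraph.card_le_mt (H := H) (T := H.rows.filter (fun r => ν r ≠ j)) hν.injOn
        (fun r hr => hmem.2 ⟨⟨hνe r, Finset.ne_of_mem_erase (Finset.mem_filter.1 hr).1⟩,
          (Finset.mem_filter.1 hr).2⟩)
      have h5 := Finset.card_filter_add_card_filter_not (s := H.rows) (fun r => ν r ≠ j)
      have h6 : (H.rows.filter (fun r => ¬ ν r ≠ j)).card ≤ 1 := by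
        rw [Finset.card_le_one]
        intro a ha b hb
        have ha := (Finset.mem_filter.1 ha).2
        have hb := (Finset.mem_filter.1 hb).2
        push Not at ha hb
        exact hν (ha.trans hb.symm)
      omega
    omega

end SingleCross

/-! ### The conditions at `z = 0` and at `z ≠ 0` -/

section SingleCross

variable {n m : ℕ} {M : Matrix (Fin n) (Fin n ⊕ Fin m) Entry} {i : Fin n} {j : Fin n ⊕ Fin m}
  {p : StarPos (starPart M) → ℂ} {x : ℂ}

theorem UniqueCross.starPart_ne_star (hM : UniqueCross M i j) : starPart M i j ≠ Entry.star := by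
  rw [Ne, starPart_eq_star, (hM i j).2 ⟨rfl, rfl⟩]
  decide

theorem exists_pencilEdge_of_sum_ne_zero {z : ℂ} {q : Fin n → ℂ} {c : Fin n ⊕ Fin m}
    (h : ∑ r, q r * genPencil (starPart M) Sum.inl p z r c ≠ 0) :
    ∃ l, q l ≠ 0 ∧ PencilEdge (starPart M) Sum.inl z l c := by
  obtain ⟨l, -, hl⟩ := Finset.exists_ne_zero_of_sum_ne_zero h
  exact ⟨l, left_ne_zero_of_mul hl, by
    by_contra he
    exact hl (by rw [genPencil_eq_zero he, mul_zero])⟩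

/-- The pencil stays controllable at `0` if and only if one of the conditions d1, d2, d3 holds. -/
theorem UniqueCross.condD_iff (hM : UniqueCross M i j) (hp : AlgebraicIndependent ℚ p)
    (h : ControllableAt M i j p x) :
    (CondD1 M j ∨ CondD2 M i j ∨ CondD3 M i j) ↔
      ∀ q, IsNullVector (genPencil (starPart M) Sum.inl p 0) j q →
        q i = 0 ∨ ∑ r, q r * genPencil (starPart M) Sum.inl p 0 r j = 0 := by
  obtain ⟨ν₀, hν₀, hν₀e⟩ := hM.exists_perfect_bipGraphOf h
  have hstar : ∀ {r c}, c ≠ j → M r c ≠ Entry.zero → starPart M r c = Entry.star :=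
    fun hc h0 => (hM.ne_zero_iff.1 h0).resolve_right fun h' => hc h'.2
  -- At `z = 0` the structurally matched minors off column `j` never vanish, since 0 is algebraic.
  have hnonsing : ∀ {S : Finset (Fin n)} {ν : Fin n → Fin n ⊕ Fin m}, Set.InjOn ν S →
      (∀ r ∈ S, M r (ν r) ≠ Entry.zero ∧ ν r ≠ j) →
      (matchedMinor (genPencil (starPart M) Sum.inl p 0) S ν).det ≠ 0 := fun hν hνe =>
    det_matchedMinor_ne_zero_of_isAlgebraic hp isAlgebraic_zero hν
      (fun r hr => Or.inl (hstar (hνe r hr).2 (hνe r hr).1))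
  have hadj : ∀ r c, c ≠ j → genPencil (starPart M) Sum.inl p 0 r c ≠ 0 → M r c ≠ Entry.zero := by
    intro r c _ h0
    by_contra hz
    refine h0 (genPencil_eq_zero ?_)
    rintro (h1 | h1)
    · exact hM.ne_zero_iff.2 (Or.inl h1) hz
    · exact h1.1 rfl
  rw [condD1_iff hν₀ hν₀e, CondD2, CondD3, mt_delRow_delCol_add_two_iff hν₀ hν₀e]
  simp only [mt_delRow_delCol_add_two_iff hν₀ hν₀e]
  constructor
  · intro hD q hq
    by_contra hne
    push Not at hne
    obtain ⟨hqi, hφ⟩ := hne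
    have hq0 : q ≠ 0 := fun h0 => hqi (by rw [h0]; rfl)
    -- By uniqueness of `q`, no null vector vanishes at a row of its support; so the other rows are
    -- independent off column `j` and can be matched there. Hence d3 contradicts `q i ≠ 0`, and d2
    -- keeps the support off the other neighbours of column `j`.
    have hav : ∀ r, q r ≠ 0 →
        Avoidable (fun r c => M r c ≠ Entry.zero) (Finset.univ.erase r) j := by
      intro r hr
      refine (avoidable_or_exists_isNullVector _ _ j hadj _).resolve_right ?_
      rintro ⟨q', hq'0, hq's, hq'⟩
      obtain ⟨a, rfl⟩ := h.exists_eq_smul hq0 hq hq'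
      have := hq's r (Finset.notMem_erase r _)
      rw [Pi.smul_apply, smul_eq_mul] at this
      exact hq'0 (by rw [(mul_eq_zero.1 this).resolve_right hr, zero_smul])
    rcases hD with ⟨ν, hν, hνe⟩ | hD | hD
    · exact hnonsing hν hνe (det_matchedMinor_support hq ⟨i, Finset.mem_univ i, hqi⟩
        (fun s hs => (hνe s hs).2) (fun r hr => absurd (Finset.mem_univ r) hr))
    · obtain ⟨l, hl, hlj | hlj⟩ := exists_pencilEdge_of_sum_ne_zero hφ
      · refine hD l ?_ ?_ (hav l hl)
        · rintro rfl
          exact hM.starPart_ne_star hlj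
        · exact Finset.mem_filter.2 ⟨Finset.mem_univ _, hM.ne_zero_iff.2 (Or.inl hlj)⟩
      · exact hlj.1 rfl
    · exact hD (hav i hqi)
  · intro H
    by_contra hD
    push Not at hD
    obtain ⟨hD1, ⟨k, hki, hkj, hk⟩, hD3⟩ := hD
    obtain ⟨q, hq0, -, hq⟩ := (avoidable_or_exists_isNullVector _ _ j hadj _).resolve_left hD1
    -- Conversely, if the rows other than `r` can be matched off column `j`, they are independent
    -- there, so `q` cannot vanish at `r`.
    have hsupp : ∀ r, Avoidable (fun r c => M r c ≠ Entry.zero) (Finset.univ.erase r) j →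
        q r ≠ 0 := by
      rintro r ⟨ν, hν, hνe⟩ hr
      obtain ⟨s, hs⟩ := Function.ne_iff.1 hq0
      refine hnonsing hν hνe (det_matchedMinor_support hq
        ⟨s, Finset.mem_erase.2 ⟨?_, Finset.mem_univ s⟩, hs⟩
        (fun s hs => (hνe s hs).2) (fun t ht => ?_))
      · rintro rfl
        exact hs hr
      · have : t = r := by
          by_contra htr
          exact ht (Finset.mem_erase.2 ⟨htr, Finset.mem_univ t⟩)
        intro s _
        rw [this, hr, zero_mul]
    have hkstar : starPart M k j = Entry.star :=
      (hM.ne_zero_iff.1 (Finset.mem_filter.1 hkj).2).resolve_right fun h' => hki h'.1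
    refine (H q hq).elim (hsupp i hD3) (hq.sum_mul_ne_zero hp Sum.inl_injective hq0
      (fun q' => h.exists_eq_smul hq0 hq) ?_ (hsupp k hk) (Or.inl hkstar))
    rw [AlgebraicIndependent.matroid_closure_eq]
    exact zero_mem _

/-- The pencil stays controllable away from `0` if and only if one of the conditions e1, e2
holds. -/
theorem UniqueCross.condE_iff (hM : UniqueCross M i j) (hp : AlgebraicIndependent ℚ p)
    (h : ControllableAt M i j p x) {D : BlockLabels (Fin n) (Fin n ⊕ Fin m)}
    (hD : D.IsDMDecomposition (pencilGraphDel M j)) :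
    (CondE1 M i j D ∨ CondE2 M i j D) ↔
      ∀ z, z ≠ 0 → ∀ q, IsNullVector (genPencil (starPart M) Sum.inl p z) j q →
        q i = 0 ∨ ∑ r, q r * genPencil (starPart M) Sum.inl p z r j = 0 := by
  obtain ⟨μ, hμ, hadj⟩ := hM.exists_perfect_pencilGraphDel h
  have hL := hD.matchLabels hμ hadj
  have hPA : ∀ {z : ℂ}, z ≠ 0 → PencilAdj (starPart M) Sum.inl z j =
      fun r c => (r, c) ∈ (pencilGraphDel M j).edges := fun hz =>
    funext₂ fun r c => propext (hM.mem_pencilGraphDel hz).symm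
  have hOmega : ∀ {k l}, k ∈ OmegaRow M j D l ↔
      (D.IsSquare k ∧ GammaNZ M (D.comp (pencilGraphDel M j) k)) ∧
        l ∈ MatchLabels.reachSet (fun r c => (r, c) ∈ (pencilGraphDel M j).edges) μ D k :=
    fun {k l} => and_congr_right fun hk => hL.exists_not_covers_iff hμ hadj hk.1 l
  have hdelmax : ∀ {l N}, ((pencilGraphDel M j).delRow l).IsMaxMatching N →
      (pencilGraphDel M j).IsMatching N := fun hN =>
    ⟨hN.1.1.trans (Finset.filter_subset _ _), hN.1.2⟩
  constructor
  · intro hE z hz q hq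
    by_contra hne
    push Not at hne
    obtain ⟨hqi, hφ⟩ := hne
    have hq0 : q ≠ 0 := fun h0 => hqi (by rw [h0]; rfl)
    obtain ⟨k, hk, hdet, hsupp⟩ := hq.exists_component hp hμ
      (fun r => by rw [hPA hz]; exact hadj r) (by rw [hPA hz]; exact hL) hq0
      (fun q' => h.exists_eq_smul hq0 hq)
    rw [hPA hz] at hsupp
    -- Row `l` in the support means that `l` is reachable from the singular component `k`, that is,
    -- `k` belongs to Ω_j^l.
    have hΩ : ∀ l, q l ≠ 0 → k ∈ OmegaRow M j D l := fun l hl =>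
      hOmega.2 ⟨⟨hk, (hM.gammaNZ_iff hp hD hμ hadj hk).2 ⟨z, hz, hdet⟩⟩, (hsupp l).1 hl⟩
    rcases hE with hE | ⟨-, hji, hE⟩
    · have := hΩ i hqi
      rw [CondE1] at hE
      rw [hE] at this
      exact this
    · obtain ⟨l, hl, hlj⟩ := exists_pencilEdge_of_sum_ne_zero hφ
      have hli : l ≠ i := by
        rintro rfl
        exact hlj.elim hM.starPart_ne_star (fun h' => hji h'.2)
      obtain ⟨-, N, hN, hNk⟩ := hΩ l hl
      refine hNk ((hL.covers_unionComp_iff hμ hadj (hdelmax hN) _).1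
        (hE l hli (mem_pencilGraph_edges.2 ?_) N hN) k (hΩ i hqi))
      exact hlj.imp (fun h' => hM.ne_zero_iff.2 (Or.inl h')) (fun h' => h'.2)
  · intro H
    by_contra hE
    push Not at hE
    obtain ⟨hE1, hE2⟩ := hE
    -- If e1 and e2 fail, one component reaches both `i` and a row `l` that is structurally nonzero
    -- in column `j`. For `j = Sum.inl i` the `λ`-edge lets `l = i` serve.
    obtain ⟨k, l, hki, hkl, hlj⟩ : ∃ k l, k ∈ OmegaRow M j D i ∧ k ∈ OmegaRow M j D l ∧
        (starPart M l j = Entry.star ∨ j = Sum.inl l) := by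
      obtain ⟨k₀, hk₀⟩ := Set.nonempty_iff_ne_empty.2 hE1
      by_cases hji : j = Sum.inl i
      · exact ⟨k₀, i, hk₀, hk₀, Or.inr hji⟩
      · by_contra hno
        refine hE2 ⟨⟨k₀, hk₀⟩, hji, fun l hli hlj N hN => ?_⟩
        rw [hL.covers_unionComp_iff hμ hadj (hdelmax hN)]
        intro k hk
        by_contra hcov
        refine hno ⟨k, l, hk, ⟨hk.1, N, hN, hcov⟩, ?_⟩
        exact (mem_pencilGraph_edges.1 hlj).imp_left fun h0 =>
          (hM.ne_zero_iff.1 h0).resolve_right fun h' => hli h'.1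
    obtain ⟨⟨hk, hγ⟩, hi⟩ := hOmega.1 hki
    obtain ⟨-, hl⟩ := hOmega.1 hkl
    obtain ⟨z, hz, hdet⟩ := (hM.gammaNZ_iff hp hD hμ hadj hk).1 hγ
    have hPadj : ∀ r, PencilAdj (starPart M) Sum.inl z j r (μ r) := fun r => by
      rw [hPA hz]
      exact hadj r
    have hPL : MatchLabels (PencilAdj (starPart M) Sum.inl z j) μ D := by
      rw [hPA hz]
      exact hL
    obtain ⟨q, hq0, hq, -⟩ := hPL.exists_isNullVector hPadj hk.1 hdet
    obtain ⟨k', -, hdet', hsupp⟩ := hq.exists_component hp hμ hPadj hPL hq0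
      (fun q' => h.exists_eq_smul hq0 hq)
    -- Only one component is singular at `z`, so the support of `q` is the set reachable from the
    -- chosen `k`.
    obtain rfl := eq_of_det_labelRows_eq_zero hp hμ hPadj hdet hdet'
    rw [hPA hz] at hsupp
    refine (H z hz q hq).elim ((hsupp i).2 hi) (hq.sum_mul_ne_zero hp Sum.inl_injective hq0
      (fun q' => h.exists_eq_smul hq0 hq) ?_ ((hsupp l).2 hl)
      (hlj.imp_right fun h' => ⟨hz, h'⟩))
    -- The root `z` is algebraic over the parameters of the component, none of which lies in column
    -- `j`.
    refine (AlgebraicIndependent.matroid ℚ ℂ).closure_subset_closure (Set.image_mono ?_)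
      (mem_closure_of_det_matchedMinor_eq_zero hp hμ.injOn (fun r _ => (hPadj r).1) hdet)
    rintro e ⟨-, s, -, hs⟩
    exact fun hej => (hPadj s).2 (hs.trans hej)

end SingleCross

/-! ### The characterization of partial strong structural controllability -/

theorem theorem3 (n m : ℕ) (A : Matrix (Fin n) (Fin n) Entry) (B : Matrix (Fin n) (Fin m) Entry)
    (i : Fin n) (j : Fin n ⊕ Fin m)
    (hcross : ∀ k l, Matrix.fromCols A B k l = Entry.cross ↔ k = i ∧ l = j)
    (D : BlockLabels (Fin n) (Fin n ⊕ Fin m))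
    (hD : D.IsDMDecomposition (pencilGraphDel (Matrix.fromCols A B) j)) :
    IsPSSC A B ↔
      IsStructurallyControllable A B ∧
      (CondD1 (Matrix.fromCols A B) j ∨ CondD2 (Matrix.fromCols A B) i j ∨
        CondD3 (Matrix.fromCols A B) i j) ∧
      (CondE1 (Matrix.fromCols A B) i j D ∨ CondE2 (Matrix.fromCols A B) i j D) := by
  have hM : UniqueCross (Matrix.fromCols A B) i j := hcross
  have key : ∀ p : StarPos (starPart (Matrix.fromCols A B)) → ℂ, AlgebraicIndependent ℚ p →
      ∀ x, ControllableAt (Matrix.fromCols A B) i j p x →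
      ((∀ x, x ≠ 0 → ControllableAt (Matrix.fromCols A B) i j p x) ↔
        (CondD1 (Matrix.fromCols A B) j ∨ CondD2 (Matrix.fromCols A B) i j ∨
          CondD3 (Matrix.fromCols A B) i j) ∧
        (CondE1 (Matrix.fromCols A B) i j D ∨ CondE2 (Matrix.fromCols A B) i j D)) := by
    intro p hp x hx
    rw [hx.forall_ne_zero_iff, hM.condD_iff hp hx, hM.condE_iff hp hx hD]
    refine ⟨fun h => ⟨h 0, fun z _ => h z⟩, fun h z => ?_⟩
    by_cases hz : z = 0
    · rw [hz]
      exact h.1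
    · exact h.2 z hz
  rw [hM.isPSSC_iff]
  constructor
  · intro h
    -- The graph conditions do not involve `p`, so a single generic point suffices for this
    -- direction.
    obtain ⟨p, hp, hpA⟩ := (h.and ae_algebraicIndependent).exists
    exact ⟨(hp 1 one_ne_zero).isStructurallyControllable hM,
      (key p hpA 1 (hp 1 one_ne_zero)).1 hp⟩
  · rintro ⟨h1, h2⟩
    filter_upwards [h1.ae_controllableAt hM, ae_algebraicIndependent] with p ⟨x, hx⟩ hp
    exact (key p hp x hx).2 h2
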